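/- **Setting.** Let $n$ workers and $p$ firms be given, with fixed types $k_i,\ell_j\in\{1,\dots,K\}$, $K\ge1$, every worker type having $n_k\ge 1$ workers. Let $C\in\mathbb R^{K\times K}$ have non-negative entries, and let $\theta_j\ge0$ with $\sum_{j:\ell_j=\ell}\theta_j=1$ for every $\ell$. Assume $p_{ij}:=\theta_jC(k_i,\ell_j)/n_{k_i}\le 1$, and let the entries $d_{ij}$ of the $n\times p$ matrix $B$ be independent Bernoulli$(p_{ij})$ variables ($d_{ij}=1$ means that $i$ and $j$ are matched). There is one outcome per match, $Y=W\mu+F\phi+U$, where $W$ and $F$ are the matrices of worker and firm dummies. Here $\mu_i=\mu^*_{k_i}+U_{w,i}$ and $\phi_j=\phi^*_{\ell_j}+U_{f,j}$ with $\mu^*,\phi^*\in\mathbb R^K$ fixed; the components of $U_w,U_f,U$ are independent of each other and of the network, have mean zero, and have variances $\sigma_w^2,\sigma_f^2,\sigma^2$. For $\lambda_w,\lambda_f>0$ the ridge estimator is $$\begin{pmatrix}\widehat\mu\\ \widehat\phi\end{pmatrix}=\begin{pmatrix}W^\top W+\lambda_wI_n&W^\top F\\F^\top W&F^\top F+\lambda_fI_p\end{pmatrix}^{-1}\begin{pmatrix}W^\top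 Y\\F^\top Y\end{pmatrix}.$$ Let $V_{w,\lambda}$ and $V_{f,\lambda}$ be the conditional variance matrices of $\widehat\mu-\mu$ and $\widehat\phi-\phi$ given the network $(W,F)$. Put $\mathfrak B=(p_{ij})$, $\mathfrak D_w=\mathrm{diag}(\sum_jp_{ij}+\lambda_w)$, $\mathfrak D_f=\mathrm{diag}(\sum_ip_{ij}+\lambda_f)$, $\mathfrak L_w=\mathfrak D_w-\mathfrak B\mathfrak D_f^{-1}\mathfrak B^\top$, $\mathfrak L_f=\mathfrak D_f-\mathfrak B^\top\mathfrak D_w^{-1}\mathfrak B$, $a_w=\lambda_w^2\sigma_w^2-\lambda_w\sigma^2$, $a_f=\lambda_f^2\sigma_f^2-\lambda_f\sigma^2$, and $$\mathfrak V_{w,\lambda}=\sigma^2\mathfrak L_w^{-1}+\mathfrak L_w^{-1}\left[a_wI_n+a_f\mathfrak B\mathfrak D_f^{-2}\mathfrak B^\top\right]\mathfrak L_w^{-1},\qquad \mathfrak V_{f,\lambda}=\sigma^2\mathfrak L_f^{-1}+\mathfrak L_f^{-1}\left[a_fI_p+a_w\mathfrak B^\top\mathfrak D_w^{-2}\mathfrak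 B\right]\mathfrak L_f^{-1}.$$ Let $\underline\delta_w,\overline\delta_w$ be the minimum and maximum over $k$ of $\frac1{n_k}\sum_\ell C(k,\ell)$, and $\underline\delta_f,\overline\delta_f$ the minimum and maximum over $j$ of $\theta_j\sum_kC(k,\ell_j)$. Let $M=\max\{(\underline\delta_w+\lambda_w)^{-1},(\underline\delta_f+\lambda_f)^{-1}\}$, $\gamma=p/n$, $\chi_w=\max(1,\overline\delta_f/(\underline\delta_w+\lambda_w))$, $\chi_f=\max(1,\overline\delta_w/(\underline\delta_f+\lambda_f))$, and $$T_w=2\left(\sqrt{\chi_w}+2\sqrt{\tfrac{\overline\delta_f+\lambda_f}{\lambda_w}}\right),\qquad T_f=2\left(\sqrt{\chi_f}+2\sqrt{\tfrac{\overline\delta_w+\lambda_w}{\lambda_f}}\right).$$ **Theorem.** Let $\epsilon>0$ satisfy $M\le\left(3\ln\frac{n+p}\epsilon\right)^{-1}$ with $\ln\frac{n+p}{\epsilon}>0$, and let $t=\sqrt{3M\ln\frac{n+p}\epsilon}\le 1$. Let $\|\cdot\|$ be the spectral norm. With probability at least $1-\frac{13+6\gamma}{1+\gamma}\epsilon$,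 the inequality $$\begin{aligned}\|V_{w,\lambda}-\mathfrak V_{w,\lambda}\|\le{}&\sigma^2\left(5+16\tfrac{\overline\delta_w+\lambda_w}{\underline\delta_w+\lambda_w}\right)\tfrac{\overline\delta_w+\lambda_w}{\lambda_w^2}t+|a_w|\left(\tfrac2{\lambda_w}+\tfrac1{\underline\delta_w+\lambda_w}\right)\left(5+16\tfrac{\overline\delta_w+\lambda_w}{\underline\delta_w+\lambda_w}\right)\tfrac{(\overline\delta_w+\lambda_w)^2}{\lambda_w^3}t\\&+|a_f|\left(\tfrac4{\lambda_w}\sqrt{\tfrac1{\lambda_f}}+\tfrac1{\underline\delta_w+\lambda_w}\sqrt{\tfrac1{\underline\delta_f+\lambda_f}}\right)\tfrac{(\overline\delta_w+\lambda_w)^{5/2}}{\lambda_w^3}\left[\left(5+16\tfrac{\overline\delta_w+\lambda_w}{\underline\delta_w+\lambda_w}\right)\sqrt{\tfrac{\overline\delta_w+\lambda_w}{\underline\delta_f+\lambda_f}}+T\right]t\end{aligned}$$ holds both for $T=T_f$ and for $T=T_w$. With probability at least $1-\frac{5+13\gamma}{1+\gamma}\epsilon$, $$\begin{aligned}\|V_{f,\lambda}-\mathfrak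 V_{f,\lambda}\|\le{}&\sigma^2\left(5+16\tfrac{\overline\delta_f+\lambda_f}{\underline\delta_f+\lambda_f}\right)\tfrac{\overline\delta_f+\lambda_f}{\lambda_f^2}t+|a_f|\left(\tfrac2{\lambda_f}+\tfrac1{\underline\delta_f+\lambda_f}\right)\left(5+16\tfrac{\overline\delta_f+\lambda_f}{\underline\delta_f+\lambda_f}\right)\tfrac{(\overline\delta_f+\lambda_f)^2}{\lambda_f^3}t\\&+|a_w|\left(\tfrac4{\lambda_f}\sqrt{\tfrac1{\lambda_w}}+\tfrac1{\underline\delta_f+\lambda_f}\sqrt{\tfrac1{\underline\delta_w+\lambda_w}}\right)\tfrac{(\overline\delta_f+\lambda_f)^{5/2}}{\lambda_f^3}\left[\left(5+16\tfrac{\overline\delta_f+\lambda_f}{\underline\delta_f+\lambda_f}\right)\sqrt{\tfrac{\overline\delta_f+\lambda_f}{\underline\delta_w+\lambda_w}}+T_w\right]t.\end{aligned}$$ -/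

import Mathlib

open MeasureTheory ProbabilityTheory Matrix

noncomputable section

namespace RidgeFE

/-! ### Degree-corrected bipartite stochastic block model -/

/-- Parameters of the model with `n` workers, `p` firms and `K` groups on each side: types `k_i`
and `ℓ_j`, firm weights `θ_j` (a probability vector inside each firm group), affinity matrix `C`.
Every worker group is non-empty, and `p_{ij} = θ_j C(k_i, ℓ_j) / n_{k_i}` is a probability. -/
structure BlockModel (n p K : ℕ) where
  wType : Fin n → Fin K
  fType : Fin p → Fin K
  θ : Fin p → ℝ
  C : Matrix (Fin K) (Fin K) ℝ
  wType_surjective : Function.Surjective wType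
  θ_nonneg : ∀ j, 0 ≤ θ j
  θ_sum : ∀ l, ∑ j with fType j = l, θ j = 1
  C_nonneg : ∀ k l, 0 ≤ C k l
  prob_le_one : ∀ i j,
    θ j * C (wType i) (fType j) / ((Finset.univ.filter fun i' => wType i' = wType i).card : ℝ) ≤ 1

namespace BlockModel

variable {n p K : ℕ} (S : BlockModel n p K)

/-- `n_k`, the number of workers of type `k`. -/
def groupSize (k : Fin K) : ℕ := (Finset.univ.filter fun i => S.wType i = k).card

/-- The matrix of edge probabilities `p_{ij}`, i.e. the expected adjacency matrix. -/
def meanAdj : Matrix (Fin n) (Fin p) ℝ :=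
  Matrix.of fun i j => S.θ j * S.C (S.wType i) (S.fType j) / (S.groupSize (S.wType i) : ℝ)

/-- Expected degree `C(k, ·) / n_k` of a worker of type `k`. -/
def wDeg (k : Fin K) : ℝ := (∑ l, S.C k l) / (S.groupSize k : ℝ)

/-- Expected degree `θ_j C(·, ℓ_j)` of firm `j`. -/
def fDeg (j : Fin p) : ℝ := S.θ j * ∑ k, S.C k (S.fType j)

/-- Minimum and maximum expected worker and firm degrees. -/
def wDegMin : ℝ := ⨅ k, S.wDeg k
def wDegMax : ℝ := ⨆ k, S.wDeg k
def fDegMin : ℝ := ⨅ j, S.fDeg j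
def fDegMax : ℝ := ⨆ j, S.fDeg j

/-- `M = max (M_w, M_f)`. -/
def maxM (lamW lamF : ℝ) : ℝ := max (S.wDegMin + lamW)⁻¹ (S.fDegMin + lamF)⁻¹

/-- `t = √(3 M log ((n + p) / ε))`. -/
def rate (lamW lamF ε : ℝ) : ℝ :=
  Real.sqrt (3 * S.maxM lamW lamF * Real.log (((n : ℝ) + p) / ε))

/-- `χ_w = max (1, δ̄_f / (δ̲_w + λ_w))`. -/
def chiW (lamW : ℝ) : ℝ := max 1 (S.fDegMax / (S.wDegMin + lamW))

/-- `χ_f = max (1, δ̄_w / (δ̲_f + λ_f))`. -/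
def chiF (lamF : ℝ) : ℝ := max 1 (S.wDegMax / (S.fDegMin + lamF))

end BlockModel

/-! ### Deterministic equivalents of the variance matrices -/

section Equivalents

variable {n p : ℕ}

/-- Regularized diagonal matrix of row sums, `diag (∑_j A_{ij}) + λ_w I`. -/
def rowDegree (lamW : ℝ) (A : Matrix (Fin n) (Fin p) ℝ) : Matrix (Fin n) (Fin n) ℝ :=
  Matrix.diagonal fun i => (∑ j, A i j) + lamW

/-- Regularized diagonal matrix of column sums, `diag (∑_i A_{ij}) + λ_f I`. -/
def colDegree (lamF : ℝ) (A : Matrix (Fin n) (Fin p) ℝ) : Matrix (Fin p) (Fin p) ℝ :=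
  Matrix.diagonal fun j => (∑ i, A i j) + lamF

/-- Regularized un-normalized worker Laplacian of the weighted bipartite graph `A`. -/
def wLaplacian (lamW lamF : ℝ) (A : Matrix (Fin n) (Fin p) ℝ) : Matrix (Fin n) (Fin n) ℝ :=
  rowDegree lamW A - A * (colDegree lamF A)⁻¹ * Aᵀ

/-- Regularized un-normalized firm Laplacian of the weighted bipartite graph `A`. -/
def fLaplacian (lamW lamF : ℝ) (A : Matrix (Fin n) (Fin p) ℝ) : Matrix (Fin p) (Fin p) ℝ :=
  colDegree lamF A - Aᵀ * (rowDegree lamW A)⁻¹ * A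

/-- `𝔙_{w,λ}`, for `A` the expected adjacency matrix. -/
def wVarianceEquiv (lamW lamF σ σw σf : ℝ) (A : Matrix (Fin n) (Fin p) ℝ) :
    Matrix (Fin n) (Fin n) ℝ :=
  σ ^ 2 • (wLaplacian lamW lamF A)⁻¹ +
    (wLaplacian lamW lamF A)⁻¹ *
      ((lamW ^ 2 * σw ^ 2 - lamW * σ ^ 2) • (1 : Matrix (Fin n) (Fin n) ℝ) +
        (lamF ^ 2 * σf ^ 2 - lamF * σ ^ 2) •
          (A * ((colDegree lamF A)⁻¹ * (colDegree lamF A)⁻¹) * Aᵀ)) *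
      (wLaplacian lamW lamF A)⁻¹

/-- `𝔙_{f,λ}`, for `A` the expected adjacency matrix. -/
def fVarianceEquiv (lamW lamF σ σw σf : ℝ) (A : Matrix (Fin n) (Fin p) ℝ) :
    Matrix (Fin p) (Fin p) ℝ :=
  σ ^ 2 • (fLaplacian lamW lamF A)⁻¹ +
    (fLaplacian lamW lamF A)⁻¹ *
      ((lamF ^ 2 * σf ^ 2 - lamF * σ ^ 2) • (1 : Matrix (Fin p) (Fin p) ℝ) +
        (lamW ^ 2 * σw ^ 2 - lamW * σ ^ 2) •
          (Aᵀ * ((rowDegree lamW A)⁻¹ * (rowDegree lamW A)⁻¹) * A)) *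
      (fLaplacian lamW lamF A)⁻¹

end Equivalents

/-! ### The two-way fixed effect regression on a network and its ridge estimator -/

section Estimator

variable {n p : ℕ}

/-- A bipartite network: `g i j = true` when worker `i` is matched to firm `j`. -/
abbrev Network (n p : ℕ) : Type := Fin n → Fin p → Bool

/-- The observations: one per match. -/
abbrev Obs (g : Network n p) : Type := {e : Fin n × Fin p // g e.1 e.2 = true}

/-- The design matrix `W` of worker dummies. -/
def designW (g : Network n p) : Matrix (Obs g) (Fin n) ℝ :=
  Matrix.of fun e i => if e.1.1 = i then 1 else 0

/-- The design matrix `F` of firm dummies. -/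
def designF (g : Network n p) : Matrix (Obs g) (Fin p) ℝ :=
  Matrix.of fun e j => if e.1.2 = j then 1 else 0

/-- The outcome vector `Y = W μ + F φ + U`; only the errors of realized matches enter. -/
def outcome (g : Network n p) (mu : Fin n → ℝ) (phi : Fin p → ℝ) (u : Fin n × Fin p → ℝ) :
    Obs g → ℝ :=
  designW g *ᵥ mu + designF g *ᵥ phi + fun e => u e.1

/-- The ridge estimator `(μ̂, φ̂)` computed from the network `g` and the outcomes `Y`. -/
def ridge (lamW lamF : ℝ) (g : Network n p) (Y : Obs g → ℝ) : Fin n ⊕ Fin p → ℝ :=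
  (Matrix.fromBlocks
      ((designW g)ᵀ * designW g + lamW • (1 : Matrix (Fin n) (Fin n) ℝ))
      ((designW g)ᵀ * designF g)
      ((designF g)ᵀ * designW g)
      ((designF g)ᵀ * designF g + lamF • (1 : Matrix (Fin p) (Fin p) ℝ)))⁻¹ *ᵥ
    Sum.elim ((designW g)ᵀ *ᵥ Y) ((designF g)ᵀ *ᵥ Y)

end Estimator

/-! ### The random model and the conditional variances -/

section Random

variable {n p K : ℕ} {Ω : Type*} [MeasurableSpace Ω]

/-- The edges are independent Bernoulli variables with the probabilities of the block model. The
components of the worker effects, of the firm effects and of the regression errors are independent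
of each other and of the network, with mean zero and variances `σw ^ 2`, `σf ^ 2`, `σ ^ 2`. -/
structure IsRandomModel (S : BlockModel n p K) (P : Measure Ω) (net : Ω → Network n p)
    (Uw : Fin n → Ω → ℝ) (Uf : Fin p → Ω → ℝ) (U : Fin n × Fin p → Ω → ℝ)
    (σ σw σf : ℝ) : Prop where
  net_measurable : Measurable net
  net_law : ∀ i j, P {ω | net ω i j = true} = ENNReal.ofReal (S.meanAdj i j)
  net_indep : iIndepFun (fun (e : Fin n × Fin p) ω => net ω e.1 e.2) P
  Uw_measurable : ∀ i, Measurable (Uw i)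
  Uf_measurable : ∀ j, Measurable (Uf j)
  U_measurable : ∀ e, Measurable (U e)
  Uw_memLp : ∀ i, MemLp (Uw i) 2 P
  Uf_memLp : ∀ j, MemLp (Uf j) 2 P
  U_memLp : ∀ e, MemLp (U e) 2 P
  Uw_mean : ∀ i, ∫ ω, Uw i ω ∂P = 0
  Uf_mean : ∀ j, ∫ ω, Uf j ω ∂P = 0
  U_mean : ∀ e, ∫ ω, U e ω ∂P = 0
  Uw_var : ∀ i, variance (Uw i) P = σw ^ 2
  Uf_var : ∀ j, variance (Uf j) P = σf ^ 2
  U_var : ∀ e, variance (U e) P = σ ^ 2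
  noise_indep : iIndepFun (Sum.elim Uw (Sum.elim Uf U)) P
  net_indep_noise : IndepFun net (fun ω a => Sum.elim Uw (Sum.elim Uf U) a ω) P

/-- The true fixed effects `(μ, φ)` with `μ = Z_w μ* + U_w` and `φ = Z_f φ* + U_f`. -/
def effects (S : BlockModel n p K) (muStar phiStar : Fin K → ℝ)
    (Uw : Fin n → Ω → ℝ) (Uf : Fin p → Ω → ℝ) (ω : Ω) : Fin n ⊕ Fin p → ℝ :=
  Sum.elim (fun i => muStar (S.wType i) + Uw i ω) (fun j => phiStar (S.fType j) + Uf j ω)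

/-- The estimation error `(μ̂ - μ, φ̂ - φ)`. -/
def ridgeError (S : BlockModel n p K) (muStar phiStar : Fin K → ℝ) (lamW lamF : ℝ)
    (net : Ω → Network n p) (Uw : Fin n → Ω → ℝ) (Uf : Fin p → Ω → ℝ)
    (U : Fin n × Fin p → Ω → ℝ) (a : Fin n ⊕ Fin p) (ω : Ω) : ℝ :=
  ridge lamW lamF (net ω)
      (outcome (net ω) (fun i => effects S muStar phiStar Uw Uf ω (Sum.inl i))
        (fun j => effects S muStar phiStar Uw Uf ω (Sum.inr j)) (fun e => U e ω)) a
    - effects S muStar phiStar Uw Uf ω a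

/-- The conditional variance matrix of a random vector `Z` given a sub-σ-algebra `m`. -/
def condVarMatrix {ι : Type*} (P : Measure Ω) (m : MeasurableSpace Ω) (Z : ι → Ω → ℝ) (ω : Ω) :
    Matrix ι ι ℝ :=
  Matrix.of fun a b =>
    (P[fun ω' => (Z a ω' - (P[Z a | m]) ω') * (Z b ω' - (P[Z b | m]) ω') | m]) ω

/-- `V_{w,λ}`, the conditional variance matrix of `μ̂ - μ` given the network. -/
def wVariance (S : BlockModel n p K) (P : Measure Ω) (muStar phiStar : Fin K → ℝ) (lamW lamF : ℝ)
    (net : Ω → Network n p) (Uw : Fin n → Ω → ℝ) (Uf : Fin p → Ω → ℝ)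
    (U : Fin n × Fin p → Ω → ℝ) (ω : Ω) : Matrix (Fin n) (Fin n) ℝ :=
  condVarMatrix P (MeasurableSpace.comap net inferInstance)
    (fun i => ridgeError S muStar phiStar lamW lamF net Uw Uf U (Sum.inl i)) ω

/-- `V_{f,λ}`, the conditional variance matrix of `φ̂ - φ` given the network. -/
def fVariance (S : BlockModel n p K) (P : Measure Ω) (muStar phiStar : Fin K → ℝ) (lamW lamF : ℝ)
    (net : Ω → Network n p) (Uw : Fin n → Ω → ℝ) (Uf : Fin p → Ω → ℝ)
    (U : Fin n × Fin p → Ω → ℝ) (ω : Ω) : Matrix (Fin p) (Fin p) ℝ :=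
  condVarMatrix P (MeasurableSpace.comap net inferInstance)
    (fun j => ridgeError S muStar phiStar lamW lamF net Uw Uf U (Sum.inr j)) ω

end Random

/-! ### Norm and bounds -/

open scoped Matrix.Norms.L2Operator in
/-- The spectral norm of a square matrix (operator norm for the Euclidean norm). -/
def specNorm {m : ℕ} (A : Matrix (Fin m) (Fin m) ℝ) : ℝ := ‖A‖

/-- The common shape of the two bounds: `lo`, `hi`, `lam` are the extreme expected degrees and the
ridge parameter of the side considered, `lo'`, `lam'` the minimum expected degree and the ridge
parameter of the other side; `own`, `other` are the values of `λ² s² - λ σ²` for the two sides. -/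
def varianceBound (σ own other lo hi lam lo' lam' tail t : ℝ) : ℝ :=
  σ ^ 2 * (5 + 16 * ((hi + lam) / (lo + lam))) * ((hi + lam) / lam ^ 2) * t
  + |own| * (2 / lam + 1 / (lo + lam)) * (5 + 16 * ((hi + lam) / (lo + lam)))
      * ((hi + lam) ^ 2 / lam ^ 3) * t
  + |other| * (4 * (1 / lam) * Real.sqrt (1 / lam') + 1 / (lo + lam) * Real.sqrt (1 / (lo' + lam')))
      * ((hi + lam) ^ (5 / 2 : ℝ) / lam ^ 3)
      * ((5 + 16 * ((hi + lam) / (lo + lam))) * Real.sqrt ((hi + lam) / (lo' + lam')) + tail) * t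

namespace BlockModel

variable {n p K : ℕ} (S : BlockModel n p K)

/-- `2 (√χ_w + 2 √((δ̄_f + λ_f) / λ_w))`. -/
def tailW (lamW lamF : ℝ) : ℝ :=
  2 * (Real.sqrt (S.chiW lamW) + 2 * Real.sqrt ((S.fDegMax + lamF) / lamW))

/-- `2 (√χ_f + 2 √((δ̄_w + λ_w) / λ_f))`. -/
def tailF (lamW lamF : ℝ) : ℝ :=
  2 * (Real.sqrt (S.chiF lamF) + 2 * Real.sqrt ((S.wDegMax + lamW) / lamF))

/-- The bound on the worker side, with a given last summand `tail` inside the square bracket. -/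
def wBound (lamW lamF σ σw σf ε tail : ℝ) : ℝ :=
  varianceBound σ (lamW ^ 2 * σw ^ 2 - lamW * σ ^ 2) (lamF ^ 2 * σf ^ 2 - lamF * σ ^ 2)
    S.wDegMin S.wDegMax lamW S.fDegMin lamF tail (S.rate lamW lamF ε)

/-- The bound on the firm side, with a given last summand `tail` inside the square bracket. -/
def fBound (lamW lamF σ σw σf ε tail : ℝ) : ℝ :=
  varianceBound σ (lamF ^ 2 * σf ^ 2 - lamF * σ ^ 2) (lamW ^ 2 * σw ^ 2 - lamW * σ ^ 2)
    S.fDegMin S.fDegMax lamF S.wDegMin lamW tail (S.rate lamW lamF ε)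

end BlockModel

end RidgeFE

end

/-! Given the network, the estimation error is affine in the noise. Its covariance is `σ² H⁻¹ + H⁻¹
diag(a_w, a_f) H⁻¹`, where `H` is the matrix of the penalized normal equations. Block inversion
shows that the diagonal blocks are exactly the formulas for the deterministic equivalents, evaluated
at the realized adjacency matrix `A` instead of its mean `A₀` (`ridge_sub_eq`,
`noise_covariance_eq`, `jointVariance_toBlocks₁₁`). The theorem thus compares one matrix function at
`A` and at `A₀`.

Deterministic half: the regularized Laplacian dominates `λ_w I` for every non-negative weighted
graph, so its inverse has norm at most `1 / λ_w`. Resolvent and product identities then make the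
difference linear in the relative errors of the degrees and in the normalized centered adjacency
matrix. This is done for `t ≤ 1/10`; for larger `t` the a priori bounds suffice
(`norm_wLaplacian_inv_sub`, `norm_gram_sub`, `norm_wVarianceEquiv_sub`).

Probabilistic half: degrees are handled by Chernoff bounds. The spectral norm is handled by a trace
moment of order `2⌈L⌉`, `L = log((n+p)/ε)`. Resampling one edge gives an exchangeable pair, and a
mean value inequality for traces bounds the moment by that of a diagonal square function. Edge
matrices have diagonal squares, so only scalar moments of degrees remain (`expect_trace_pow_le`,
`expect_degree_pow_le`, `prob_norm_normalized_le`).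

Upper degrees, lower degrees and norm each fail with probability at most `ε`. The coefficients of
`ε` in the theorem are at least 5, so `ε ≥ 1/5` is trivial, and `ε < 1/5` ensures `L ≥ 2`. The bound
already holds without the summand `T`, hence for every non-negative `T`. -/

noncomputable section

namespace RidgeFE

open scoped Matrix.Norms.L2Operator

/-! ### Spectral norm estimates for real matrices -/

section Norms

variable {ι κ : Type*} [Fintype ι] [Fintype κ] [DecidableEq κ]

theorem opNorm_le_of_sum_sq_le {A : Matrix ι κ ℝ} {c : ℝ} (hc : 0 ≤ c)
    (h : ∀ x : κ → ℝ, ∑ i, (A *ᵥ x) i ^ 2 ≤ c ^ 2 * ∑ j, x j ^ 2) : ‖A‖ ≤ c := by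
  rw [Matrix.l2_opNorm_def]
  refine ContinuousLinearMap.opNorm_le_bound _ hc fun x => ?_
  refine (sq_le_sq₀ (norm_nonneg _) (by positivity)).mp ?_
  rw [mul_pow, EuclideanSpace.norm_sq_eq, EuclideanSpace.norm_sq_eq]
  simpa using h x

theorem sum_sq_mulVec_le (A : Matrix ι κ ℝ) (x : κ → ℝ) :
    ∑ i, (A *ᵥ x) i ^ 2 ≤ ‖A‖ ^ 2 * ∑ j, x j ^ 2 := by
  have h := Matrix.l2_opNorm_mulVec A (WithLp.toLp 2 x)
  have h2 := (sq_le_sq₀ (norm_nonneg _) (by positivity)).mpr h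
  rw [mul_pow, EuclideanSpace.norm_sq_eq, EuclideanSpace.norm_sq_eq] at h2
  simpa using h2

/-- Weighted Schur test for a matrix with non-negative entries. -/
theorem opNorm_le_one_of_row_col {B : Matrix ι κ ℝ} (hB : ∀ i j, 0 ≤ B i j) {d : ι → ℝ} {e : κ → ℝ}
    (hd : ∀ i, 0 < d i) (he : ∀ j, 0 < e j) (hdB : ∀ i, ∑ j, B i j ≤ d i)
    (heB : ∀ j, ∑ i, B i j ≤ e j) :
    ‖(Matrix.of fun i j => B i j / (√(d i) * √(e j)) : Matrix ι κ ℝ)‖ ≤ 1 := by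
  refine opNorm_le_of_sum_sq_le zero_le_one fun x => ?_
  rw [one_pow, one_mul]
  -- Cauchy–Schwarz in row `i` with weights `B i j` uses up the row bound; the column bound is spent
  -- when the rows are summed.
  have key : ∀ i, ((Matrix.of fun i j => B i j / (√(d i) * √(e j)) : Matrix ι κ ℝ) *ᵥ x) i ^ 2
      ≤ ∑ j, B i j * (x j ^ 2 / e j) := by
    intro i
    have h1 : ((Matrix.of fun i j => B i j / (√(d i) * √(e j)) : Matrix ι κ ℝ) *ᵥ x) i
        = (√(d i))⁻¹ * ∑ j, B i j * (x j / √(e j)) := by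
      simp only [mulVec, dotProduct, of_apply, Finset.mul_sum]
      refine Finset.sum_congr rfl fun j _ => ?_
      have := (Real.sqrt_pos.mpr (hd i)).ne'
      have := (Real.sqrt_pos.mpr (he j)).ne'
      field_simp
    have h2 : (∑ j, B i j * (x j / √(e j))) ^ 2 ≤ (∑ j, B i j) * ∑ j, B i j * (x j ^ 2 / e j) := by
      refine Finset.sum_sq_le_sum_mul_sum_of_sq_le_mul _ (fun j _ => hB i j)
        (fun j _ => mul_nonneg (hB i j) (div_nonneg (sq_nonneg _) (he j).le)) fun j _ => le_of_eq ?_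
      rw [mul_pow, div_pow, Real.sq_sqrt (he j).le]
      ring
    have h3 : 0 ≤ ∑ j, B i j * (x j ^ 2 / e j) :=
      Finset.sum_nonneg fun j _ => mul_nonneg (hB i j) (div_nonneg (sq_nonneg _) (he j).le)
    rw [h1, mul_pow, inv_pow, Real.sq_sqrt (hd i).le, ← div_eq_inv_mul, div_le_iff₀ (hd i)]
    calc _ ≤ _ := h2
      _ ≤ d i * ∑ j, B i j * (x j ^ 2 / e j) := by gcongr; exact hdB i
      _ = _ := mul_comm _ _
  calc _ ≤ ∑ i, ∑ j, B i j * (x j ^ 2 / e j) := Finset.sum_le_sum fun i _ => key i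
    _ = ∑ j, (∑ i, B i j) * (x j ^ 2 / e j) := by
      rw [Finset.sum_comm]; simp_rw [Finset.sum_mul]
    _ ≤ ∑ j, e j * (x j ^ 2 / e j) := by
      refine Finset.sum_le_sum fun j _ => ?_
      have := he j
      gcongr
      exact heB j
    _ = _ := Finset.sum_congr rfl fun j _ => mul_div_cancel₀ _ (he j).ne'

variable [DecidableEq ι]

theorem opNorm_transpose (A : Matrix ι κ ℝ) : ‖Aᵀ‖ = ‖A‖ := by
  rw [← Matrix.l2_opNorm_conjTranspose A, Matrix.conjTranspose_eq_transpose_of_trivial]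

theorem opNorm_diagonal_le {v : ι → ℝ} {c : ℝ} (hc : 0 ≤ c) (h : ∀ i, |v i| ≤ c) :
    ‖(diagonal v : Matrix ι ι ℝ)‖ ≤ c := by
  rw [Matrix.l2_opNorm_diagonal]
  exact (pi_norm_le_iff_of_nonneg hc).mpr h

/-- A coercive matrix is invertible, with the corresponding bound on its inverse. -/
theorem isUnit_det_and_norm_inv_le {M : Matrix ι ι ℝ} {c : ℝ} (hc : 0 < c)
    (h : ∀ x : ι → ℝ, c * ∑ i, x i ^ 2 ≤ x ⬝ᵥ M *ᵥ x) : IsUnit M.det ∧ ‖M⁻¹‖ ≤ 1 / c := by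
  have hu : IsUnit M.det := by
    rw [isUnit_iff_ne_zero]
    intro hdet
    obtain ⟨v, hv, hMv⟩ := Matrix.exists_mulVec_eq_zero_iff.mpr hdet
    have h1 := h v
    rw [hMv, dotProduct_zero] at h1
    have h2 : 0 < ∑ i, v i ^ 2 := by
      obtain ⟨i, hi⟩ := Function.ne_iff.mp hv
      exact Finset.sum_pos' (fun i _ => sq_nonneg _) ⟨i, Finset.mem_univ _, by
        have : v i ≠ 0 := hi
        positivity⟩
    nlinarith [mul_pos hc h2]
  refine ⟨hu, opNorm_le_of_sum_sq_le (by positivity) fun y => ?_⟩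
  set x := M⁻¹ *ᵥ y with hx
  have hMx : M *ᵥ x = y := by
    rw [hx, Matrix.mulVec_mulVec, Matrix.mul_nonsing_inv _ hu, Matrix.one_mulVec]
  have h1 := h x
  rw [hMx] at h1
  have h2 : (x ⬝ᵥ y) ^ 2 ≤ (∑ i, x i ^ 2) * ∑ i, y i ^ 2 :=
    Finset.sum_mul_sq_le_sq_mul_sq _ _ _
  have hX : 0 ≤ ∑ i, x i ^ 2 := Finset.sum_nonneg fun i _ => sq_nonneg _
  have hY : 0 ≤ ∑ i, y i ^ 2 := Finset.sum_nonneg fun i _ => sq_nonneg _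
  set X := ∑ i, x i ^ 2
  set Y := ∑ i, y i ^ 2
  rw [div_pow, one_pow, one_div, ← div_eq_inv_mul, le_div_iff₀ (by positivity)]
  -- Coercivity and Cauchy–Schwarz give `c² X² ≤ X Y`; one factor `X` is to be cancelled, so `X = 0`
  -- is treated apart.
  rcases hX.eq_or_lt with h0 | h0
  · rw [← h0, zero_mul]; exact hY
  · have h3 : (c * X) ^ 2 ≤ (x ⬝ᵥ y) ^ 2 := by
      apply pow_le_pow_left₀ (by positivity) h1
    have h4 : X * (X * c ^ 2) ≤ X * Y := by nlinarith
    exact le_of_mul_le_mul_left h4 h0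

end Norms

/-! ### Regularized bipartite Laplacians: coercivity and a priori norm bounds. -/

section Laplacian

variable {n p : ℕ} {A : Matrix (Fin n) (Fin p) ℝ} {lamW lamF : ℝ}

theorem colDegree_inv (hA : ∀ i j, 0 ≤ A i j) (hF : 0 < lamF) :
    (colDegree lamF A)⁻¹ = diagonal fun j => ((∑ i, A i j) + lamF)⁻¹ := by
  have h : ∀ j, (∑ i, A i j) + lamF ≠ 0 := fun j =>
    (add_pos_of_nonneg_of_pos (Finset.sum_nonneg fun i _ => hA i j) hF).ne'
  refine Matrix.inv_eq_right_inv ?_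
  rw [colDegree, diagonal_mul_diagonal, ← diagonal_one]
  congr 1
  funext j
  exact mul_inv_cancel₀ (h j)

theorem rowDegree_transpose (lam : ℝ) (A : Matrix (Fin n) (Fin p) ℝ) :
    rowDegree lam Aᵀ = colDegree lam A := rfl

theorem colDegree_transpose (lam : ℝ) (A : Matrix (Fin n) (Fin p) ℝ) :
    colDegree lam Aᵀ = rowDegree lam A := rfl

/-- Exchanging workers and firms amounts to transposing the adjacency matrix, so all estimates are
made on the worker side only. -/
theorem fVarianceEquiv_eq (lamW lamF σ σw σf : ℝ) (A : Matrix (Fin n) (Fin p) ℝ) :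
    fVarianceEquiv lamW lamF σ σw σf A = wVarianceEquiv lamF lamW σ σf σw Aᵀ := rfl

/-- Coercivity of the regularized Laplacian. -/
theorem wLaplacian_coercive (hA : ∀ i j, 0 ≤ A i j) (hF : 0 < lamF) (x : Fin n → ℝ) :
    lamW * ∑ i, x i ^ 2 ≤ x ⬝ᵥ wLaplacian lamW lamF A *ᵥ x := by
  have hE : ∀ j, 0 < (∑ i, A i j) + lamF := fun j =>
    add_pos_of_nonneg_of_pos (Finset.sum_nonneg fun i _ => hA i j) hF
  have h1 : x ⬝ᵥ wLaplacian lamW lamF A *ᵥ x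
      = ∑ i, ((∑ j, A i j) + lamW) * x i ^ 2
        - ∑ j, (∑ i, A i j * x i) ^ 2 / ((∑ i, A i j) + lamF) := by
    rw [wLaplacian, sub_mulVec, dotProduct_sub, colDegree_inv hA hF, ← mulVec_mulVec,
      ← mulVec_mulVec, dotProduct_mulVec x A, ← mulVec_transpose]
    congr 1
    · simp only [rowDegree, mulVec_diagonal, dotProduct]
      exact Finset.sum_congr rfl fun i _ => by ring
    · simp only [mulVec_diagonal, dotProduct]
      simp only [mulVec, dotProduct, transpose_apply]
      exact Finset.sum_congr rfl fun i _ => by ring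
  -- Cauchy–Schwarz in column `j`. Summed over `j`, the right sides are the unregularized degree
  -- form, so subtracting them leaves `lamW * ∑ x i ^ 2`.
  have h2 : ∀ j, (∑ i, A i j * x i) ^ 2 / ((∑ i, A i j) + lamF) ≤ ∑ i, A i j * x i ^ 2 := by
    intro j
    have hs : 0 ≤ ∑ i, A i j * x i ^ 2 :=
      Finset.sum_nonneg fun i _ => mul_nonneg (hA i j) (sq_nonneg _)
    rw [div_le_iff₀ (hE j)]
    calc _ ≤ (∑ i, A i j) * ∑ i, A i j * x i ^ 2 :=
          Finset.sum_sq_le_sum_mul_sum_of_sq_le_mul _ (fun i _ => hA i j)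
            (fun i _ => mul_nonneg (hA i j) (sq_nonneg _)) fun i _ => le_of_eq (by ring)
      _ ≤ ((∑ i, A i j) + lamF) * ∑ i, A i j * x i ^ 2 := by gcongr; linarith
      _ = _ := mul_comm _ _
  have h3 := Finset.sum_le_sum fun j (_ : j ∈ Finset.univ) => h2 j
  rw [Finset.sum_comm] at h3
  simp_rw [← Finset.sum_mul] at h3
  rw [h1]
  simp_rw [add_mul, Finset.sum_add_distrib, ← Finset.mul_sum]
  linarith

theorem isUnit_det_wLaplacian (hA : ∀ i j, 0 ≤ A i j) (hW : 0 < lamW) (hF : 0 < lamF) :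
    IsUnit (wLaplacian lamW lamF A).det :=
  (isUnit_det_and_norm_inv_le hW (wLaplacian_coercive hA hF)).1

theorem norm_wLaplacian_inv_le (hA : ∀ i j, 0 ≤ A i j) (hW : 0 < lamW) (hF : 0 < lamF) :
    ‖(wLaplacian lamW lamF A)⁻¹‖ ≤ 1 / lamW :=
  (isUnit_det_and_norm_inv_le hW (wLaplacian_coercive hA hF)).2

theorem wLaplacian_transpose (hA : ∀ i j, 0 ≤ A i j) (hF : 0 < lamF) :
    (wLaplacian lamW lamF A)ᵀ = wLaplacian lamW lamF A := by
  rw [wLaplacian, colDegree_inv hA hF]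
  simp [rowDegree, Matrix.mul_assoc]

/-- Row-normalized transposed adjacency matrix, `E⁻¹ Aᵀ`. -/
def colAverage (lamF : ℝ) (A : Matrix (Fin n) (Fin p) ℝ) : Matrix (Fin p) (Fin n) ℝ :=
  (colDegree lamF A)⁻¹ * Aᵀ

/-- Each row is a sub-probability vector, so Jensen bounds the square of entry `j` by `E_j⁻¹ ∑ i, A
i j * x i ^ 2`; summing over `j` turns column weights into row degrees. -/
theorem norm_colAverage_le (hA : ∀ i j, 0 ≤ A i j) {dmax emin : ℝ} (hF : 0 < lamF)
    (hd0 : 0 ≤ dmax) (hd : ∀ i, ∑ j, A i j ≤ dmax) (he : 0 < emin)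
    (heA : ∀ j, emin ≤ (∑ i, A i j) + lamF) :
    ‖colAverage lamF A‖ ≤ √(dmax / emin) := by
  refine opNorm_le_of_sum_sq_le (Real.sqrt_nonneg _) fun x => ?_
  rw [Real.sq_sqrt (by positivity), colAverage, colDegree_inv hA hF]
  have h2 : ∀ j, ((diagonal (fun j => ((∑ i, A i j) + lamF)⁻¹) * Aᵀ) *ᵥ x) j ^ 2
      ≤ emin⁻¹ * ∑ i, A i j * x i ^ 2 := by
    intro j
    have hE : 0 < (∑ i, A i j) + lamF := he.trans_le (heA j)
    have hs : 0 ≤ ∑ i, A i j * x i ^ 2 :=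
      Finset.sum_nonneg fun i _ => mul_nonneg (hA i j) (sq_nonneg _)
    rw [← mulVec_mulVec, mulVec_diagonal, mul_pow]
    have h3 : (Aᵀ *ᵥ x) j ^ 2 ≤ (∑ i, A i j) * ∑ i, A i j * x i ^ 2 := by
      simp only [mulVec, dotProduct, transpose_apply]
      exact Finset.sum_sq_le_sum_mul_sum_of_sq_le_mul _ (fun i _ => hA i j)
            (fun i _ => mul_nonneg (hA i j) (sq_nonneg _)) fun i _ => le_of_eq (by ring)
    calc _ ≤ (((∑ i, A i j) + lamF)⁻¹) ^ 2 * (((∑ i, A i j) + lamF) * ∑ i, A i j * x i ^ 2) := by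
          gcongr
          exact h3.trans (by gcongr; linarith)
      _ = ((∑ i, A i j) + lamF)⁻¹ * ∑ i, A i j * x i ^ 2 := by field_simp
      _ ≤ _ := by gcongr; exact heA j
  calc _ ≤ ∑ j, emin⁻¹ * ∑ i, A i j * x i ^ 2 := Finset.sum_le_sum fun j _ => h2 j
    _ = emin⁻¹ * ∑ i, (∑ j, A i j) * x i ^ 2 := by
      rw [← Finset.mul_sum, Finset.sum_comm]; simp_rw [Finset.sum_mul]
    _ ≤ emin⁻¹ * ∑ i, dmax * x i ^ 2 := by
      gcongr with i
      exact hd i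
    _ = _ := by rw [← Finset.mul_sum]; ring

/-- Splits the formula into an inverse, its square and a Gram matrix, using that `A E⁻² Aᵀ` is the
Gram matrix of `E⁻¹ Aᵀ`. Each term is then perturbed separately. -/
theorem wVarianceEquiv_eq (hA : ∀ i j, 0 ≤ A i j) (hF : 0 < lamF) (σ σw σf : ℝ) :
    wVarianceEquiv lamW lamF σ σw σf A
      = σ ^ 2 • (wLaplacian lamW lamF A)⁻¹
        + (lamW ^ 2 * σw ^ 2 - lamW * σ ^ 2) •
          ((wLaplacian lamW lamF A)⁻¹ * (wLaplacian lamW lamF A)⁻¹)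
        + (lamF ^ 2 * σf ^ 2 - lamF * σ ^ 2) •
          ((colAverage lamF A * (wLaplacian lamW lamF A)⁻¹)ᵀ
            * (colAverage lamF A * (wLaplacian lamW lamF A)⁻¹)) := by
  have hE : ((colDegree lamF A)⁻¹)ᵀ = (colDegree lamF A)⁻¹ := by
    rw [colDegree_inv hA hF, diagonal_transpose]
  rw [wVarianceEquiv, colAverage, transpose_mul, transpose_mul, transpose_transpose, hE,
    transpose_nonsing_inv, wLaplacian_transpose hA hF]
  simp only [mul_add, add_mul, Matrix.mul_smul, Matrix.smul_mul, Matrix.mul_one, Matrix.mul_assoc,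
    add_assoc]

end Laplacian

end RidgeFE

end

noncomputable section

namespace RidgeFE

open scoped Matrix.Norms.L2Operator

/-! ### Perturbation of the variance matrix -/

section Perturbation

variable {n p : ℕ}

/-- `D₀^{-1/2} B E₀^{-1/2}` for the regularized degree matrices `D₀`, `E₀` of `A₀`. -/
def normalized (lamW lamF : ℝ) (A₀ B : Matrix (Fin n) (Fin p) ℝ) : Matrix (Fin n) (Fin p) ℝ :=
  Matrix.of fun i j => B i j / (√((∑ j, A₀ i j) + lamW) * √((∑ i, A₀ i j) + lamF))

theorem normalized_transpose (lamW lamF : ℝ) (A₀ B : Matrix (Fin n) (Fin p) ℝ) :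
    (normalized lamW lamF A₀ B)ᵀ = normalized lamF lamW A₀ᵀ Bᵀ := by
  ext i j
  simp [normalized, mul_comm]

/-- The adjacency matrix `A` is close to `A₀`, with regularized degrees of `A₀` at most `hi + lamW`
for rows, and at least `lo' + lamF` for columns. -/
structure IsClose (lamW lamF hi lo' t : ℝ) (A A₀ : Matrix (Fin n) (Fin p) ℝ) : Prop where
  nonneg : ∀ i j, 0 ≤ A i j
  nonneg₀ : ∀ i j, 0 ≤ A₀ i j
  lamW_pos : 0 < lamW
  lamF_pos : 0 < lamF
  hi_nonneg : 0 ≤ hi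
  lo_nonneg : 0 ≤ lo'
  row_le : ∀ i, ∑ j, A₀ i j ≤ hi
  le_col : ∀ j, lo' ≤ ∑ i, A₀ i j
  t_nonneg : 0 ≤ t
  t_le : t ≤ 1
  row_upper : ∀ i, ∑ j, A i j ≤ (∑ j, A₀ i j) + 2 * t * ((∑ j, A₀ i j) + lamW)
  -- The factor 5/6 is large enough for the Chernoff exponent, since `(5/6)² / 2 · 3 = 25/24 ≥ 1`,
  -- and small enough to keep `1 - 5/6 t` positive up to `t = 1`.
  row_lower : ∀ i, (∑ j, A₀ i j) - 5 / 6 * t * ((∑ j, A₀ i j) + lamW) ≤ ∑ j, A i j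
  col_upper : ∀ j, ∑ i, A i j ≤ (∑ i, A₀ i j) + 2 * t * ((∑ i, A₀ i j) + lamF)
  col_lower : ∀ j, (∑ i, A₀ i j) - 5 / 6 * t * ((∑ i, A₀ i j) + lamF) ≤ ∑ i, A i j
  norm_le : ‖normalized lamW lamF A₀ (A - A₀)‖ ≤ 5 * t

namespace IsClose

variable {lamW lamF hi lo' t : ℝ} {A A₀ : Matrix (Fin n) (Fin p) ℝ}

theorem rowDeg_pos (h : IsClose lamW lamF hi lo' t A A₀) (i : Fin n) :
    0 < (∑ j, A₀ i j) + lamW :=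
  add_pos_of_nonneg_of_pos (Finset.sum_nonneg fun j _ => h.nonneg₀ i j) h.lamW_pos

theorem colDeg_pos (h : IsClose lamW lamF hi lo' t A A₀) (j : Fin p) :
    0 < (∑ i, A₀ i j) + lamF :=
  add_pos_of_nonneg_of_pos (Finset.sum_nonneg fun i _ => h.nonneg₀ i j) h.lamF_pos

theorem transpose (h : IsClose lamW lamF hi lo' t A A₀) {hi' lo : ℝ} (hhi' : 0 ≤ hi')
    (hlo : 0 ≤ lo) (hcol : ∀ j, ∑ i, A₀ i j ≤ hi') (hrow : ∀ i, lo ≤ ∑ j, A₀ i j) :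
    IsClose lamF lamW hi' lo t Aᵀ A₀ᵀ where
  nonneg i j := h.nonneg j i
  nonneg₀ i j := h.nonneg₀ j i
  lamW_pos := h.lamF_pos
  lamF_pos := h.lamW_pos
  hi_nonneg := hhi'
  lo_nonneg := hlo
  row_le := hcol
  le_col := hrow
  t_nonneg := h.t_nonneg
  t_le := h.t_le
  row_upper := h.col_upper
  row_lower := h.col_lower
  col_upper := h.row_upper
  col_lower := h.row_lower
  norm_le := by
    rw [← transpose_sub, ← normalized_transpose, opNorm_transpose]
    exact h.norm_le

theorem norm_normalized_self (h : IsClose lamW lamF hi lo' t A A₀) :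
    ‖normalized lamW lamF A₀ A₀‖ ≤ 1 :=
  opNorm_le_one_of_row_col h.nonneg₀ h.rowDeg_pos h.colDeg_pos
    (fun _ => le_add_of_nonneg_right h.lamW_pos.le) fun _ => le_add_of_nonneg_right h.lamF_pos.le

theorem normalized_eq_add :
    normalized lamW lamF A₀ A = normalized lamW lamF A₀ A₀ + normalized lamW lamF A₀ (A - A₀) := by
  ext i j
  simp only [normalized, of_apply, Matrix.add_apply, Matrix.sub_apply]
  ring

theorem norm_normalized (h : IsClose lamW lamF hi lo' t A A₀) :
    ‖normalized lamW lamF A₀ A‖ ≤ 1 + 5 * t := by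
  rw [normalized_eq_add]
  exact (norm_add_le _ _).trans (add_le_add h.norm_normalized_self h.norm_le)

theorem eq_mul_normalized_mul (h : IsClose lamW lamF hi lo' t A A₀)
    (B : Matrix (Fin n) (Fin p) ℝ) :
    B = diagonal (fun i => √((∑ j, A₀ i j) + lamW)) * normalized lamW lamF A₀ B
      * diagonal (fun j => √((∑ i, A₀ i j) + lamF)) := by
  ext i j
  rw [mul_diagonal, diagonal_mul]
  have := (Real.sqrt_pos.mpr (h.rowDeg_pos i)).ne'
  have := (Real.sqrt_pos.mpr (h.colDeg_pos j)).ne'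
  simp only [normalized, of_apply]
  field_simp

theorem transpose_eq_mul (h : IsClose lamW lamF hi lo' t A A₀)
    (B : Matrix (Fin n) (Fin p) ℝ) :
    Bᵀ = diagonal (fun j => √((∑ i, A₀ i j) + lamF)) * (normalized lamW lamF A₀ B)ᵀ
      * diagonal (fun i => √((∑ j, A₀ i j) + lamW)) := by
  conv_lhs => rw [h.eq_mul_normalized_mul B]
  simp [Matrix.mul_assoc]

/-- Both `A` and `A₀` are normalized by the degrees of `A₀`. The outer factors then agree and cancel
from differences, and the fluctuation of the column degrees is isolated in the diagonal ratio `E₀ /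
E`. -/
theorem colAverage_eq (h : IsClose lamW lamF hi lo' t A A₀) {B : Matrix (Fin n) (Fin p) ℝ}
    (hB : ∀ i j, 0 ≤ B i j) :
    colAverage lamF B = diagonal (fun j => (√((∑ i, A₀ i j) + lamF))⁻¹)
      * (diagonal (fun j => ((∑ i, A₀ i j) + lamF) / ((∑ i, B i j) + lamF))
        * (normalized lamW lamF A₀ B)ᵀ) * diagonal (fun i => √((∑ j, A₀ i j) + lamW)) := by
  rw [colAverage, colDegree_inv hB h.lamF_pos, h.transpose_eq_mul B, ← Matrix.mul_assoc,
    ← Matrix.mul_assoc, ← Matrix.mul_assoc, diagonal_mul_diagonal, diagonal_mul_diagonal]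
  congr 3
  funext j
  have h1 := (Real.sqrt_pos.mpr (h.colDeg_pos j)).ne'
  rw [div_eq_mul_inv, ← mul_assoc]
  nth_rw 3 [← Real.mul_self_sqrt (h.colDeg_pos j).le]
  field_simp

theorem wLaplacian_eq (h : IsClose lamW lamF hi lo' t A A₀) {B : Matrix (Fin n) (Fin p) ℝ}
    (hB : ∀ i j, 0 ≤ B i j) :
    wLaplacian lamW lamF B = rowDegree lamW B - diagonal (fun i => √((∑ j, A₀ i j) + lamW)) *
      (normalized lamW lamF A₀ B *
        (diagonal (fun j => ((∑ i, A₀ i j) + lamF) / ((∑ i, B i j) + lamF))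
        * (normalized lamW lamF A₀ B)ᵀ)) * diagonal (fun i => √((∑ j, A₀ i j) + lamW)) := by
  rw [wLaplacian, Matrix.mul_assoc B]
  have h1 := h.colAverage_eq hB
  rw [colAverage] at h1
  rw [h1]
  nth_rw 2 [h.eq_mul_normalized_mul B]
  have h2 : diagonal (fun j => √((∑ i, A₀ i j) + lamF))
      * diagonal (fun j => (√((∑ i, A₀ i j) + lamF))⁻¹) = 1 := by
    rw [diagonal_mul_diagonal, ← diagonal_one]
    congr 1
    funext j
    exact mul_inv_cancel₀ (Real.sqrt_pos.mpr (h.colDeg_pos j)).ne'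
  congr 1
  simp only [Matrix.mul_assoc]
  rw [← Matrix.mul_assoc (diagonal _) (diagonal _) (diagonal _ * _), h2, Matrix.one_mul]

theorem ratio_self (h : IsClose lamW lamF hi lo' t A A₀) :
    diagonal (fun j => ((∑ i, A₀ i j) + lamF) / ((∑ i, A₀ i j) + lamF)) =
      (1 : Matrix (Fin p) (Fin p) ℝ) := by
  rw [← diagonal_one]
  congr 1
  funext j
  exact div_self (h.colDeg_pos j).ne'

theorem norm_ratio_sub_one (h : IsClose lamW lamF hi lo' t A A₀) (ht : t ≤ 1 / 10) :
    ‖diagonal (fun j => ((∑ i, A₀ i j) + lamF) / ((∑ i, A i j) + lamF))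
      - (1 : Matrix (Fin p) (Fin p) ℝ)‖ ≤ 2 * t := by
  have ht0 := h.t_nonneg
  rw [← diagonal_one, diagonal_sub]
  refine opNorm_diagonal_le (by positivity) fun j => ?_
  have h0 := h.colDeg_pos j
  have h1 : 0 < (∑ i, A i j) + lamF :=
    add_pos_of_nonneg_of_pos (Finset.sum_nonneg fun i _ => h.nonneg i j) h.lamF_pos
  have h2 := h.col_upper j
  have h3 := h.col_lower j
  rw [div_sub_one h1.ne', abs_div, abs_of_pos h1, div_le_iff₀ h1, abs_le]
  constructor <;> nlinarith [mul_nonneg ht0 h0.le, mul_nonneg ht0 (mul_nonneg ht0 h0.le)]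

theorem norm_sqrt_rowDeg (h : IsClose lamW lamF hi lo' t A A₀) :
    ‖(diagonal (fun i => √((∑ j, A₀ i j) + lamW)) : Matrix (Fin n) (Fin n) ℝ)‖
      ≤ √(hi + lamW) := by
  refine opNorm_diagonal_le (Real.sqrt_nonneg _) fun i => ?_
  rw [abs_of_nonneg (Real.sqrt_nonneg _)]
  exact Real.sqrt_le_sqrt (by linarith [h.row_le i])

theorem norm_inv_sqrt_colDeg (h : IsClose lamW lamF hi lo' t A A₀) :
    ‖(diagonal (fun j => (√((∑ i, A₀ i j) + lamF))⁻¹) : Matrix (Fin p) (Fin p) ℝ)‖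
      ≤ (√(lo' + lamF))⁻¹ := by
  have h0 : 0 < √(lo' + lamF) := Real.sqrt_pos.mpr (by linarith [h.lo_nonneg, h.lamF_pos])
  refine opNorm_diagonal_le (by positivity) fun j => ?_
  rw [abs_of_nonneg (by positivity)]
  gcongr
  exact h.le_col j

theorem norm_mul_mul_le {a b c d : ℕ} (P : Matrix (Fin a) (Fin b) ℝ) (Q : Matrix (Fin b) (Fin c) ℝ)
    (R : Matrix (Fin c) (Fin d) ℝ) {x y z : ℝ} (hP : ‖P‖ ≤ x) (hQ : ‖Q‖ ≤ y) (hR : ‖R‖ ≤ z) :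
    ‖P * Q * R‖ ≤ x * y * z := by
  have hx := (norm_nonneg P).trans hP
  have hy := (norm_nonneg Q).trans hQ
  calc ‖P * Q * R‖ ≤ ‖P * Q‖ * ‖R‖ := Matrix.l2_opNorm_mul _ _
    _ ≤ ‖P‖ * ‖Q‖ * ‖R‖ := by gcongr; exact Matrix.l2_opNorm_mul _ _
    _ ≤ _ := by gcongr

theorem norm_ratio_mul_sub (h : IsClose lamW lamF hi lo' t A A₀) (ht : t ≤ 1 / 10) :
    ‖diagonal (fun j => ((∑ i, A₀ i j) + lamF) / ((∑ i, A i j) + lamF))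
        * (normalized lamW lamF A₀ A)ᵀ - (normalized lamW lamF A₀ A₀)ᵀ‖ ≤ 8 * t := by
  have ht0 := h.t_nonneg
  have e : diagonal (fun j => ((∑ i, A₀ i j) + lamF) / ((∑ i, A i j) + lamF))
        * (normalized lamW lamF A₀ A)ᵀ - (normalized lamW lamF A₀ A₀)ᵀ
      = (diagonal (fun j => ((∑ i, A₀ i j) + lamF) / ((∑ i, A i j) + lamF)) - 1)
        * (normalized lamW lamF A₀ A)ᵀ + (normalized lamW lamF A₀ (A - A₀))ᵀ := by
    rw [Matrix.sub_mul, Matrix.one_mul, normalized_eq_add (A := A), transpose_add]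
    abel
  rw [e]
  calc _ ≤ _ := norm_add_le _ _
    _ ≤ 2 * t * (1 + 5 * t) + 5 * t := by
      refine add_le_add ((Matrix.l2_opNorm_mul _ _).trans ?_) ?_
      · rw [opNorm_transpose]
        exact mul_le_mul (h.norm_ratio_sub_one ht) h.norm_normalized (norm_nonneg _) (by positivity)
      · rw [opNorm_transpose]; exact h.norm_le
    -- The sum is `7t + 10t²`, at most `8t` because `t ≤ 1/10`.
    _ ≤ _ := by nlinarith

theorem norm_colAverage_sub (h : IsClose lamW lamF hi lo' t A A₀) (ht : t ≤ 1 / 10) :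
    ‖colAverage lamF A - colAverage lamF A₀‖ ≤ 8 * t * √((hi + lamW) / (lo' + lamF)) := by
  rw [h.colAverage_eq h.nonneg, h.colAverage_eq h.nonneg₀, h.ratio_self, Matrix.one_mul,
    ← Matrix.sub_mul, ← Matrix.mul_sub]
  refine (norm_mul_mul_le _ _ _ h.norm_inv_sqrt_colDeg (h.norm_ratio_mul_sub ht)
    h.norm_sqrt_rowDeg).trans (le_of_eq ?_)
  rw [Real.sqrt_div (by linarith [h.hi_nonneg, h.lamW_pos])]
  ring

theorem norm_wLaplacian_sub (h : IsClose lamW lamF hi lo' t A A₀) (ht : t ≤ 1 / 10) :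
    ‖wLaplacian lamW lamF A - wLaplacian lamW lamF A₀‖ ≤ 19 * t * (hi + lamW) := by
  have ht0 := h.t_nonneg
  have hΔ : 0 ≤ hi + lamW := by linarith [h.hi_nonneg, h.lamW_pos]
  rw [h.wLaplacian_eq h.nonneg, h.wLaplacian_eq h.nonneg₀, h.ratio_self, Matrix.one_mul,
    sub_sub_sub_comm, ← Matrix.sub_mul, ← Matrix.mul_sub]
  set X := normalized lamW lamF A₀ A with hX
  set X₀ := normalized lamW lamF A₀ A₀
  set R := diagonal (fun j => ((∑ i, A₀ i j) + lamF) / ((∑ i, A i j) + lamF)) with hR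
  have h1 : ‖rowDegree lamW A - rowDegree lamW A₀‖ ≤ 2 * t * (hi + lamW) := by
    rw [rowDegree, rowDegree, diagonal_sub]
    refine opNorm_diagonal_le (by positivity) fun i => ?_
    have h2 : t * ((∑ j, A₀ i j) + lamW) ≤ t * (hi + lamW) := by
      gcongr; exact h.row_le i
    have h3 := mul_nonneg ht0 (h.rowDeg_pos i).le
    rw [abs_le]
    constructor <;> linarith [h.row_upper i, h.row_lower i]
  have h2 : ‖X * (R * Xᵀ) - X₀ * X₀ᵀ‖ ≤ 17 * t := by
    have e : X * (R * Xᵀ) - X₀ * X₀ᵀ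
        = X * (R * Xᵀ - X₀ᵀ) + normalized lamW lamF A₀ (A - A₀) * X₀ᵀ := by
      rw [Matrix.mul_sub, hX, normalized_eq_add (A := A)]
      simp only [Matrix.add_mul]
      abel
    rw [e]
    calc _ ≤ _ := norm_add_le _ _
      _ ≤ (1 + 5 * t) * (8 * t) + 5 * t * 1 := by
        refine add_le_add ((Matrix.l2_opNorm_mul _ _).trans ?_)
          ((Matrix.l2_opNorm_mul _ _).trans ?_)
        · exact mul_le_mul h.norm_normalized (h.norm_ratio_mul_sub ht) (norm_nonneg _)
            (by positivity)
        · rw [opNorm_transpose]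
          exact mul_le_mul h.norm_le h.norm_normalized_self (norm_nonneg _) (by positivity)
      -- Here `13t + 40t² ≤ 17t`; the degree matrix contributes another `2t`, whence 19.
      _ ≤ _ := by nlinarith
  calc _ ≤ _ := norm_sub_le _ _
    _ ≤ 2 * t * (hi + lamW) + √(hi + lamW) * (17 * t) * √(hi + lamW) :=
      add_le_add h1 (norm_mul_mul_le _ _ _ h.norm_sqrt_rowDeg h2 h.norm_sqrt_rowDeg)
    _ = 2 * t * (hi + lamW) + 17 * t * (√(hi + lamW) * √(hi + lamW)) := by ring
    _ = _ := by rw [Real.mul_self_sqrt hΔ]; ring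

/-- The resolvent identity gives the constant 19 when `t ≤ 1/10`; otherwise the sum of the two
norms, `2 / lamW`, is enough because `21 t ≥ 2`. The constant 21 is the least value of the theorem's
coefficient `5 + 16 (hi + lam) / (lo + lam)`. -/
theorem norm_wLaplacian_inv_sub (h : IsClose lamW lamF hi lo' t A A₀) :
    ‖(wLaplacian lamW lamF A)⁻¹ - (wLaplacian lamW lamF A₀)⁻¹‖
      ≤ 21 * t * (hi + lamW) / lamW ^ 2 := by
  have ht0 := h.t_nonneg
  have hW := h.lamW_pos
  have hhi := h.hi_nonneg
  have hu := isUnit_det_wLaplacian h.nonneg h.lamW_pos h.lamF_pos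
  have hu₀ := isUnit_det_wLaplacian h.nonneg₀ h.lamW_pos h.lamF_pos
  have hl := norm_wLaplacian_inv_le h.nonneg h.lamW_pos h.lamF_pos
  have hl₀ := norm_wLaplacian_inv_le h.nonneg₀ h.lamW_pos h.lamF_pos
  rcases le_total t (1 / 10) with ht | ht
  · have e : (wLaplacian lamW lamF A)⁻¹ - (wLaplacian lamW lamF A₀)⁻¹
        = -((wLaplacian lamW lamF A)⁻¹ * (wLaplacian lamW lamF A - wLaplacian lamW lamF A₀)
          * (wLaplacian lamW lamF A₀)⁻¹) := by
      rw [Matrix.mul_sub, Matrix.sub_mul, Matrix.nonsing_inv_mul _ hu, Matrix.one_mul,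
        Matrix.mul_assoc, Matrix.mul_nonsing_inv _ hu₀, Matrix.mul_one, neg_sub]
    rw [e, norm_neg]
    calc _ ≤ 1 / lamW * (19 * t * (hi + lamW)) * (1 / lamW) :=
          norm_mul_mul_le _ _ _ hl (h.norm_wLaplacian_sub ht) hl₀
      _ = 19 * t * (hi + lamW) / lamW ^ 2 := by field_simp
      _ ≤ _ := by gcongr; norm_num
  · calc _ ≤ _ := norm_sub_le _ _
      _ ≤ 1 / lamW + 1 / lamW := add_le_add hl hl₀
      _ = 2 * lamW / lamW ^ 2 := by field_simp; norm_num
      _ ≤ _ := by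
        gcongr
        · linarith
        · linarith

theorem norm_colAverage_self (h : IsClose lamW lamF hi lo' t A A₀) :
    ‖colAverage lamF A₀‖ ≤ √((hi + lamW) / (lo' + lamF)) :=
  norm_colAverage_le h.nonneg₀ h.lamF_pos (by linarith [h.hi_nonneg, h.lamW_pos])
    (fun i => by linarith [h.row_le i, h.lamW_pos]) (by linarith [h.lo_nonneg, h.lamF_pos])
    fun j => by linarith [h.le_col j]

theorem norm_colAverage (h : IsClose lamW lamF hi lo' t A A₀) :
    ‖colAverage lamF A‖
      ≤ √((1 + 2 * t) / (1 - 5 / 6 * t) * ((hi + lamW) / (lo' + lamF))) := by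
  have ht0 := h.t_nonneg
  have ht1 := h.t_le
  have hW := h.lamW_pos
  have hF := h.lamF_pos
  have hhi := h.hi_nonneg
  have hlo := h.lo_nonneg
  rw [div_mul_div_comm]
  refine norm_colAverage_le h.nonneg h.lamF_pos (by positivity) (fun i => ?_)
    (mul_pos (by linarith) (by linarith)) fun j => ?_
  · have h1 := h.row_upper i
    have h2 := h.row_le i
    nlinarith [mul_le_mul_of_nonneg_left h2 ht0]
  · have h1 := h.col_lower j
    have h2 := h.le_col j
    nlinarith [mul_le_mul_of_nonneg_left h2 (show 0 ≤ 1 - 5 / 6 * t by linarith)]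

theorem norm_gram_sub (h : IsClose lamW lamF hi lo' t A A₀) :
    ‖(colAverage lamF A * (wLaplacian lamW lamF A)⁻¹)ᵀ
          * (colAverage lamF A * (wLaplacian lamW lamF A)⁻¹)
        - (colAverage lamF A₀ * (wLaplacian lamW lamF A₀)⁻¹)ᵀ
          * (colAverage lamF A₀ * (wLaplacian lamW lamF A₀)⁻¹)‖
      ≤ 84 * t * (hi + lamW) ^ 2 / (lamW ^ 3 * (lo' + lamF)) := by
  have ht0 := h.t_nonneg
  have ht1 := h.t_le
  have hW := h.lamW_pos
  have hF := h.lamF_pos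
  have hhi := h.hi_nonneg
  have hlo := h.lo_nonneg
  have hΔ : 0 < hi + lamW := by linarith
  have hη : 0 < lo' + lamF := by linarith
  have hl := norm_wLaplacian_inv_le h.nonneg h.lamW_pos h.lamF_pos
  have hl₀ := norm_wLaplacian_inv_le h.nonneg₀ h.lamW_pos h.lamF_pos
  have hd := h.norm_wLaplacian_inv_sub
  have hK := h.norm_colAverage
  have hK₀ := h.norm_colAverage_self
  set L := (wLaplacian lamW lamF A)⁻¹
  set L₀ := (wLaplacian lamW lamF A₀)⁻¹
  set K := colAverage lamF A with hKdef
  set K₀ := colAverage lamF A₀ with hK₀def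
  set r := √((hi + lamW) / (lo' + lamF)) with hr
  have hr0 : 0 ≤ r := Real.sqrt_nonneg _
  have hrr : r ^ 2 = (hi + lamW) / (lo' + lamF) := Real.sq_sqrt (by positivity)
  have hG₀ : ‖K₀ * L₀‖ ≤ r * (1 / lamW) :=
    (Matrix.l2_opNorm_mul _ _).trans (mul_le_mul hK₀ hl₀ (norm_nonneg _) hr0)
  rcases le_total t (1 / 10) with ht | ht
  · have hK' : ‖K‖ ≤ 23 / 20 * r := by
      refine hK.trans ?_
      rw [Real.sqrt_mul' _ (by positivity)]
      gcongr
      rw [Real.sqrt_le_left (by norm_num), div_le_iff₀ (by linarith)]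
      linarith
    have hG : ‖K * L‖ ≤ 23 / 20 * r * (1 / lamW) :=
      (Matrix.l2_opNorm_mul _ _).trans (mul_le_mul hK' hl (norm_nonneg _) (by positivity))
    have hKd := h.norm_colAverage_sub ht
    rw [← hKdef, ← hK₀def, ← hr] at hKd
    -- The constant is `23/20 · 21 + 8 = 32.15`, rounded up; the second term uses `lamW ≤ hi +
    -- lamW`.
    have hGd : ‖K * L - K₀ * L₀‖ ≤ 33 * t * r * (hi + lamW) / lamW ^ 2 := by
      have e : K * L - K₀ * L₀ = K * (L - L₀) + (K - K₀) * L₀ := by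
        rw [Matrix.mul_sub, Matrix.sub_mul]; abel
      rw [e]
      calc _ ≤ _ := norm_add_le _ _
        _ ≤ 23 / 20 * r * (21 * t * (hi + lamW) / lamW ^ 2) + 8 * t * r * (1 / lamW) :=
          add_le_add
            ((Matrix.l2_opNorm_mul _ _).trans (mul_le_mul hK' hd (norm_nonneg _) (by positivity)))
            ((Matrix.l2_opNorm_mul _ _).trans (mul_le_mul hKd hl₀ (norm_nonneg _) (by positivity)))
        _ = (23 / 20 * 21 * (t * r * (hi + lamW)) + 8 * (t * r * lamW)) / lamW ^ 2 := by
          field_simp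
        _ ≤ _ := by
          gcongr
          have : t * r * lamW ≤ t * r * (hi + lamW) := by gcongr; linarith
          have : 0 ≤ t * r * (hi + lamW) := by positivity
          linarith
    have e : (K * L)ᵀ * (K * L) - (K₀ * L₀)ᵀ * (K₀ * L₀)
        = (K * L)ᵀ * (K * L - K₀ * L₀) + (K * L - K₀ * L₀)ᵀ * (K₀ * L₀) := by
      rw [Matrix.mul_sub, transpose_sub, Matrix.sub_mul]; abel
    rw [e]
    calc _ ≤ _ := norm_add_le _ _
      _ ≤ (23 / 20 * r * (1 / lamW)) * (33 * t * r * (hi + lamW) / lamW ^ 2)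
          + (33 * t * r * (hi + lamW) / lamW ^ 2) * (r * (1 / lamW)) := by
        refine add_le_add ((Matrix.l2_opNorm_mul _ _).trans ?_)
          ((Matrix.l2_opNorm_mul _ _).trans ?_)
        · rw [opNorm_transpose]
          exact mul_le_mul hG hGd (norm_nonneg _) (by positivity)
        · rw [opNorm_transpose]
          exact mul_le_mul hGd hG₀ (norm_nonneg _) (by positivity)
      _ = 43 / 20 * 33 * t * (hi + lamW) * r ^ 2 / lamW ^ 3 := by field_simp; ring
      _ = 43 / 20 * 33 * t * (hi + lamW) ^ 2 / (lamW ^ 3 * (lo' + lamF)) := by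
        rw [hrr]; field_simp
      _ ≤ _ := by gcongr; norm_num
  · set s := √((1 + 2 * t) / (1 - 5 / 6 * t) * ((hi + lamW) / (lo' + lamF))) with hs
    have hs0 : 0 ≤ s := Real.sqrt_nonneg _
    have h56 : 0 < 1 - 5 / 6 * t := by linarith
    have hss : s ^ 2 = (1 + 2 * t) / (1 - 5 / 6 * t) * ((hi + lamW) / (lo' + lamF)) :=
      Real.sq_sqrt (by positivity)
    have hG : ‖K * L‖ ≤ s * (1 / lamW) :=
      (Matrix.l2_opNorm_mul _ _).trans (mul_le_mul hK hl (norm_nonneg _) (by positivity))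
    -- For `t` between 1/10 and 1 the left side is at most 19 and is about 2.3 at `t = 1/10`; the
    -- norms of the two Gram matrices are simply added.
    have hq : (1 + 2 * t) / (1 - 5 / 6 * t) + 1 ≤ 84 * t := by
      rw [div_add_one h56.ne', div_le_iff₀ h56]
      nlinarith
    calc _ ≤ _ := norm_sub_le _ _
      _ ≤ (s * (1 / lamW)) * (s * (1 / lamW)) + (r * (1 / lamW)) * (r * (1 / lamW)) := by
        refine add_le_add ((Matrix.l2_opNorm_mul _ _).trans ?_)
          ((Matrix.l2_opNorm_mul _ _).trans ?_)
        · rw [opNorm_transpose]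
          exact mul_le_mul hG hG (norm_nonneg _) (by positivity)
        · rw [opNorm_transpose]
          exact mul_le_mul hG₀ hG₀ (norm_nonneg _) (by positivity)
      _ = (s ^ 2 + r ^ 2) / lamW ^ 2 := by field_simp
      _ = ((1 + 2 * t) / (1 - 5 / 6 * t) + 1) * ((hi + lamW) / (lo' + lamF)) / lamW ^ 2 := by
        rw [hss, hrr]; ring
      _ ≤ 84 * t * ((hi + lamW) / (lo' + lamF)) / lamW ^ 2 := by gcongr
      _ = 84 * t * ((hi + lamW) * lamW) / (lamW ^ 3 * (lo' + lamF)) := by field_simp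
      _ ≤ _ := by
        gcongr
        nlinarith

/-- The three terms are bounded with constant 21, which is at most `5 + 16 (hi + lamW) / (lo +
lamW)`. The summands with `1 / (lo + lamW)` and the summand `tail` are pure slack, so any
non-negative `tail` is admissible. -/
theorem norm_wVarianceEquiv_sub (h : IsClose lamW lamF hi lo' t A A₀) {σ σw σf lo tail : ℝ}
    (hlo : 0 ≤ lo) (hlohi : lo ≤ hi) (htail : 0 ≤ tail) :
    specNorm (wVarianceEquiv lamW lamF σ σw σf A - wVarianceEquiv lamW lamF σ σw σf A₀)
      ≤ varianceBound σ (lamW ^ 2 * σw ^ 2 - lamW * σ ^ 2) (lamF ^ 2 * σf ^ 2 - lamF * σ ^ 2)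
          lo hi lamW lo' lamF tail t := by
  have ht0 := h.t_nonneg
  have hW := h.lamW_pos
  have hF := h.lamF_pos
  have hhi := h.hi_nonneg
  have hlo' := h.lo_nonneg
  have hΔ : 0 < hi + lamW := by linarith
  have hη : 0 < lo' + lamF := by linarith
  have hl := norm_wLaplacian_inv_le h.nonneg h.lamW_pos h.lamF_pos
  have hl₀ := norm_wLaplacian_inv_le h.nonneg₀ h.lamW_pos h.lamF_pos
  have hd := h.norm_wLaplacian_inv_sub
  have hg := h.norm_gram_sub
  have h21 : 21 ≤ 5 + 16 * ((hi + lamW) / (lo + lamW)) := by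
    have : 1 ≤ (hi + lamW) / (lo + lamW) := by rw [one_le_div (by linarith)]; linarith
    linarith
  rw [specNorm, wVarianceEquiv_eq h.nonneg hF, wVarianceEquiv_eq h.nonneg₀ hF, varianceBound]
  set L := (wLaplacian lamW lamF A)⁻¹
  set L₀ := (wLaplacian lamW lamF A₀)⁻¹
  set G := colAverage lamF A * L
  set G₀ := colAverage lamF A₀ * L₀
  set a := lamW ^ 2 * σw ^ 2 - lamW * σ ^ 2
  set b := lamF ^ 2 * σf ^ 2 - lamF * σ ^ 2
  set c := 5 + 16 * ((hi + lamW) / (lo + lamW))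
  have hsq : ‖L * L - L₀ * L₀‖ ≤ 2 / lamW * (21 * t * (hi + lamW) / lamW ^ 2) := by
    have e : L * L - L₀ * L₀ = L * (L - L₀) + (L - L₀) * L₀ := by
      rw [Matrix.mul_sub, Matrix.sub_mul]; abel
    rw [e]
    calc _ ≤ _ := norm_add_le _ _
      _ ≤ 1 / lamW * (21 * t * (hi + lamW) / lamW ^ 2)
          + 21 * t * (hi + lamW) / lamW ^ 2 * (1 / lamW) :=
        add_le_add
          ((Matrix.l2_opNorm_mul _ _).trans (mul_le_mul hl hd (norm_nonneg _) (by positivity)))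
          ((Matrix.l2_opNorm_mul _ _).trans (mul_le_mul hd hl₀ (norm_nonneg _) (by positivity)))
      _ = _ := by ring
  have e : σ ^ 2 • L + a • (L * L) + b • (Gᵀ * G)
        - (σ ^ 2 • L₀ + a • (L₀ * L₀) + b • (G₀ᵀ * G₀))
      = σ ^ 2 • (L - L₀) + a • (L * L - L₀ * L₀) + b • (Gᵀ * G - G₀ᵀ * G₀) := by
    simp only [smul_sub]; abel
  rw [e]
  refine (norm_add₃_le ..).trans ?_
  rw [norm_smul, norm_smul, norm_smul, Real.norm_eq_abs, Real.norm_eq_abs, Real.norm_eq_abs,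
    abs_of_nonneg (sq_nonneg σ)]
  have T1 : ‖L - L₀‖ ≤ c * ((hi + lamW) / lamW ^ 2) * t := by
    refine hd.trans ?_
    calc _ = 21 * ((hi + lamW) / lamW ^ 2) * t := by ring
      _ ≤ _ := by gcongr
  -- A factor `(hi + lamW) / lamW ≥ 1` is given away to reach the power in the target.
  have hq : (hi + lamW) / lamW ^ 2 ≤ (hi + lamW) ^ 2 / lamW ^ 3 := by
    rw [div_le_div_iff₀ (by positivity) (by positivity)]
    have : 0 ≤ (hi + lamW) * lamW ^ 2 * hi := by positivity
    nlinarith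
  have T2 : ‖L * L - L₀ * L₀‖
      ≤ (2 / lamW + 1 / (lo + lamW)) * c * ((hi + lamW) ^ 2 / lamW ^ 3) * t := by
    refine hsq.trans ?_
    calc _ = 2 / lamW * 21 * ((hi + lamW) / lamW ^ 2) * t := by ring
      _ ≤ _ := by
        have : 0 ≤ 1 / (lo + lamW) := by positivity
        gcongr
        linarith
  have T3 : ‖Gᵀ * G - G₀ᵀ * G₀‖
      ≤ (4 * (1 / lamW) * √(1 / lamF) + 1 / (lo + lamW) * √(1 / (lo' + lamF)))
        * ((hi + lamW) ^ (5 / 2 : ℝ) / lamW ^ 3)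
        * (c * √((hi + lamW) / (lo' + lamF)) + tail) * t := by
    refine hg.trans ?_
    have e1 : (hi + lamW) ^ (5 / 2 : ℝ) = (hi + lamW) ^ 2 * √(hi + lamW) := by
      rw [Real.sqrt_eq_rpow, ← Real.rpow_natCast, ← Real.rpow_add hΔ]
      norm_num
    have e2 : √((hi + lamW) / (lo' + lamF)) = √(hi + lamW) * √(1 / (lo' + lamF)) := by
      rw [← Real.sqrt_mul hΔ.le, mul_one_div]
    have e3 : √(hi + lamW) * √(hi + lamW) = hi + lamW := Real.mul_self_sqrt hΔ.le
    have e4 : √(1 / (lo' + lamF)) * √(1 / (lo' + lamF)) = 1 / (lo' + lamF) :=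
      Real.mul_self_sqrt (by positivity)
    -- The target has `4 · 21 = 84` and one more factor `(hi + lamW) / lamW ≥ 1`. The two factors
    -- `√(hi + lamW)` go to the power 5/2 and to the square bracket.
    calc 84 * t * (hi + lamW) ^ 2 / (lamW ^ 3 * (lo' + lamF))
        = 84 * (hi + lamW) ^ 2 / lamW ^ 3 * (1 / (lo' + lamF)) * 1 * t := by field_simp
      _ ≤ 84 * (hi + lamW) ^ 2 / lamW ^ 3 * (1 / (lo' + lamF)) * ((hi + lamW) / lamW) * t := by
        gcongr
        rw [one_le_div hW]; linarith
      _ = 4 * (1 / lamW) * √(1 / (lo' + lamF))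
          * ((hi + lamW) ^ 2 * √(hi + lamW) / lamW ^ 3)
          * (21 * (√(hi + lamW) * √(1 / (lo' + lamF)))) * t := by
        linear_combination (-(84 * (hi + lamW) ^ 2 / lamW ^ 3 / lamW * t * (hi + lamW))) * e4
          - (84 * (hi + lamW) ^ 2 / lamW ^ 3 / lamW * t * √(1 / (lo' + lamF))
            * √(1 / (lo' + lamF))) * e3
      _ ≤ _ := by
        rw [e1, e2]
        have h1 : √(1 / (lo' + lamF)) ≤ √(1 / lamF) :=
          Real.sqrt_le_sqrt (one_div_le_one_div_of_le hF (by linarith))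
        have h2 : 0 ≤ 1 / (lo + lamW) * √(1 / (lo' + lamF)) := by positivity
        have h3 : 4 * (1 / lamW) * √(1 / (lo' + lamF))
            ≤ 4 * (1 / lamW) * √(1 / lamF) + 1 / (lo + lamW) * √(1 / (lo' + lamF)) :=
          le_add_of_le_of_nonneg (by gcongr) h2
        have h4 : 21 * (√(hi + lamW) * √(1 / (lo' + lamF)))
            ≤ c * (√(hi + lamW) * √(1 / (lo' + lamF))) + tail :=
          le_add_of_le_of_nonneg (by gcongr) htail
        gcongr
  calc _ ≤ σ ^ 2 * (c * ((hi + lamW) / lamW ^ 2) * t)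
        + |a| * ((2 / lamW + 1 / (lo + lamW)) * c * ((hi + lamW) ^ 2 / lamW ^ 3) * t)
        + |b| * ((4 * (1 / lamW) * √(1 / lamF) + 1 / (lo + lamW) * √(1 / (lo' + lamF)))
          * ((hi + lamW) ^ (5 / 2 : ℝ) / lamW ^ 3)
          * (c * √((hi + lamW) / (lo' + lamF)) + tail) * t) := by gcongr
    _ = _ := by ring

end IsClose

end Perturbation

end RidgeFE

end

noncomputable section

namespace RidgeFE

open scoped Matrix.Norms.L2Operator

/-! ### Trace inequalities for powers of symmetric matrices -/

section Trace

variable {ι : Type*} [Fintype ι] [DecidableEq ι]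

theorem exists_orthogonal_diagonalization {Z : Matrix ι ι ℝ} (hZ : Zᵀ = Z) :
    ∃ (O : Matrix ι ι ℝ) (l : ι → ℝ), Oᵀ * O = 1 ∧ O * Oᵀ = 1 ∧ Z = O * diagonal l * Oᵀ := by
  have h : Z.IsHermitian := by
    rw [Matrix.IsHermitian, Matrix.conjTranspose_eq_transpose_of_trivial, hZ]
  have h1 : (h.eigenvectorUnitary : Matrix ι ι ℝ)ᵀ * h.eigenvectorUnitary = 1 := by
    have := Unitary.coe_star_mul_self h.eigenvectorUnitary
    rwa [star_eq_conjTranspose, Matrix.conjTranspose_eq_transpose_of_trivial] at this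
  refine ⟨h.eigenvectorUnitary, h.eigenvalues, h1, mul_eq_one_comm.mp h1, ?_⟩
  · have := h.spectral_theorem
    rw [Unitary.conjStarAlgAut_apply, star_eq_conjTranspose,
      Matrix.conjTranspose_eq_transpose_of_trivial] at this
    simpa using this

theorem conj_diagonal_pow {O : Matrix ι ι ℝ} (hO : Oᵀ * O = 1) (hO' : O * Oᵀ = 1) (l : ι → ℝ)
    (k : ℕ) : (O * diagonal l * Oᵀ) ^ k = O * diagonal (fun a => l a ^ k) * Oᵀ := by
  induction k with
  | zero => simp [hO']
  | succ k ih =>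
    rw [pow_succ, ih]
    calc _ = O * diagonal (fun a => l a ^ k) * (Oᵀ * O) * diagonal l * Oᵀ := by
          simp only [Matrix.mul_assoc]
      _ = _ := by
        rw [hO, Matrix.mul_one, Matrix.mul_assoc O, diagonal_mul_diagonal]
        simp only [pow_succ]

theorem conj_diagonal_apply_self (O : Matrix ι ι ℝ) (l : ι → ℝ) (v : ι) :
    (O * diagonal l * Oᵀ) v v = ∑ a, O v a ^ 2 * l a := by
  rw [mul_apply]
  exact Finset.sum_congr rfl fun a _ => by rw [mul_diagonal, transpose_apply]; ring

theorem sum_sq_row_eq_one {O : Matrix ι ι ℝ} (hO' : O * Oᵀ = 1) (v : ι) :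
    ∑ a, O v a ^ 2 = 1 := by
  have := congrFun (congrFun hO' v) v
  rw [mul_apply, one_apply_eq] at this
  rw [← this]
  exact Finset.sum_congr rfl fun a _ => by rw [transpose_apply]; ring

theorem trace_pow_eq {O : Matrix ι ι ℝ} (hO : Oᵀ * O = 1) (hO' : O * Oᵀ = 1) (l : ι → ℝ)
    (k : ℕ) : ((O * diagonal l * Oᵀ) ^ k).trace = ∑ a, l a ^ k := by
  rw [conj_diagonal_pow hO hO', trace_mul_comm, ← Matrix.mul_assoc, hO, Matrix.one_mul,
    trace_diagonal]

/-- The diagonal entries of even powers of a symmetric matrix are non-negative. -/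
theorem pow_even_apply_self_nonneg {Z : Matrix ι ι ℝ} (hZ : Zᵀ = Z) (k : ℕ) (v : ι) :
    0 ≤ (Z ^ (2 * k)) v v := by
  obtain ⟨O, l, hO, hO', rfl⟩ := exists_orthogonal_diagonalization hZ
  rw [conj_diagonal_pow hO hO', conj_diagonal_apply_self]
  exact Finset.sum_nonneg fun a _ => by rw [pow_mul]; positivity

theorem mul_pow_le_pow_succ_add_pow_succ {x y : ℝ} (hx : 0 ≤ x) (hy : 0 ≤ y) (k : ℕ) :
    x * y ^ k ≤ x ^ (k + 1) + y ^ (k + 1) := by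
  rcases le_total x y with h | h
  · calc x * y ^ k ≤ y * y ^ k := by gcongr
      _ = y ^ (k + 1) := by ring
      _ ≤ _ := le_add_of_nonneg_left (by positivity)
  · calc x * y ^ k ≤ x * x ^ k := by gcongr
      _ = x ^ (k + 1) := by ring
      _ ≤ _ := le_add_of_nonneg_right (by positivity)

/-- The numbers `O v a ^ 2` form a probability vector on the spectrum, and diagonal entries of
powers of `Z` are its moments; the scalar inequality is averaged against it. -/
theorem mul_pow_apply_self_le {Z : Matrix ι ι ℝ} (hZ : Zᵀ = Z) {x : ℝ} (hx : 0 ≤ x) (k : ℕ)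
    (v : ι) : x * (Z ^ (2 * k)) v v ≤ x ^ (k + 1) + (Z ^ (2 * (k + 1))) v v := by
  obtain ⟨O, l, hO, hO', rfl⟩ := exists_orthogonal_diagonalization hZ
  rw [conj_diagonal_pow hO hO', conj_diagonal_pow hO hO', conj_diagonal_apply_self,
    conj_diagonal_apply_self]
  have h1 : x ^ (k + 1) = ∑ a, O v a ^ 2 * x ^ (k + 1) := by
    rw [← Finset.sum_mul, sum_sq_row_eq_one hO', one_mul]
  rw [h1, ← Finset.sum_add_distrib, Finset.mul_sum]
  refine Finset.sum_le_sum fun a _ => ?_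
  rw [pow_mul, pow_mul]
  calc x * (O v a ^ 2 * (l a ^ 2) ^ k) = O v a ^ 2 * (x * (l a ^ 2) ^ k) := by ring
    _ ≤ O v a ^ 2 * (x ^ (k + 1) + (l a ^ 2) ^ (k + 1)) := by
      gcongr
      exact mul_pow_le_pow_succ_add_pow_succ hx (sq_nonneg _) k
    _ = _ := by ring

theorem opNorm_orthogonal_le {O : Matrix ι ι ℝ} (hO : Oᵀ * O = 1) : ‖O‖ ≤ 1 := by
  refine opNorm_le_of_sum_sq_le zero_le_one fun x => le_of_eq ?_
  have h : (O *ᵥ x) ⬝ᵥ (O *ᵥ x) = x ⬝ᵥ x := by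
    rw [dotProduct_mulVec, ← mulVec_transpose, mulVec_mulVec, hO, one_mulVec]
  simpa [dotProduct, sq] using h

/-- The spectral norm is controlled by the trace of an even power. -/
theorem opNorm_le_of_trace_pow_le {Z : Matrix ι ι ℝ} (hZ : Zᵀ = Z) {s : ℝ} (hs : 0 ≤ s) {q : ℕ}
    (hq : q ≠ 0) (h : (Z ^ (2 * q)).trace ≤ s ^ (2 * q)) : ‖Z‖ ≤ s := by
  obtain ⟨O, l, hO, hO', rfl⟩ := exists_orthogonal_diagonalization hZ
  rw [trace_pow_eq hO hO'] at h
  have hl : ∀ a, |l a| ≤ s := by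
    intro a
    have h1 : l a ^ (2 * q) ≤ s ^ (2 * q) :=
      (Finset.single_le_sum (f := fun a => l a ^ (2 * q))
        (fun b _ => by rw [pow_mul]; positivity) (Finset.mem_univ a)).trans h
    rw [← (even_two_mul q).pow_abs] at h1
    exact le_of_pow_le_pow_left₀ (by omega) hs h1
  have hOt : ‖Oᵀ‖ ≤ 1 := by rw [opNorm_transpose]; exact opNorm_orthogonal_le hO
  calc _ ≤ ‖O * diagonal l‖ * ‖Oᵀ‖ := Matrix.l2_opNorm_mul _ _
    _ ≤ (‖O‖ * ‖(diagonal l : Matrix ι ι ℝ)‖) * 1 := by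
      gcongr
      exact Matrix.l2_opNorm_mul _ _
    _ ≤ (1 * s) * 1 := by
      gcongr
      · exact opNorm_orthogonal_le hO
      · exact opNorm_diagonal_le hs hl
    _ = s := by ring

/-- The weights `((O₁ᵀ * O₂) i j) ^ 2` are non-negative and do not depend on the exponents. A scalar
inequality between combinations of `x ^ a * y ^ b` therefore passes to traces, although the two
matrices need not commute. -/
theorem trace_pow_mul_pow {O₁ O₂ : Matrix ι ι ℝ} (h₁ : O₁ᵀ * O₁ = 1) (h₁' : O₁ * O₁ᵀ = 1)
    (h₂ : O₂ᵀ * O₂ = 1) (h₂' : O₂ * O₂ᵀ = 1) (l₁ l₂ : ι → ℝ) (a b : ℕ) :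
    ((O₁ * diagonal l₁ * O₁ᵀ) ^ a * (O₂ * diagonal l₂ * O₂ᵀ) ^ b).trace
      = ∑ i, ∑ j, l₁ i ^ a * l₂ j ^ b * ((O₁ᵀ * O₂) i j) ^ 2 := by
  rw [conj_diagonal_pow h₁ h₁', conj_diagonal_pow h₂ h₂']
  have e : (O₁ * diagonal (fun i => l₁ i ^ a) * O₁ᵀ * (O₂ * diagonal (fun i => l₂ i ^ b) * O₂ᵀ))
      = O₁ * (diagonal (fun i => l₁ i ^ a) * (O₁ᵀ * O₂) * diagonal (fun i => l₂ i ^ b) * O₂ᵀ) := by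
    simp only [Matrix.mul_assoc]
  rw [e, trace_mul_comm, Matrix.mul_assoc]
  have e2 : O₂ᵀ * O₁ = (O₁ᵀ * O₂)ᵀ := by simp
  rw [e2]
  set M := O₁ᵀ * O₂
  have e3 : ∀ X Y : Matrix ι ι ℝ, (X * Yᵀ).trace = ∑ i, ∑ j, X i j * Y i j := fun X Y => by
    simp [trace, mul_apply]
  rw [e3]
  refine Finset.sum_congr rfl fun i _ => Finset.sum_congr rfl fun j _ => ?_
  rw [mul_diagonal, diagonal_mul]
  ring

/-- In the geometric sum for `x ^ (2k+1) - y ^ (2k+1)`, the terms `j` and `2k - j` together are at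
most `x ^ (2k) + y ^ (2k)`, since powers of `|x|` and `|y|` are ordered alike. Averaging the `2k +
1` pairs gives the factor `(2k+1)/2`. -/
theorem sub_mul_pow_sub_pow_le (x y : ℝ) (k : ℕ) :
    (x - y) * (x ^ (2 * k + 1) - y ^ (2 * k + 1))
      ≤ (2 * k + 1) / 2 * ((x - y) ^ 2 * (x ^ (2 * k) + y ^ (2 * k))) := by
  have h1 : ∀ j ∈ Finset.range (2 * k + 1),
      x ^ j * y ^ (2 * k - j) + x ^ (2 * k - j) * y ^ j ≤ x ^ (2 * k) + y ^ (2 * k) := by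
    intro j hj
    have hj' : j ≤ 2 * k := by simpa [Nat.lt_succ_iff] using hj
    set i := 2 * k - j with hi
    have hij : 2 * k = j + i := by omega
    have hx : x ^ (2 * k) = |x| ^ j * |x| ^ i := by
      rw [← pow_add, ← hij, (even_two_mul k).pow_abs]
    have hy : y ^ (2 * k) = |y| ^ j * |y| ^ i := by
      rw [← pow_add, ← hij, (even_two_mul k).pow_abs]
    rw [hx, hy]
    have h2 : x ^ j * y ^ i ≤ |x| ^ j * |y| ^ i := by
      rw [← abs_pow, ← abs_pow, ← abs_mul]; exact le_abs_self _
    have h3 : x ^ i * y ^ j ≤ |x| ^ i * |y| ^ j := by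
      rw [← abs_pow, ← abs_pow, ← abs_mul]; exact le_abs_self _
    have h4 : 0 ≤ (|x| ^ j - |y| ^ j) * (|x| ^ i - |y| ^ i) := by
      rcases le_total |x| |y| with h | h
      · exact mul_nonneg_of_nonpos_of_nonpos
          (sub_nonpos.mpr (pow_le_pow_left₀ (abs_nonneg _) h _))
          (sub_nonpos.mpr (pow_le_pow_left₀ (abs_nonneg _) h _))
      · exact mul_nonneg
          (sub_nonneg.mpr (pow_le_pow_left₀ (abs_nonneg _) h _))
          (sub_nonneg.mpr (pow_le_pow_left₀ (abs_nonneg _) h _))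
    nlinarith
  have h2 : x ^ (2 * k + 1) - y ^ (2 * k + 1)
      = (∑ j ∈ Finset.range (2 * k + 1), x ^ j * y ^ (2 * k - j)) * (x - y) := by
    have := (Commute.all x y).geom_sum₂_mul (2 * k + 1)
    simpa using this.symm
  have h3 : 2 * ∑ j ∈ Finset.range (2 * k + 1), x ^ j * y ^ (2 * k - j)
      ≤ (2 * k + 1) * (x ^ (2 * k) + y ^ (2 * k)) := by
    have h4 : ∑ j ∈ Finset.range (2 * k + 1), x ^ j * y ^ (2 * k - j)
        = ∑ j ∈ Finset.range (2 * k + 1), x ^ (2 * k - j) * y ^ j := by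
      rw [← Finset.sum_range_reflect]
      refine Finset.sum_congr rfl fun j hj => ?_
      have hj' : j ≤ 2 * k := by simpa [Nat.lt_succ_iff] using hj
      have e1 : 2 * k + 1 - 1 - j = 2 * k - j := by omega
      have e2 : 2 * k - (2 * k - j) = j := by omega
      rw [e1, e2]
    rw [two_mul]
    nth_rw 2 [h4]
    rw [← Finset.sum_add_distrib]
    refine (Finset.sum_le_sum h1).trans (le_of_eq ?_)
    rw [Finset.sum_const, Finset.card_range, nsmul_eq_mul]
    push_cast
    ring
  rw [h2]
  nlinarith [mul_le_mul_of_nonneg_left h3 (sq_nonneg (x - y))]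

/-- Mean value inequality for the trace. -/
theorem trace_sub_mul_pow_sub_pow_le {P Q : Matrix ι ι ℝ} (hP : Pᵀ = P) (hQ : Qᵀ = Q) (k : ℕ) :
    ((P - Q) * (P ^ (2 * k + 1) - Q ^ (2 * k + 1))).trace
      ≤ (2 * k + 1) / 2 * ((P - Q) * (P - Q) * (P ^ (2 * k) + Q ^ (2 * k))).trace := by
  obtain ⟨O₁, l₁, h₁, h₁', rfl⟩ := exists_orthogonal_diagonalization hP
  obtain ⟨O₂, l₂, h₂, h₂', rfl⟩ := exists_orthogonal_diagonalization hQ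
  have key := trace_pow_mul_pow h₁ h₁' h₂ h₂' l₁ l₂
  set P := O₁ * diagonal l₁ * O₁ᵀ
  set Q := O₂ * diagonal l₂ * O₂ᵀ
  -- By cyclicity every term of both expansions is the trace of some `P ^ a * Q ^ b`, so `key`
  -- reduces the claim to pairs of eigenvalues.
  have e1 : ((P - Q) * (P ^ (2 * k + 1) - Q ^ (2 * k + 1))).trace
      = (P ^ (2 * k + 2) * Q ^ 0).trace - (P ^ 1 * Q ^ (2 * k + 1)).trace
        - (P ^ (2 * k + 1) * Q ^ 1).trace + (P ^ 0 * Q ^ (2 * k + 2)).trace := by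
    rw [sub_mul, mul_sub, mul_sub, trace_sub, trace_sub, trace_sub, trace_mul_comm Q (P ^ _),
      ← pow_succ', ← pow_succ']
    simp only [pow_zero, pow_one, mul_one, one_mul]
    ring
  have e2 : ((P - Q) * (P - Q) * (P ^ (2 * k) + Q ^ (2 * k))).trace
      = (P ^ (2 * k + 2) * Q ^ 0).trace - 2 * (P ^ (2 * k + 1) * Q ^ 1).trace
        + (P ^ (2 * k) * Q ^ 2).trace + (P ^ 2 * Q ^ (2 * k)).trace
        - 2 * (P ^ 1 * Q ^ (2 * k + 1)).trace + (P ^ 0 * Q ^ (2 * k + 2)).trace := by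
    have f1 : (P * Q * P ^ (2 * k)).trace = (P ^ (2 * k + 1) * Q ^ 1).trace := by
      rw [trace_mul_comm, ← mul_assoc, ← pow_succ, pow_one]
    have f2 : (Q * P * P ^ (2 * k)).trace = (P ^ (2 * k + 1) * Q ^ 1).trace := by
      rw [mul_assoc, trace_mul_comm, ← pow_succ', pow_one]
    have f3 : (Q * Q * P ^ (2 * k)).trace = (P ^ (2 * k) * Q ^ 2).trace := by
      rw [trace_mul_comm, sq]
    have f4 : (Q * P * Q ^ (2 * k)).trace = (P ^ 1 * Q ^ (2 * k + 1)).trace := by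
      rw [mul_assoc, trace_mul_comm, mul_assoc, ← pow_succ, pow_one]
    have f5 : (P * Q * Q ^ (2 * k)).trace = (P ^ 1 * Q ^ (2 * k + 1)).trace := by
      rw [mul_assoc, ← pow_succ', pow_one]
    have f6 : (P * P * P ^ (2 * k)).trace = (P ^ (2 * k + 2) * Q ^ 0).trace := by
      rw [pow_zero, mul_one, ← sq, ← pow_add, add_comm]
    have f7 : (Q * Q * Q ^ (2 * k)).trace = (P ^ 0 * Q ^ (2 * k + 2)).trace := by
      rw [pow_zero, one_mul, ← sq, ← pow_add, add_comm]
    have f8 : (P * P * Q ^ (2 * k)).trace = (P ^ 2 * Q ^ (2 * k)).trace := by rw [sq]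
    simp only [sub_mul, mul_sub, mul_add, trace_sub, trace_add]
    rw [f1, f2, f3, f4, f5, f6, f7, f8]
    ring
  rw [e1, e2]
  simp only [key, Finset.mul_sum, ← Finset.sum_sub_distrib, ← Finset.sum_add_distrib]
  refine Finset.sum_le_sum fun i _ => Finset.sum_le_sum fun j _ => ?_
  have h := mul_le_mul_of_nonneg_right (sub_mul_pow_sub_pow_le (l₁ i) (l₂ j) k)
    (sq_nonneg ((O₁ᵀ * O₂) i j))
  refine (le_of_eq ?_).trans (h.trans (le_of_eq ?_)) <;> ring

end Trace

end RidgeFE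

end

noncomputable section

namespace RidgeFE

/-! ### Expectations under a product of Bernoulli laws -/

section Bernoulli

/-- The number `0` or `1` attached to a Boolean. -/
def bit (b : Bool) : ℝ := if b then 1 else 0

/-- The mass given to `b` by the Bernoulli law with parameter `q`. -/
def bernoulliMass (q : ℝ) (b : Bool) : ℝ := if b then q else 1 - q

variable {ι : Type*}

theorem bernoulliMass_nonneg {q : ι → ℝ} (hq : ∀ e, 0 ≤ q e ∧ q e ≤ 1) (e : ι) (b : Bool) :
    0 ≤ bernoulliMass (q e) b := by
  rw [bernoulliMass]
  split_ifs
  · exact (hq e).1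
  · linarith [(hq e).2]

variable [Fintype ι]

/-- The mass given to `g` by the product of the Bernoulli laws with parameters `q e`. -/
def productMass (q : ι → ℝ) (g : ι → Bool) : ℝ := ∏ e, bernoulliMass (q e) (g e)

theorem productMass_nonneg {q : ι → ℝ} (hq : ∀ e, 0 ≤ q e ∧ q e ≤ 1) (g : ι → Bool) :
    0 ≤ productMass q g :=
  Finset.prod_nonneg fun e _ => bernoulliMass_nonneg hq e _

variable [DecidableEq ι]

/-- Expectation under the product of the Bernoulli laws with parameters `q e`. -/
def expect (q : ι → ℝ) (f : (ι → Bool) → ℝ) : ℝ := ∑ g, productMass q g * f g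

/-- Probability under the product of the Bernoulli laws with parameters `q e`. -/
def prob (q : ι → ℝ) (B : Set (ι → Bool)) : ℝ := expect q (B.indicator 1)

variable {q : ι → ℝ}

theorem expect_mono (hq : ∀ e, 0 ≤ q e ∧ q e ≤ 1) {f f' : (ι → Bool) → ℝ} (h : ∀ g, f g ≤ f' g) :
    expect q f ≤ expect q f' :=
  Finset.sum_le_sum fun g _ => mul_le_mul_of_nonneg_left (h g) (productMass_nonneg hq g)

theorem expect_add (f f' : (ι → Bool) → ℝ) :
    expect q (fun g => f g + f' g) = expect q f + expect q f' := by
  simp [expect, mul_add, Finset.sum_add_distrib]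

theorem expect_const_mul (c : ℝ) (f : (ι → Bool) → ℝ) :
    expect q (fun g => c * f g) = c * expect q f := by
  rw [expect, expect, Finset.mul_sum]
  exact Finset.sum_congr rfl fun g _ => by ring

theorem expect_sum {κ : Type*} (s : Finset κ) (f : κ → (ι → Bool) → ℝ) :
    expect q (fun g => ∑ k ∈ s, f k g) = ∑ k ∈ s, expect q (f k) := by
  simp only [expect, Finset.mul_sum]
  exact Finset.sum_comm

theorem expect_prod (φ : ι → Bool → ℝ) :
    expect q (fun g => ∏ e, φ e (g e))
      = ∏ e, (q e * φ e true + (1 - q e) * φ e false) := by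
  have h := Finset.prod_univ_sum (fun _ : ι => (Finset.univ : Finset Bool))
    (fun e b => bernoulliMass (q e) b * φ e b)
  rw [Fintype.piFinset_univ] at h
  simp only [expect, productMass, ← Finset.prod_mul_distrib]
  rw [← h]
  exact Finset.prod_congr rfl fun e _ => by simp [bernoulliMass]

/-- The expectation factorizes, and each factor `1 + q (e^c - 1)` is at most the exponential of `q
(e^c - 1)`. -/
theorem expect_exp_le (hq : ∀ e, 0 ≤ q e ∧ q e ≤ 1) (c : ℝ) (s : Finset ι) :
    expect q (fun g => Real.exp (c * ∑ e ∈ s, bit (g e)))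
      ≤ Real.exp ((∑ e ∈ s, q e) * (Real.exp c - 1)) := by
  have h1 : ∀ g : ι → Bool, Real.exp (c * ∑ e ∈ s, bit (g e))
      = ∏ e, (fun e b => if e ∈ s then Real.exp (c * bit b) else 1) e (g e) := by
    intro g
    rw [Finset.mul_sum, Real.exp_sum, Finset.prod_ite_mem, Finset.univ_inter]
  rw [funext h1, expect_prod fun e b => if e ∈ s then Real.exp (c * bit b) else 1, Finset.sum_mul, Real.exp_sum]
  calc _ = ∏ e ∈ s, (q e * Real.exp c + (1 - q e)) := by
        rw [← Finset.univ_inter s, ← Finset.prod_ite_mem]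
        refine Finset.prod_congr rfl fun e _ => ?_
        by_cases he : e ∈ s <;> simp [he, bit]
    _ ≤ _ := by
      refine Finset.prod_le_prod (fun e _ => ?_) fun e _ => ?_
      · have := hq e
        exact add_nonneg (mul_nonneg this.1 (Real.exp_nonneg _)) (by linarith)
      · have := Real.add_one_le_exp (q e * (Real.exp c - 1))
        linarith

theorem prob_le_expect (hq : ∀ e, 0 ≤ q e ∧ q e ≤ 1) {B : Set (ι → Bool)} {f : (ι → Bool) → ℝ}
    (hf : ∀ g, 0 ≤ f g) (h : ∀ g ∈ B, 1 ≤ f g) : prob q B ≤ expect q f := by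
  refine expect_mono hq fun g => ?_
  by_cases hg : g ∈ B
  · simpa [hg] using h g hg
  · simpa [hg] using hf g

theorem prob_mono (hq : ∀ e, 0 ≤ q e ∧ q e ≤ 1) {B B' : Set (ι → Bool)} (h : B ⊆ B') :
    prob q B ≤ prob q B' :=
  expect_mono hq fun g => Set.indicator_le_indicator_of_subset h (fun _ => zero_le_one) g

theorem prob_union_le (hq : ∀ e, 0 ≤ q e ∧ q e ≤ 1) (B B' : Set (ι → Bool)) :
    prob q (B ∪ B') ≤ prob q B + prob q B' := by
  rw [prob, prob, prob, ← expect_add]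
  refine expect_mono hq fun g => ?_
  by_cases h : g ∈ B <;> by_cases h' : g ∈ B' <;> simp [h, h']

theorem prob_iUnion_le (hq : ∀ e, 0 ≤ q e ∧ q e ≤ 1) {κ : Type*} [Fintype κ]
    (B : κ → Set (ι → Bool)) : prob q (⋃ k, B k) ≤ ∑ k, prob q (B k) := by
  simp only [prob]
  rw [← expect_sum]
  refine expect_mono hq fun g => ?_
  have h0 : ∀ k ∈ Finset.univ, 0 ≤ (B k).indicator (1 : (ι → Bool) → ℝ) g := fun k _ =>
    Set.indicator_nonneg (fun _ _ => zero_le_one) g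
  by_cases h : g ∈ ⋃ k, B k
  · obtain ⟨k, hk⟩ := Set.mem_iUnion.mp h
    refine le_trans (le_of_eq ?_) (Finset.single_le_sum h0 (Finset.mem_univ k))
    simp [h, hk]
  · rw [Set.indicator_of_notMem h]
    exact Finset.sum_nonneg h0

/-- Upper tail of a sum of independent Bernoulli variables. -/
theorem prob_upper_tail (hq : ∀ e, 0 ≤ q e ∧ q e ≤ 1) (s : Finset ι) {D t : ℝ} (ht : 0 ≤ t)
    (ht1 : t ≤ 1) (hD : ∑ e ∈ s, q e ≤ D) :
    prob q {g | (∑ e ∈ s, q e) + 2 * t * D < ∑ e ∈ s, bit (g e)} ≤ Real.exp (-(t ^ 2 * D)) := by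
  set d := ∑ e ∈ s, q e
  have hd : 0 ≤ d := Finset.sum_nonneg fun e _ => (hq e).1
  calc _ ≤ expect q fun g => Real.exp (-(t * (d + 2 * t * D)))
        * Real.exp (t * ∑ e ∈ s, bit (g e)) := by
        refine prob_le_expect hq (fun g => by positivity) fun g hg => ?_
        rw [← Real.exp_add, Real.one_le_exp_iff]
        nlinarith [mul_le_mul_of_nonneg_left (le_of_lt hg) ht]
    _ ≤ Real.exp (-(t * (d + 2 * t * D))) * Real.exp (d * (Real.exp t - 1)) := by
      rw [expect_const_mul]
      gcongr
      exact expect_exp_le hq t s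
    _ ≤ _ := by
      rw [← Real.exp_add, Real.exp_le_exp]
      -- From `e^t - 1 - t ≤ t²` on `[0, 1]`, the exponent is at most `-2t²D + t²d`, and `d ≤ D`.
      have h := (abs_le.mp (Real.abs_exp_sub_one_sub_id_le (abs_le.mpr ⟨by linarith, ht1⟩))).2
      nlinarith [mul_le_mul_of_nonneg_left h hd, mul_le_mul_of_nonneg_left hD (sq_nonneg t)]

theorem exp_neg_le_quadratic {x : ℝ} (hx : 0 ≤ x) : Real.exp (-x) ≤ 1 - x + x ^ 2 / 2 := by
  have h := Real.quadratic_le_exp_of_nonneg hx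
  have h1 : 0 < 1 - x + x ^ 2 / 2 := by nlinarith [sq_nonneg (x - 1)]
  rw [Real.exp_neg, inv_le_iff_one_le_mul₀ (Real.exp_pos x)]
  -- The product equals `1 + x⁴/4`.
  calc (1 : ℝ) ≤ (1 - x + x ^ 2 / 2) * (1 + x + x ^ 2 / 2) := by nlinarith [sq_nonneg (x ^ 2)]
    _ ≤ _ := by gcongr

/-- Lower tail of a sum of independent Bernoulli variables. -/
theorem prob_lower_tail (hq : ∀ e, 0 ≤ q e ∧ q e ≤ 1) (s : Finset ι) {D u : ℝ} (hu : 0 ≤ u)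
    (hD : ∑ e ∈ s, q e ≤ D) :
    prob q {g | ∑ e ∈ s, bit (g e) < (∑ e ∈ s, q e) - u * D} ≤ Real.exp (-(u ^ 2 * D / 2)) := by
  set d := ∑ e ∈ s, q e
  have hd : 0 ≤ d := Finset.sum_nonneg fun e _ => (hq e).1
  calc _ ≤ expect q fun g => Real.exp (u * (d - u * D))
        * Real.exp (-u * ∑ e ∈ s, bit (g e)) := by
        refine prob_le_expect hq (fun g => by positivity) fun g hg => ?_
        rw [← Real.exp_add, Real.one_le_exp_iff]
        nlinarith [mul_le_mul_of_nonneg_left (le_of_lt hg) hu]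
    _ ≤ Real.exp (u * (d - u * D)) * Real.exp (d * (Real.exp (-u) - 1)) := by
      rw [expect_const_mul]
      gcongr
      exact expect_exp_le hq (-u) s
    _ ≤ _ := by
      rw [← Real.exp_add, Real.exp_le_exp]
      nlinarith [mul_le_mul_of_nonneg_left (exp_neg_le_quadratic hu) hd,
        mul_le_mul_of_nonneg_left hD (sq_nonneg u)]

/-- Dividing by 25, the square of the 5 in the norm bound `5 t`, outweighs the moment growth
`e^(2k)` and leaves `e^(-k)`. -/
theorem exp_three_le : Real.exp 3 ≤ 25 := by
  have h := Real.exp_one_lt_d9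
  have : Real.exp 3 = Real.exp 1 ^ 3 := by rw [← Real.exp_nat_mul]; norm_num
  rw [this]
  calc Real.exp 1 ^ 3 ≤ 2.7182818286 ^ 3 := by gcongr
    _ ≤ 25 := by norm_num

/-- Moments of a sum of independent Bernoulli variables. -/
theorem expect_degree_pow_le (hq : ∀ e, 0 ≤ q e ∧ q e ≤ 1) (s : Finset ι) {D : ℝ} (hD0 : 0 < D)
    (hD : ∑ e ∈ s, q e ≤ D) (k : ℕ) (hk : k ≤ D) :
    expect q (fun g => ((∑ e ∈ s, (bit (g e) + q e)) / D / 25) ^ k) ≤ Real.exp (-k) := by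
  set d := ∑ e ∈ s, q e with hd_def
  have hd : 0 ≤ d := Finset.sum_nonneg fun e _ => (hq e).1
  have hdD : d / D ≤ 1 := (div_le_one hD0).mpr hD
  have hkD : 0 ≤ (k : ℝ) / D := by positivity
  have h1 : ∀ g : ι → Bool, ((∑ e ∈ s, (bit (g e) + q e)) / D / 25) ^ k
      ≤ Real.exp (k * (d / D) - k) / 25 ^ k * Real.exp (k / D * ∑ e ∈ s, bit (g e)) := by
    intro g
    have hb : 0 ≤ ∑ e ∈ s, bit (g e) := Finset.sum_nonneg fun e _ => by
      rw [bit]; split_ifs <;> norm_num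
    rw [Finset.sum_add_distrib, ← hd_def, div_pow, div_mul_eq_mul_div, ← Real.exp_add]
    gcongr
    set x := (∑ e ∈ s, bit (g e) + d) / D with hx
    have hx0 : 0 ≤ x := by positivity
    -- The bound `x ≤ e^(x-1)` replaces the moment by an exponential moment with parameter `k / D`,
    -- at most 1 because `k ≤ D`.
    calc x ^ k ≤ Real.exp (x - 1) ^ k := by
          gcongr
          linarith [Real.add_one_le_exp (x - 1)]
      _ = Real.exp (k * (x - 1)) := by rw [← Real.exp_nat_mul]
      _ = _ := by
        rw [hx]
        congr 1
        field_simp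
        ring
  calc _ ≤ expect q fun g => Real.exp (k * (d / D) - k) / 25 ^ k
        * Real.exp (k / D * ∑ e ∈ s, bit (g e)) := expect_mono hq h1
    _ ≤ Real.exp (k * (d / D) - k) / 25 ^ k * Real.exp (d * (Real.exp (k / D) - 1)) := by
      rw [expect_const_mul]
      gcongr
      exact expect_exp_le hq _ s
    _ ≤ Real.exp (2 * k) / 25 ^ k := by
      rw [div_mul_eq_mul_div, ← Real.exp_add]
      gcongr
      have h2 : (k : ℝ) / D ≤ 1 := (div_le_one hD0).mpr hk
      have h := (abs_le.mp (Real.abs_exp_sub_one_sub_id_le (abs_le.mpr ⟨by linarith, h2⟩))).2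
      have h3 : d * (Real.exp (k / D) - 1) ≤ d * (2 * (k / D)) := by
        gcongr
        nlinarith
      have h4 : d * (2 * (k / D)) = 2 * (k * (d / D)) := by ring
      have h5 : (k : ℝ) * (d / D) ≤ k * 1 := by gcongr
      linarith
    _ ≤ Real.exp (2 * k) / Real.exp 3 ^ k := by
      gcongr
      exact exp_three_le
    _ = _ := by
      rw [← Real.exp_nat_mul, ← Real.exp_sub]
      congr 1
      ring

/-! ### Resampling one coordinate -/

theorem productMass_update_mul (g : ι → Bool) (e : ι) (b : Bool) :
    productMass q (Function.update g e b) * bernoulliMass (q e) (g e)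
      = productMass q g * bernoulliMass (q e) b := by
  rw [productMass, productMass, ← Finset.mul_prod_erase _ _ (Finset.mem_univ e),
    ← Finset.mul_prod_erase _ _ (Finset.mem_univ e), Function.update_self]
  have : ∏ x ∈ Finset.univ.erase e, bernoulliMass (q x) (Function.update g e b x)
      = ∏ x ∈ Finset.univ.erase e, bernoulliMass (q x) (g x) :=
    Finset.prod_congr rfl fun x hx => by rw [Function.update_of_ne (Finset.ne_of_mem_erase hx)]
  rw [this]
  ring

/-- Expectation over a configuration together with an independent copy of its coordinate `e`. -/
def expect₂ (q : ι → ℝ) (e : ι) (Φ : (ι → Bool) → Bool → ℝ) : ℝ :=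
  expect q fun g => ∑ b, bernoulliMass (q e) b * Φ g b

/-- Exchangeability: swapping the coordinate with its independent copy is an involution that
preserves the joint mass. -/
theorem expect₂_swap (e : ι) (Φ : (ι → Bool) → Bool → ℝ) :
    expect₂ q e Φ = expect₂ q e fun g b => Φ (Function.update g e b) (g e) := by
  simp only [expect₂, expect, Finset.mul_sum]
  rw [← Fintype.sum_prod_type', ← Fintype.sum_prod_type']
  refine Finset.sum_nbij' (fun x => (Function.update x.1 e x.2, x.1 e))
    (fun x => (Function.update x.1 e x.2, x.1 e)) (by simp) (by simp) (by simp) (by simp) ?_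
  rintro ⟨g, b⟩ -
  simp only [Function.update_idem, Function.update_self, Function.update_eq_self, ← mul_assoc]
  rw [productMass_update_mul]

end Bernoulli

end RidgeFE

end

noncomputable section

namespace RidgeFE

/-! ### Trace moments of a centered sum of independent matrices -/

section Moments

variable {ι V : Type*} [Fintype ι]

/-- The centered random matrix `∑ e, (g e - q e) K e`. -/
def centeredSum (q : ι → ℝ) (K : ι → Matrix V V ℝ) (g : ι → Bool) : Matrix V V ℝ :=
  ∑ e, (bit (g e) - q e) • K e

variable {q : ι → ℝ} {K : ι → Matrix V V ℝ}

theorem centeredSum_transpose (hK : ∀ e, (K e)ᵀ = K e) (g : ι → Bool) :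
    (centeredSum q K g)ᵀ = centeredSum q K g := by
  simp [centeredSum, transpose_sum, transpose_smul, hK]

variable [DecidableEq ι]

theorem centeredSum_sub_update (g : ι → Bool) (e : ι) (b : Bool) :
    centeredSum q K g - centeredSum q K (Function.update g e b) = (bit (g e) - bit b) • K e := by
  rw [centeredSum, centeredSum, ← Finset.sum_sub_distrib, Finset.sum_eq_single e]
  · rw [Function.update_self, ← sub_smul, sub_sub_sub_cancel_right]
  · intro x _ hx
    rw [Function.update_of_ne hx, sub_self]
  · simp

theorem expect₂_mono (hq : ∀ e, 0 ≤ q e ∧ q e ≤ 1) (e : ι) {Φ Ψ : (ι → Bool) → Bool → ℝ}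
    (h : ∀ g b, Φ g b ≤ Ψ g b) : expect₂ q e Φ ≤ expect₂ q e Ψ :=
  expect_mono hq fun g => Finset.sum_le_sum fun b _ =>
    mul_le_mul_of_nonneg_left (h g b) (bernoulliMass_nonneg hq e b)

theorem expect₂_add (e : ι) (Φ Ψ : (ι → Bool) → Bool → ℝ) :
    expect₂ q e (fun g b => Φ g b + Ψ g b) = expect₂ q e Φ + expect₂ q e Ψ := by
  simp only [expect₂, mul_add, Finset.sum_add_distrib, expect_add]

theorem expect₂_const_mul (e : ι) (c : ℝ) (Φ : (ι → Bool) → Bool → ℝ) :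
    expect₂ q e (fun g b => c * Φ g b) = c * expect₂ q e Φ := by
  simp only [expect₂, mul_left_comm _ c, ← Finset.mul_sum, expect_const_mul]

variable [Fintype V] [DecidableEq V] {κ : ι → V → ℝ}

theorem trace_sq_mul_pow {Z B : Matrix V V ℝ} {d : V → ℝ} (hB : B * B = diagonal d) (k : ℕ) :
    (B * B * Z ^ (2 * k)).trace = ∑ v, d v * (Z ^ (2 * k)) v v := by
  rw [hB]
  simp [trace, diagonal_mul]

/-- Contribution of one coordinate to the trace moment. -/
theorem expect_trace_summand_le (hq : ∀ e, 0 ≤ q e ∧ q e ≤ 1) (hK : ∀ e, (K e)ᵀ = K e)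
    (hκ : ∀ e v, 0 ≤ κ e v) (hKκ : ∀ e, K e * K e = diagonal (κ e)) (k : ℕ) (e : ι) :
    expect q (fun g => (((bit (g e) - q e) • K e) * centeredSum q K g ^ (2 * k + 1)).trace)
      ≤ (2 * k + 1) / 2 * expect q fun g =>
        (bit (g e) + q e) * ∑ v, κ e v * (centeredSum q K g ^ (2 * k)) v v := by
  set Z := centeredSum q K with hZ
  have hZt : ∀ g, (Z g)ᵀ = Z g := centeredSum_transpose hK
  have hsub : ∀ g b, Z g - Z (Function.update g e b) = (bit (g e) - bit b) • K e := fun g b =>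
    centeredSum_sub_update g e b
  set Φ : (ι → Bool) → Bool → ℝ := fun g b =>
    (bit (g e) - bit b) * (K e * Z g ^ (2 * k + 1)).trace with hΦ
  set Ψ : (ι → Bool) → Bool → ℝ := fun g b =>
    (bit (g e) - bit b) ^ 2 * (K e * K e * Z g ^ (2 * k)).trace with hΨ
  -- The mean `q e` is the average of `bit b` over the independent copy.
  have h1 : expect q (fun g => (((bit (g e) - q e) • K e) * Z g ^ (2 * k + 1)).trace)
      = expect₂ q e Φ := by
    rw [expect₂]
    congr 1
    funext g
    rw [Fintype.sum_bool, smul_mul, trace_smul, smul_eq_mul, hΦ]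
    simp only [bernoulliMass, bit]
    split_ifs <;> simp_all
  -- Adding the swapped integrand produces `(P - Q)(P^(2k+1) - Q^(2k+1))` under the trace, with `P`,
  -- `Q` the sums before and after resampling. The trace mean value inequality applies, and
  -- exchangeability merges the two terms on the right.
  have h2 : 2 * expect₂ q e Φ
      ≤ (2 * k + 1) / 2 * (2 * expect₂ q e Ψ) := by
    have hs := expect₂_swap (q := q) e Φ
    have hs' := expect₂_swap (q := q) e Ψ
    calc 2 * expect₂ q e Φ = expect₂ q e Φ
          + expect₂ q e (fun g b => Φ (Function.update g e b) (g e)) := by rw [← hs]; ring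
      _ = expect₂ q e fun g b => Φ g b + Φ (Function.update g e b) (g e) :=
        (expect₂_add e _ _).symm
      _ ≤ expect₂ q e fun g b => (2 * k + 1) / 2
          * (Ψ g b + Ψ (Function.update g e b) (g e)) := by
        refine expect₂_mono hq e fun g b => ?_
        have h := trace_sub_mul_pow_sub_pow_le (hZt g) (hZt (Function.update g e b)) k
        rw [hsub] at h
        refine (le_of_eq ?_).trans (h.trans (le_of_eq ?_))
        · simp only [hΦ, Function.update_self, smul_mul, trace_smul, smul_eq_mul, mul_sub,
            trace_sub]
          ring
        · simp only [hΨ, Function.update_self, smul_mul, Matrix.mul_smul, trace_smul, smul_eq_mul,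
            mul_add, trace_add]
          ring
      _ = (2 * k + 1) / 2 * (expect₂ q e Ψ
          + expect₂ q e (fun g b => Ψ (Function.update g e b) (g e))) := by
        rw [← expect₂_add, expect₂_const_mul]
      _ = _ := by rw [← hs']; ring
  -- Averaged over `b`, the squared difference is `q e` when `g e` is false and `1 - q e` when it is
  -- true, hence at most `bit (g e) + q e`.
  have h3 : expect₂ q e Ψ
      ≤ expect q fun g => (bit (g e) + q e) * ∑ v, κ e v * (Z g ^ (2 * k)) v v := by
    refine expect_mono hq fun g => ?_
    simp only [hΨ]
    rw [trace_sq_mul_pow (hKκ e)]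
    have hs : 0 ≤ ∑ v, κ e v * (Z g ^ (2 * k)) v v :=
      Finset.sum_nonneg fun v _ => mul_nonneg (hκ e v) (pow_even_apply_self_nonneg (hZt g) k v)
    set s := ∑ v, κ e v * (Z g ^ (2 * k)) v v
    simp only [← mul_assoc, ← Finset.sum_mul]
    refine mul_le_mul_of_nonneg_right ?_ hs
    have := hq e
    rw [Fintype.sum_bool]
    simp only [bernoulliMass, bit]
    generalize g e = b
    cases b
    · norm_num
    · norm_num
      linarith
  rw [h1]
  have hk : (0 : ℝ) ≤ (2 * k + 1) / 2 := by positivity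
  nlinarith [mul_le_mul_of_nonneg_left h3 hk]

/-- The trace moments are controlled by the moments of the diagonal square function. -/
theorem expect_trace_pow_le (hq : ∀ e, 0 ≤ q e ∧ q e ≤ 1) (hK : ∀ e, (K e)ᵀ = K e)
    (hκ : ∀ e v, 0 ≤ κ e v) (hKκ : ∀ e, K e * K e = diagonal (κ e)) (k : ℕ) :
    expect q (fun g => (centeredSum q K g ^ (2 * (k + 1))).trace)
      ≤ ∑ v, expect q fun g =>
          ((2 * k + 1) * ∑ e, (bit (g e) + q e) * κ e v) ^ (k + 1) := by
  set Z := centeredSum q K with hZ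
  have hZt : ∀ g, (Z g)ᵀ = Z g := centeredSum_transpose hK
  have hbit : ∀ b, 0 ≤ bit b := fun b => by rw [bit]; split_ifs <;> norm_num
  -- One factor `Z` is expanded into its summands, and each coordinate is treated by resampling.
  have h1 : expect q (fun g => (Z g ^ (2 * (k + 1))).trace)
      ≤ expect q fun g => (2 * k + 1) / 2 * ∑ v, (∑ e, (bit (g e) + q e) * κ e v)
          * (Z g ^ (2 * k)) v v := by
    calc _ = ∑ e, expect q (fun g => (((bit (g e) - q e) • K e) * Z g ^ (2 * k + 1)).trace) := by
          rw [← expect_sum]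
          congr 1
          funext g
          rw [← trace_sum, ← Finset.sum_mul]
          change _ = (Z g * Z g ^ (2 * k + 1)).trace
          rw [← pow_succ']
          rfl
      _ ≤ ∑ e, (2 * k + 1) / 2 * expect q fun g =>
          (bit (g e) + q e) * ∑ v, κ e v * (Z g ^ (2 * k)) v v :=
        Finset.sum_le_sum fun e _ => expect_trace_summand_le hq hK hκ hKκ k e
      _ = _ := by
        rw [← Finset.mul_sum, ← expect_sum, ← expect_const_mul]
        congr 1
        funext g
        congr 1
        simp only [Finset.mul_sum, Finset.sum_mul]
        rw [Finset.sum_comm]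
        exact Finset.sum_congr rfl fun v _ => Finset.sum_congr rfl fun e _ => by ring
  have h2 : (expect q fun g => (2 * k + 1) / 2 * ∑ v, (∑ e, (bit (g e) + q e) * κ e v)
          * (Z g ^ (2 * k)) v v)
      -- The factor 1/2 from the mean value inequality leaves half of the trace moment on the right,
      -- to be absorbed by the left side.
      ≤ expect q fun g => 1 / 2 * (∑ v, ((2 * k + 1) * ∑ e, (bit (g e) + q e) * κ e v) ^ (k + 1))
        + 1 / 2 * (Z g ^ (2 * (k + 1))).trace := by
    refine expect_mono hq fun g => ?_
    have : (Z g ^ (2 * (k + 1))).trace = ∑ v, (Z g ^ (2 * (k + 1))) v v := rfl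
    rw [this, ← mul_add, ← Finset.sum_add_distrib, Finset.mul_sum, Finset.mul_sum]
    refine Finset.sum_le_sum fun v _ => ?_
    have h := mul_pow_apply_self_le (hZt g)
      (x := (2 * k + 1) * ∑ e, (bit (g e) + q e) * κ e v)
      (mul_nonneg (by positivity) (Finset.sum_nonneg fun e _ =>
        mul_nonneg (add_nonneg (hbit _) (hq e).1) (hκ e v))) k v
    linarith
  have h3 := h1.trans h2
  rw [expect_add, expect_const_mul, expect_const_mul, expect_sum] at h3
  linarith

end Moments

end RidgeFE

end

noncomputable section

namespace RidgeFE

open scoped Matrix.Norms.L2Operator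

/-! ### Concentration of the adjacency matrix of a random bipartite network -/

section Adjacency

variable {n p : ℕ}

/-- The adjacency matrix of a network. -/
def adj (g : Fin n × Fin p → Bool) : Matrix (Fin n) (Fin p) ℝ := Matrix.of fun i j => bit (g (i, j))

/-- The pairs that contain a given worker or firm. -/
def star (v : Fin n ⊕ Fin p) : Finset (Fin n × Fin p) :=
  Sum.elim (fun i => {i} ×ˢ Finset.univ) (fun j => Finset.univ ×ˢ {j}) v

/-- The regularized expected degree of a worker or firm. -/
def regDegree (lamW lamF : ℝ) (A₀ : Matrix (Fin n) (Fin p) ℝ) (v : Fin n ⊕ Fin p) : ℝ :=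
  Sum.elim (fun i => (∑ j, A₀ i j) + lamW) (fun j => (∑ i, A₀ i j) + lamF) v

/-- The normalized symmetric matrix with two non-zero entries attached to a pair. -/
def edgeMatrix (lamW lamF : ℝ) (A₀ : Matrix (Fin n) (Fin p) ℝ) (e : Fin n × Fin p) :
    Matrix (Fin n ⊕ Fin p) (Fin n ⊕ Fin p) ℝ :=
  Matrix.fromBlocks 0
    (Matrix.single e.1 e.2
      (√(regDegree lamW lamF A₀ (Sum.inl e.1)) * √(regDegree lamW lamF A₀ (Sum.inr e.2)))⁻¹)
    (Matrix.single e.2 e.1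
      (√(regDegree lamW lamF A₀ (Sum.inl e.1)) * √(regDegree lamW lamF A₀ (Sum.inr e.2)))⁻¹) 0

/-- The diagonal of the square of `edgeMatrix`. -/
def edgeWeight (lamW lamF : ℝ) (A₀ : Matrix (Fin n) (Fin p) ℝ) (e : Fin n × Fin p) :
    Fin n ⊕ Fin p → ℝ :=
  Sum.elim
    (Pi.single e.1
      (regDegree lamW lamF A₀ (Sum.inl e.1) * regDegree lamW lamF A₀ (Sum.inr e.2))⁻¹)
    (Pi.single e.2
      (regDegree lamW lamF A₀ (Sum.inl e.1) * regDegree lamW lamF A₀ (Sum.inr e.2))⁻¹)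

variable {lamW lamF : ℝ} {A₀ : Matrix (Fin n) (Fin p) ℝ}

theorem sum_star_inl (f : Fin n × Fin p → ℝ) (i : Fin n) :
    ∑ e ∈ star (Sum.inl i), f e = ∑ j, f (i, j) := by
  rw [star, Sum.elim_inl, Finset.sum_product, Finset.sum_singleton]

theorem sum_star_inr (f : Fin n × Fin p → ℝ) (j : Fin p) :
    ∑ e ∈ star (Sum.inr j), f e = ∑ i, f (i, j) := by
  rw [star, Sum.elim_inr, Finset.sum_product]
  simp only [Finset.sum_singleton]

theorem sum_star_lt_regDegree (hW : 0 < lamW) (hF : 0 < lamF) (v : Fin n ⊕ Fin p) :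
    ∑ e ∈ star v, A₀ e.1 e.2 < regDegree lamW lamF A₀ v := by
  cases v with
  | inl i => rw [sum_star_inl, regDegree, Sum.elim_inl]; linarith
  | inr j => rw [sum_star_inr, regDegree, Sum.elim_inr]; linarith

theorem regDegree_pos (hA : ∀ i j, 0 ≤ A₀ i j) (hW : 0 < lamW) (hF : 0 < lamF)
    (v : Fin n ⊕ Fin p) : 0 < regDegree lamW lamF A₀ v :=
  (Finset.sum_nonneg fun e _ => hA e.1 e.2).trans_lt (sum_star_lt_regDegree hW hF v)

theorem edgeMatrix_transpose (e : Fin n × Fin p) :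
    (edgeMatrix lamW lamF A₀ e)ᵀ = edgeMatrix lamW lamF A₀ e := by
  simp [edgeMatrix, fromBlocks_transpose, transpose_single]

/-- An edge matrix exchanges the two endpoints up to a scalar, so its square is diagonal; this makes
the square function a weighted degree at each vertex. -/
theorem edgeMatrix_mul_self (hA : ∀ i j, 0 ≤ A₀ i j) (hW : 0 < lamW) (hF : 0 < lamF)
    (e : Fin n × Fin p) :
    edgeMatrix lamW lamF A₀ e * edgeMatrix lamW lamF A₀ e
      = diagonal (edgeWeight lamW lamF A₀ e) := by
  have h1 := (regDegree_pos hA hW hF (Sum.inl e.1)).le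
  have h2 := (regDegree_pos hA hW hF (Sum.inr e.2)).le
  rw [edgeMatrix, fromBlocks_multiply, edgeWeight, ← fromBlocks_diagonal, diagonal_single,
    diagonal_single, single_mul_single_same, single_mul_single_same, ← mul_inv, mul_mul_mul_comm,
    Real.mul_self_sqrt h1, Real.mul_self_sqrt h2]
  simp

theorem edgeWeight_nonneg (hA : ∀ i j, 0 ≤ A₀ i j) (hW : 0 < lamW) (hF : 0 < lamF)
    (e : Fin n × Fin p) (v : Fin n ⊕ Fin p) : 0 ≤ edgeWeight lamW lamF A₀ e v := by
  have h1 := regDegree_pos hA hW hF (Sum.inl e.1)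
  have h2 := regDegree_pos hA hW hF (Sum.inr e.2)
  have h3 := (inv_pos.mpr (mul_pos h1 h2)).le
  cases v with
  | inl i =>
    rw [edgeWeight, Sum.elim_inl, Pi.single_apply]
    split_ifs
    exacts [h3, le_rfl]
  | inr j =>
    rw [edgeWeight, Sum.elim_inr, Pi.single_apply]
    split_ifs
    exacts [h3, le_rfl]

/-- The inverse degree at `v` is kept for normalization and the one at the opposite endpoint is
bounded by `M`. -/
theorem edgeWeight_le (hA : ∀ i j, 0 ≤ A₀ i j) (hW : 0 < lamW) (hF : 0 < lamF) {M : ℝ}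
    (hM : ∀ v, (regDegree lamW lamF A₀ v)⁻¹ ≤ M) (e : Fin n × Fin p) (v : Fin n ⊕ Fin p) :
    edgeWeight lamW lamF A₀ e v ≤ if e ∈ star v then M / regDegree lamW lamF A₀ v else 0 := by
  have hpos := regDegree_pos hA hW hF
  cases v with
  | inl i =>
    rw [edgeWeight, Sum.elim_inl, Pi.single_apply]
    by_cases h : i = e.1
    · subst h
      rw [if_pos rfl, if_pos (by simp [star]), mul_inv, mul_comm, div_eq_mul_inv]
      have := inv_pos.mpr (hpos (Sum.inl e.1))
      gcongr
      exact hM _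
    · rw [if_neg h]
      have := (inv_pos.mpr (hpos (Sum.inl i))).le.trans (hM (Sum.inl i))
      split_ifs
      exacts [div_nonneg this (hpos _).le, le_rfl]
  | inr j =>
    rw [edgeWeight, Sum.elim_inr, Pi.single_apply]
    by_cases h : j = e.2
    · subst h
      rw [if_pos rfl, if_pos (by simp [star]), mul_inv, div_eq_mul_inv]
      have := inv_pos.mpr (hpos (Sum.inr e.2))
      gcongr
      exact hM _
    · rw [if_neg h]
      have := (inv_pos.mpr (hpos (Sum.inr j))).le.trans (hM (Sum.inr j))
      split_ifs
      exacts [div_nonneg this (hpos _).le, le_rfl]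

/-- Symmetric dilation of the rectangular matrix, which makes the trace method available. -/
theorem centeredSum_edgeMatrix (g : Fin n × Fin p → Bool) :
    centeredSum (fun e => A₀ e.1 e.2) (edgeMatrix lamW lamF A₀) g
      = Matrix.fromBlocks 0 (normalized lamW lamF A₀ (adj g - A₀))
          (normalized lamW lamF A₀ (adj g - A₀))ᵀ 0 := by
  ext v w
  rw [centeredSum, Matrix.sum_apply, Fintype.sum_prod_type]
  rcases v with i | j <;> rcases w with i' | j'
  · simp [edgeMatrix]
  · simp [edgeMatrix, normalized, adj, Matrix.single_apply, ite_and, div_eq_mul_inv, regDegree]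
  · simp [edgeMatrix, normalized, adj, Matrix.single_apply, ite_and, div_eq_mul_inv, regDegree]
  · simp [edgeMatrix]

theorem opNorm_le_opNorm_fromBlocks (B : Matrix (Fin n) (Fin p) ℝ) :
    ‖B‖ ≤ ‖Matrix.fromBlocks 0 B Bᵀ 0‖ := by
  refine opNorm_le_of_sum_sq_le (norm_nonneg _) fun x => ?_
  have h := sum_sq_mulVec_le (Matrix.fromBlocks 0 B Bᵀ 0) (Sum.elim 0 x)
  rw [fromBlocks_mulVec, Fintype.sum_sum_type, Fintype.sum_sum_type] at h
  simpa [-add_le_iff_nonpos_right] using h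

/-- Tail bound for the spectral norm of the normalized centered adjacency matrix. -/
theorem prob_norm_normalized_le (hA : ∀ i j, 0 ≤ A₀ i j ∧ A₀ i j ≤ 1) (hW : 0 < lamW)
    (hF : 0 < lamF) {M L t : ℝ} (hM : ∀ v, (regDegree lamW lamF A₀ v)⁻¹ ≤ M) (hM0 : 0 < M)
    (hL : 2 ≤ L) (ht0 : 0 ≤ t) (ht1 : t ≤ 1) (ht : t ^ 2 = 3 * M * L) :
    prob (fun e => A₀ e.1 e.2) {g | 5 * t < ‖normalized lamW lamF A₀ (adj g - A₀)‖}
      ≤ ((n : ℝ) + p) * Real.exp (-L) := by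
  have hA' : ∀ i j, 0 ≤ A₀ i j := fun i j => (hA i j).1
  set q : Fin n × Fin p → ℝ := fun e => A₀ e.1 e.2 with hq_def
  have hq : ∀ e, 0 ≤ q e ∧ q e ≤ 1 := fun e => hA e.1 e.2
  have hpos := regDegree_pos (A₀ := A₀) hA' hW hF
  have htpos : 0 < t := by
    have : 0 < t ^ 2 := by rw [ht]; positivity
    exact lt_of_le_of_ne ht0 fun h => by simp [← h] at this
  -- The moment order is `2 (k + 1) = 2 ⌈L⌉`, so the final factor `e^(-(k+1))` is at most `e^(-L)`.
  obtain ⟨k, hk⟩ : ∃ k, ⌈L⌉₊ = k + 1 :=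
    Nat.exists_eq_succ_of_ne_zero (Nat.ceil_pos.mpr (by linarith)).ne'
  have hkL : L ≤ k + 1 := by have := Nat.le_ceil L; rw [hk] at this; exact_mod_cast this
  have hkL' : (k : ℝ) + 1 < L + 1 := by
    have := Nat.ceil_lt_add_one (show 0 ≤ L by linarith); rw [hk] at this; exact_mod_cast this
  -- Since `k < L` and `L ≥ 1`, `2k + 1 ≤ 3L`; this is where the 3 in `t ^ 2 = 3 * M * L` is used.
  have hkt : (2 * k + 1) * M ≤ t ^ 2 := by rw [ht]; nlinarith
  set Z := centeredSum q (edgeMatrix lamW lamF A₀) with hZ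
  have hZt : ∀ g, (Z g)ᵀ = Z g := centeredSum_transpose edgeMatrix_transpose
  have hmom := expect_trace_pow_le (q := q) hq edgeMatrix_transpose
    (edgeWeight_nonneg hA' hW hF) (edgeMatrix_mul_self (A₀ := A₀) hA' hW hF) k
  have hs : 0 < (5 * t) ^ (2 * (k + 1)) := by positivity
  have htr : ∀ g, 0 ≤ (Z g ^ (2 * (k + 1))).trace := fun g =>
    Finset.sum_nonneg fun v _ => pow_even_apply_self_nonneg (hZt g) (k + 1) v
  have hbit : ∀ b, 0 ≤ bit b := fun b => by rw [bit]; split_ifs <;> norm_num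
  calc _ ≤ expect q fun g => ((5 * t) ^ (2 * (k + 1)))⁻¹ * (Z g ^ (2 * (k + 1))).trace := by
        refine prob_le_expect hq (fun g => mul_nonneg (inv_pos.mpr hs).le (htr g)) fun g hg => ?_
        rw [inv_mul_eq_div, one_le_div hs]
        by_contra! hcon
        have h1 := opNorm_le_of_trace_pow_le (hZt g) (by positivity) (by omega) hcon.le
        have h2 := opNorm_le_opNorm_fromBlocks (normalized lamW lamF A₀ (adj g - A₀))
        rw [← centeredSum_edgeMatrix] at h2
        exact absurd (h2.trans h1) (not_le.mpr hg)
    _ ≤ ((5 * t) ^ (2 * (k + 1)))⁻¹ * ∑ v, expect q fun g =>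
          ((2 * k + 1) * ∑ e, (bit (g e) + q e) * edgeWeight lamW lamF A₀ e v) ^ (k + 1) := by
      rw [expect_const_mul]
      gcongr
    _ = ∑ v, expect q fun g => ((5 * t) ^ (2 * (k + 1)))⁻¹ *
          ((2 * k + 1) * ∑ e, (bit (g e) + q e) * edgeWeight lamW lamF A₀ e v) ^ (k + 1) := by
      rw [Finset.mul_sum]
      simp only [expect_const_mul]
    _ ≤ ∑ v, expect q fun g =>
          ((∑ e ∈ star v, (bit (g e) + q e)) / regDegree lamW lamF A₀ v / 25) ^ (k + 1) := by
      refine Finset.sum_le_sum fun v _ => expect_mono hq fun g => ?_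
      rw [pow_mul, ← inv_pow, ← mul_pow]
      have hw : 0 ≤ ∑ e, (bit (g e) + q e) * edgeWeight lamW lamF A₀ e v :=
        Finset.sum_nonneg fun e _ => mul_nonneg (add_nonneg (hbit _) (hq e).1)
          (edgeWeight_nonneg hA' hW hF e v)
      have hw2 : ∑ e, (bit (g e) + q e) * edgeWeight lamW lamF A₀ e v
          ≤ (∑ e ∈ star v, (bit (g e) + q e)) * (M / regDegree lamW lamF A₀ v) := by
        calc _ ≤ ∑ e, (bit (g e) + q e)
              * (if e ∈ star v then M / regDegree lamW lamF A₀ v else 0) := by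
              refine Finset.sum_le_sum fun e _ => mul_le_mul_of_nonneg_left
                (edgeWeight_le hA' hW hF hM e v) (add_nonneg (hbit _) (hq e).1)
          _ = _ := by
            simp only [mul_ite, mul_zero]
            rw [Finset.sum_ite_mem, Finset.univ_inter, Finset.sum_mul]
      gcongr
      have hx : 0 ≤ (∑ e ∈ star v, (bit (g e) + q e)) / regDegree lamW lamF A₀ v :=
        div_nonneg (Finset.sum_nonneg fun e _ => add_nonneg (hbit _) (hq e).1) (hpos v).le
      set x := (∑ e ∈ star v, (bit (g e) + q e)) / regDegree lamW lamF A₀ v with hx_def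
      calc _ ≤ ((5 * t) ^ 2)⁻¹ * ((2 * k + 1) * (M * x)) := by
            gcongr
            refine hw2.trans (le_of_eq ?_)
            rw [hx_def]
            ring
        _ = ((5 * t) ^ 2)⁻¹ * ((2 * k + 1) * M * x) := by ring
        _ ≤ ((5 * t) ^ 2)⁻¹ * (t ^ 2 * x) := by gcongr
        _ = x / 25 := by field_simp; ring
    _ ≤ ∑ v : Fin n ⊕ Fin p, Real.exp (-((k + 1 : ℕ) : ℝ)) := by
      refine Finset.sum_le_sum fun v _ => expect_degree_pow_le hq (star v) (hpos v)
        (sum_star_lt_regDegree hW hF v).le (k + 1) ?_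
      have h1 := hM v
      rw [inv_le_iff_one_le_mul₀ (hpos v)] at h1
      -- The moment bound needs `k + 1 ≤ D_v`. It follows from `(k + 1) M ≤ t² ≤ 1` and `1 ≤ M D_v`.
      have h2 : ((k : ℝ) + 1) * M ≤ 1 := by nlinarith
      push_cast
      by_contra! hcon
      nlinarith
    _ = ((n : ℝ) + p) * Real.exp (-((k + 1 : ℕ) : ℝ)) := by
      rw [Finset.sum_const, Finset.card_univ, Fintype.card_sum, Fintype.card_fin,
        Fintype.card_fin, nsmul_eq_mul]
      push_cast
      ring
    _ ≤ _ := by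
      gcongr
      push_cast
      exact hkL

/-- With high probability, the adjacency matrix is close to its mean. -/
theorem prob_not_isClose_le (hA : ∀ i j, 0 ≤ A₀ i j ∧ A₀ i j ≤ 1) (hW : 0 < lamW)
    (hF : 0 < lamF) {M L t : ℝ} (hM : ∀ v, (regDegree lamW lamF A₀ v)⁻¹ ≤ M) (hM0 : 0 < M)
    (hL : 2 ≤ L) (ht0 : 0 ≤ t) (ht1 : t ≤ 1) (ht : t ^ 2 = 3 * M * L) {hi lo' : ℝ} (hhi : 0 ≤ hi)
    (hlo' : 0 ≤ lo') (hrow : ∀ i, ∑ j, A₀ i j ≤ hi) (hcol : ∀ j, lo' ≤ ∑ i, A₀ i j) :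
    prob (fun e => A₀ e.1 e.2) {g | ¬ IsClose lamW lamF hi lo' t (adj g) A₀}
      ≤ 3 * (((n : ℝ) + p) * Real.exp (-L)) := by
  have hA' : ∀ i j, 0 ≤ A₀ i j := fun i j => (hA i j).1
  set q : Fin n × Fin p → ℝ := fun e => A₀ e.1 e.2 with hq_def
  have hq : ∀ e, 0 ≤ q e ∧ q e ≤ 1 := fun e => hA e.1 e.2
  have hpos := regDegree_pos (A₀ := A₀) hA' hW hF
  set D := regDegree lamW lamF A₀ with hD
  set B₁ : Fin n ⊕ Fin p → Set (Fin n × Fin p → Bool) := fun v =>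
    {g | (∑ e ∈ star v, q e) + 2 * t * D v < ∑ e ∈ star v, bit (g e)} with hB₁
  set B₂ : Fin n ⊕ Fin p → Set (Fin n × Fin p → Bool) := fun v =>
    {g | ∑ e ∈ star v, bit (g e) < (∑ e ∈ star v, q e) - 5 / 6 * t * D v} with hB₂
  set B₃ : Set (Fin n × Fin p → Bool) :=
    {g | 5 * t < ‖normalized lamW lamF A₀ (adj g - A₀)‖} with hB₃
  have hMD : ∀ v, 1 ≤ M * D v := fun v => (inv_le_iff_one_le_mul₀ (hpos v)).mp (hM v)
  have hLD : ∀ v, 3 * L ≤ t ^ 2 * D v := fun v => by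
    rw [ht]
    nlinarith [hMD v]
  have h1 : ∀ v, prob q (B₁ v) ≤ Real.exp (-L) := fun v =>
    (prob_upper_tail hq (star v) ht0 ht1 (sum_star_lt_regDegree hW hF v).le).trans
      (Real.exp_le_exp.mpr (by linarith [hLD v]))
  have h2 : ∀ v, prob q (B₂ v) ≤ Real.exp (-L) := fun v =>
    (prob_lower_tail hq (star v) (by positivity) (sum_star_lt_regDegree hW hF v).le).trans
      (Real.exp_le_exp.mpr (by
        have e : (5 / 6 * t) ^ 2 * regDegree lamW lamF A₀ v / 2 = 25 / 72 * (t ^ 2 * D v) := by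
          rw [← hD]; ring
        rw [e]
        linarith [hLD v]))
  have h3 : prob q B₃ ≤ ((n : ℝ) + p) * Real.exp (-L) :=
    prob_norm_normalized_le hA hW hF hM hM0 hL ht0 ht1 ht
  have hcard : ∑ v : Fin n ⊕ Fin p, Real.exp (-L) = ((n : ℝ) + p) * Real.exp (-L) := by
    rw [Finset.sum_const, Finset.card_univ, Fintype.card_sum, Fintype.card_fin,
      Fintype.card_fin, nsmul_eq_mul]
    push_cast
    ring
  have hsub : {g | ¬ IsClose lamW lamF hi lo' t (adj g) A₀}
      ⊆ ((⋃ v, B₁ v) ∪ ⋃ v, B₂ v) ∪ B₃ := by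
    intro g hg
    by_contra hcon
    simp only [Set.mem_union, Set.mem_iUnion, not_or, not_exists, hB₁, hB₂, hB₃,
      Set.mem_ofPred_eq, not_lt] at hcon
    obtain ⟨⟨c1, c2⟩, c3⟩ := hcon
    refine hg ⟨fun i j => ?_, hA', hW, hF, hhi, hlo', hrow, hcol, ht0, ht1, fun i => ?_,
      fun i => ?_, fun j => ?_, fun j => ?_, c3⟩
    · simp only [adj, of_apply, bit]
      split_ifs <;> norm_num
    · have h := c1 (Sum.inl i)
      rwa [sum_star_inl, sum_star_inl] at h
    · have h := c2 (Sum.inl i)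
      rwa [sum_star_inl, sum_star_inl] at h
    · have h := c1 (Sum.inr j)
      rwa [sum_star_inr, sum_star_inr] at h
    · have h := c2 (Sum.inr j)
      rwa [sum_star_inr, sum_star_inr] at h
  calc _ ≤ _ := prob_mono hq hsub
    _ ≤ prob q ((⋃ v, B₁ v) ∪ ⋃ v, B₂ v) + prob q B₃ := prob_union_le hq _ _
    _ ≤ (prob q (⋃ v, B₁ v) + prob q (⋃ v, B₂ v)) + prob q B₃ := by
      gcongr
      exact prob_union_le hq _ _
    _ ≤ (∑ v, prob q (B₁ v) + ∑ v, prob q (B₂ v)) + prob q B₃ := by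
      gcongr <;> exact prob_iUnion_le hq _
    _ ≤ (∑ v : Fin n ⊕ Fin p, Real.exp (-L) + ∑ v : Fin n ⊕ Fin p, Real.exp (-L))
        + ((n : ℝ) + p) * Real.exp (-L) := by
      gcongr with v _ v _
      · exact h1 v
      · exact h2 v
    _ = _ := by rw [hcard]; ring

end Adjacency

end RidgeFE

end

noncomputable section

namespace RidgeFE

/-! ### The penalized normal equations -/

section NormalEquations

variable {n p : ℕ}

/-- The matrix of the penalized normal equations. -/
def ridgeMatrix (lamW lamF : ℝ) (A : Matrix (Fin n) (Fin p) ℝ) :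
    Matrix (Fin n ⊕ Fin p) (Fin n ⊕ Fin p) ℝ :=
  Matrix.fromBlocks (rowDegree lamW A) A Aᵀ (colDegree lamF A)

variable {A : Matrix (Fin n) (Fin p) ℝ} {lamW lamF : ℝ}

theorem isUnit_det_colDegree (hA : ∀ i j, 0 ≤ A i j) (hF : 0 < lamF) :
    IsUnit (colDegree lamF A).det := by
  rw [colDegree, det_diagonal, isUnit_iff_ne_zero]
  exact Finset.prod_ne_zero_iff.mpr fun j _ =>
    (add_pos_of_nonneg_of_pos (Finset.sum_nonneg fun i _ => hA i j) hF).ne'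

/-- Block inversion: the Laplacian is the Schur complement of the firm degree block. -/
theorem ridgeMatrix_mul_eq_one (hA : ∀ i j, 0 ≤ A i j) (hW : 0 < lamW) (hF : 0 < lamF) :
    ridgeMatrix lamW lamF A * Matrix.fromBlocks (wLaplacian lamW lamF A)⁻¹
      (-((wLaplacian lamW lamF A)⁻¹ * A * (colDegree lamF A)⁻¹))
      (-((colDegree lamF A)⁻¹ * Aᵀ * (wLaplacian lamW lamF A)⁻¹))
      ((colDegree lamF A)⁻¹ + (colDegree lamF A)⁻¹ * Aᵀ * (wLaplacian lamW lamF A)⁻¹ * A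
        * (colDegree lamF A)⁻¹) = 1 := by
  have hL : wLaplacian lamW lamF A * (wLaplacian lamW lamF A)⁻¹ = 1 :=
    Matrix.mul_nonsing_inv _ (isUnit_det_wLaplacian hA hW hF)
  have hE : colDegree lamF A * (colDegree lamF A)⁻¹ = 1 :=
    Matrix.mul_nonsing_inv _ (isUnit_det_colDegree hA hF)
  have hD : rowDegree lamW A = wLaplacian lamW lamF A + A * (colDegree lamF A)⁻¹ * Aᵀ := by
    rw [wLaplacian]; abel
  rw [ridgeMatrix, fromBlocks_multiply, hD, ← fromBlocks_one]
  set L := wLaplacian lamW lamF A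
  set E := colDegree lamF A
  congr 1
  · rw [Matrix.add_mul, hL]
    simp only [Matrix.mul_neg, Matrix.mul_assoc]
    abel
  · simp only [Matrix.mul_neg, Matrix.add_mul, Matrix.mul_add, ← Matrix.mul_assoc]
    rw [hL, Matrix.one_mul]
    abel
  · simp only [Matrix.mul_neg, ← Matrix.mul_assoc]
    rw [hE, Matrix.one_mul]
    abel
  · simp only [Matrix.mul_neg, Matrix.mul_add, ← Matrix.mul_assoc]
    rw [hE, Matrix.one_mul]
    abel

theorem isUnit_det_ridgeMatrix (hA : ∀ i j, 0 ≤ A i j) (hW : 0 < lamW) (hF : 0 < lamF) :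
    IsUnit (ridgeMatrix lamW lamF A).det :=
  Matrix.isUnit_det_of_right_inverse (ridgeMatrix_mul_eq_one hA hW hF)

theorem ridgeMatrix_transpose : (ridgeMatrix lamW lamF A)ᵀ = ridgeMatrix lamW lamF A := by
  rw [ridgeMatrix, fromBlocks_transpose, transpose_transpose, rowDegree, colDegree,
    diagonal_transpose, diagonal_transpose]

/-- The conditional variance of the estimation error, as a function of the adjacency matrix. -/
def jointVariance (lamW lamF σ σw σf : ℝ) (A : Matrix (Fin n) (Fin p) ℝ) :
    Matrix (Fin n ⊕ Fin p) (Fin n ⊕ Fin p) ℝ :=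
  σ ^ 2 • (ridgeMatrix lamW lamF A)⁻¹ + (ridgeMatrix lamW lamF A)⁻¹
    * diagonal (Sum.elim (fun _ => lamW ^ 2 * σw ^ 2 - lamW * σ ^ 2)
        fun _ => lamF ^ 2 * σf ^ 2 - lamF * σ ^ 2) * (ridgeMatrix lamW lamF A)⁻¹

theorem jointVariance_toBlocks₁₁ (hA : ∀ i j, 0 ≤ A i j) (hW : 0 < lamW) (hF : 0 < lamF)
    (σ σw σf : ℝ) :
    (jointVariance lamW lamF σ σw σf A).toBlocks₁₁ = wVarianceEquiv lamW lamF σ σw σf A := by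
  rw [jointVariance, Matrix.inv_eq_right_inv (ridgeMatrix_mul_eq_one hA hW hF),
    ← fromBlocks_diagonal, fromBlocks_multiply, fromBlocks_multiply, fromBlocks_smul,
    fromBlocks_add, toBlocks_fromBlocks₁₁, wVarianceEquiv]
  have h : ∀ (m : ℕ) (c : ℝ), (diagonal fun _ => c) = c • (1 : Matrix (Fin m) (Fin m) ℝ) :=
    fun m c => by rw [Matrix.smul_one_eq_diagonal]
  rw [h, h]
  simp only [Matrix.mul_zero, add_zero, zero_add, Matrix.mul_smul, Matrix.smul_mul, Matrix.mul_one,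
    Matrix.mul_add, Matrix.add_mul, Matrix.neg_mul, Matrix.mul_neg, neg_neg, Matrix.mul_assoc,
    smul_neg]

theorem jointVariance_toBlocks₂₂ (hA : ∀ i j, 0 ≤ A i j) (hW : 0 < lamW) (hF : 0 < lamF)
    (σ σw σf : ℝ) :
    (jointVariance lamW lamF σ σw σf A).toBlocks₂₂ = fVarianceEquiv lamW lamF σ σw σf A := by
  rw [fVarianceEquiv_eq, ← jointVariance_toBlocks₁₁ (A := Aᵀ) (fun i j => hA j i) hF hW]
  have h1 : ridgeMatrix lamF lamW Aᵀ
      = (ridgeMatrix lamW lamF A).submatrix (Equiv.sumComm _ _) (Equiv.sumComm _ _) := by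
    rw [ridgeMatrix, ridgeMatrix, rowDegree_transpose, colDegree_transpose, transpose_transpose]
    exact (fromBlocks_submatrix_sum_swap_sum_swap ..).symm
  have h2 : jointVariance lamF lamW σ σf σw Aᵀ
      = (jointVariance lamW lamF σ σw σf A).submatrix (Equiv.sumComm _ _) (Equiv.sumComm _ _) := by
    have h3 : (diagonal (Sum.elim (fun _ => lamF ^ 2 * σf ^ 2 - lamF * σ ^ 2)
        fun _ => lamW ^ 2 * σw ^ 2 - lamW * σ ^ 2) : Matrix (Fin p ⊕ Fin n) (Fin p ⊕ Fin n) ℝ)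
        = (diagonal (Sum.elim (fun _ => lamW ^ 2 * σw ^ 2 - lamW * σ ^ 2)
        fun _ => lamF ^ 2 * σf ^ 2 - lamF * σ ^ 2) :
          Matrix (Fin n ⊕ Fin p) (Fin n ⊕ Fin p) ℝ).submatrix
            (Equiv.sumComm _ _) (Equiv.sumComm _ _) := by
      rw [submatrix_diagonal_equiv]
      congr 1
      funext v
      cases v <;> rfl
    rw [jointVariance, jointVariance, h1, inv_submatrix_equiv, h3, submatrix_mul_equiv,
      submatrix_mul_equiv]
    rfl
  rw [h2]
  rfl

end NormalEquations

/-! ### The estimation error as a function of the network and the noise -/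

section Error

variable {n p : ℕ}

/-- The adjacency matrix of a network, in curried form. -/
def netAdj (g : Network n p) : Matrix (Fin n) (Fin p) ℝ := adj fun e => g e.1 e.2

theorem netAdj_apply (g : Network n p) (i : Fin n) (j : Fin p) :
    netAdj g i j = if g i j then 1 else 0 := rfl

theorem netAdj_nonneg (g : Network n p) (i : Fin n) (j : Fin p) : 0 ≤ netAdj g i j := by
  rw [netAdj_apply]
  split_ifs <;> norm_num

theorem sum_obs (g : Network n p) (f : Fin n × Fin p → ℝ) :
    ∑ e : Obs g, f e.1 = ∑ i, ∑ j, netAdj g i j * f (i, j) := by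
  rw [← Finset.sum_subtype (Finset.univ.filter fun e : Fin n × Fin p => g e.1 e.2 = true)
    (by simp) f, Finset.sum_filter, Fintype.sum_prod_type]
  simp [netAdj_apply]

theorem designW_transpose_mulVec (g : Network n p) (f : Fin n × Fin p → ℝ) (i : Fin n) :
    ((designW g)ᵀ *ᵥ fun e : Obs g => f e.1) i = ∑ j, netAdj g i j * f (i, j) := by
  have h := sum_obs g fun e => (if e.1 = i then 1 else 0) * f e
  simp only [mulVec, dotProduct, transpose_apply, designW, of_apply]
  rw [h, Finset.sum_eq_single i]
  · simp
  · intro b _ hb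
    simp [hb]
  · simp

theorem designF_transpose_mulVec (g : Network n p) (f : Fin n × Fin p → ℝ) (j : Fin p) :
    ((designF g)ᵀ *ᵥ fun e : Obs g => f e.1) j = ∑ i, netAdj g i j * f (i, j) := by
  have h := sum_obs g fun e => (if e.2 = j then 1 else 0) * f e
  simp only [mulVec, dotProduct, transpose_apply, designF, of_apply]
  rw [h]
  refine Finset.sum_congr rfl fun i _ => ?_
  rw [Finset.sum_eq_single j]
  · simp
  · intro b _ hb
    simp [hb]
  · simp

theorem normalMatrix_eq (lamW lamF : ℝ) (g : Network n p) :
    Matrix.fromBlocks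
      ((designW g)ᵀ * designW g + lamW • (1 : Matrix (Fin n) (Fin n) ℝ))
      ((designW g)ᵀ * designF g)
      ((designF g)ᵀ * designW g)
      ((designF g)ᵀ * designF g + lamF • (1 : Matrix (Fin p) (Fin p) ℝ))
      = ridgeMatrix lamW lamF (netAdj g) := by
  have hWF : (designW g)ᵀ * designF g = netAdj g := by
    ext i j
    have h := designW_transpose_mulVec g (fun e => if e.2 = j then 1 else 0) i
    refine (Eq.trans ?_ h).trans (by simp)
    rfl
  rw [ridgeMatrix]
  congr 1
  · ext i i'
    have h := designW_transpose_mulVec g (fun e => if e.1 = i' then 1 else 0) i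
    have h2 : ((designW g)ᵀ * designW g) i i' = ∑ j, netAdj g i j * if i = i' then 1 else 0 :=
      Eq.trans rfl h
    rw [Matrix.add_apply, h2, rowDegree, diagonal_apply, Matrix.smul_apply, one_apply]
    split_ifs <;> simp
  · rw [← hWF, transpose_mul, transpose_transpose]
  · ext j j'
    have h := designF_transpose_mulVec g (fun e => if e.2 = j' then 1 else 0) j
    have h2 : ((designF g)ᵀ * designF g) j j' = ∑ i, netAdj g i j * if j = j' then 1 else 0 :=
      Eq.trans rfl h
    rw [Matrix.add_apply, h2, colDegree, diagonal_apply, Matrix.smul_apply, one_apply]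
    split_ifs <;> simp

/-- The indices of the noise variables: workers, firms and pairs. -/
abbrev NoiseIndex (n p : ℕ) : Type := Fin n ⊕ (Fin p ⊕ Fin n × Fin p)

/-- The matrix which maps the noise variables to the right-hand side of the equations for the
estimation error. -/
def noiseMatrix (lamW lamF : ℝ) (A : Matrix (Fin n) (Fin p) ℝ) :
    Matrix (Fin n ⊕ Fin p) (NoiseIndex n p) ℝ :=
  Matrix.of fun a c => Sum.elim
    (fun i => Sum.elim (fun i' => if i = i' then -lamW else 0)
      (Sum.elim (fun _ => 0) fun e => if e.1 = i then A e.1 e.2 else 0) c)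
    (fun j => Sum.elim (fun _ => 0)
      (Sum.elim (fun j' => if j = j' then -lamF else 0)
        fun e => if e.2 = j then A e.1 e.2 else 0) c) a

/-- The variances of the noise variables. -/
def noiseVariance (σ σw σf : ℝ) (c : NoiseIndex n p) : ℝ :=
  Sum.elim (fun _ => σw ^ 2) (Sum.elim (fun _ => σf ^ 2) fun _ => σ ^ 2) c

/-- With `H` the ridge matrix and `Λ` the penalty, the right-hand side of the normal equations is
`(H - Λ) β` plus the aggregated errors, so the error is `H⁻¹` applied to those errors minus `Λ β`.
The part from the group means depends on the network alone and drops out of the conditional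
variance. -/
theorem ridge_sub_eq {lamW lamF : ℝ} (hW : 0 < lamW) (hF : 0 < lamF) (g : Network n p)
    (m : Fin n → ℝ) (f : Fin p → ℝ) (x : NoiseIndex n p → ℝ) :
    ridge lamW lamF g (outcome g (fun i => m i + x (Sum.inl i))
        (fun j => f j + x (Sum.inr (Sum.inl j))) fun e => x (Sum.inr (Sum.inr e)))
      - Sum.elim (fun i => m i + x (Sum.inl i)) (fun j => f j + x (Sum.inr (Sum.inl j)))
      = (ridgeMatrix lamW lamF (netAdj g))⁻¹ *ᵥ
          Sum.elim (fun i => -(lamW * m i)) (fun j => -(lamF * f j))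
        + ((ridgeMatrix lamW lamF (netAdj g))⁻¹ * noiseMatrix lamW lamF (netAdj g)) *ᵥ x := by
  have hu := isUnit_det_ridgeMatrix (netAdj_nonneg g) hW hF
  set β : Fin n ⊕ Fin p → ℝ :=
    Sum.elim (fun i => m i + x (Sum.inl i)) (fun j => f j + x (Sum.inr (Sum.inl j))) with hβ
  set y : Fin n × Fin p → ℝ := fun e => (m e.1 + x (Sum.inl e.1))
    + (f e.2 + x (Sum.inr (Sum.inl e.2))) + x (Sum.inr (Sum.inr e)) with hy
  have hout : outcome g (fun i => m i + x (Sum.inl i))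
        (fun j => f j + x (Sum.inr (Sum.inl j))) (fun e => x (Sum.inr (Sum.inr e)))
 = fun e : Obs g => y e.1 := by
    funext e
    simp [hy, outcome, designW, designF, mulVec, dotProduct]
  rw [ridge, normalMatrix_eq, hout]
  have hβ' : β = (ridgeMatrix lamW lamF (netAdj g))⁻¹ *ᵥ
      (ridgeMatrix lamW lamF (netAdj g) *ᵥ β) := by
    rw [mulVec_mulVec, Matrix.nonsing_inv_mul _ hu, one_mulVec]
  rw [hβ', ← mulVec_sub, ← mulVec_mulVec, ← mulVec_add]
  congr 1
  have hb : ridgeMatrix lamW lamF (netAdj g) *ᵥ β = Sum.elim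
      (fun i => (∑ j, netAdj g i j + lamW) * (m i + x (Sum.inl i))
        + ∑ j, netAdj g i j * (f j + x (Sum.inr (Sum.inl j))))
      (fun j => ∑ i, netAdj g i j * (m i + x (Sum.inl i))
        + (∑ i, netAdj g i j + lamF) * (f j + x (Sum.inr (Sum.inl j)))) := by
    rw [ridgeMatrix, fromBlocks_mulVec, rowDegree, colDegree]
    funext v
    rcases v with i | j
    · simp only [Sum.elim_inl, Pi.add_apply, mulVec_diagonal, hβ, Function.comp_apply]
      rfl
    · simp only [Sum.elim_inr, Pi.add_apply, mulVec_diagonal, hβ, Function.comp_apply]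
      rfl
  rw [hb]
  funext v
  rcases v with i | j
  · rw [Pi.sub_apply, Sum.elim_inl, designW_transpose_mulVec]
    simp only [hy, Sum.elim_inl, Pi.add_apply, mulVec, dotProduct, noiseMatrix, of_apply, Fintype.sum_sum_type, Sum.elim_inr, Fintype.sum_prod_type,
      mul_add, add_mul, Finset.sum_add_distrib, Finset.sum_mul, ite_mul, zero_mul,
      Finset.sum_ite_eq, Finset.mem_univ, if_true, Finset.sum_const_zero]
    rw [Finset.sum_eq_single (f := fun i' => ∑ j, if i' = i then
      netAdj g i' j * x (Sum.inr (Sum.inr (i', j))) else 0) i (by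
        intro b _ hb; simp [hb]) (by simp)]
    simp only [if_true]
    ring
  · rw [Pi.sub_apply, Sum.elim_inr, designF_transpose_mulVec]
    simp only [hy, Sum.elim_inl, Pi.add_apply, mulVec, dotProduct, noiseMatrix, of_apply, Fintype.sum_sum_type, Sum.elim_inr, Fintype.sum_prod_type,
      mul_add, add_mul, Finset.sum_add_distrib, Finset.sum_mul, ite_mul, zero_mul,
      Finset.sum_ite_eq, Finset.sum_ite_eq', Finset.mem_univ, if_true, Finset.sum_const_zero]
    ring

/-- Adjacency entries equal their squares, so the regression errors contribute `σ² (H - Λ)`. Adding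
`λ² s²` from the random effects yields the coefficients `λ² s² - λ σ²`. -/
theorem noiseMatrix_mul_diagonal_mul (lamW lamF σ σw σf : ℝ) (g : Network n p) :
    noiseMatrix lamW lamF (netAdj g) * (diagonal (noiseVariance σ σw σf) : Matrix (NoiseIndex n p) (NoiseIndex n p) ℝ)
        * (noiseMatrix lamW lamF (netAdj g))ᵀ
      = σ ^ 2 • ridgeMatrix lamW lamF (netAdj g)
        + diagonal (Sum.elim (fun _ => lamW ^ 2 * σw ^ 2 - lamW * σ ^ 2)
          fun _ => lamF ^ 2 * σf ^ 2 - lamF * σ ^ 2) := by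
  have hsq : ∀ i j, netAdj g i j * netAdj g i j = netAdj g i j := fun i j => by
    rw [netAdj_apply]; split_ifs <;> norm_num
  ext v w
  rw [mul_apply]
  simp only [mul_diagonal, transpose_apply, Fintype.sum_sum_type, Fintype.sum_prod_type]
  rcases v with i | j <;> rcases w with i' | j' <;>
    simp only [noiseMatrix, noiseVariance, of_apply, Sum.elim_inl, Sum.elim_inr, ridgeMatrix,
      Matrix.add_apply, Matrix.smul_apply, fromBlocks_apply₁₁, fromBlocks_apply₁₂,
      fromBlocks_apply₂₁, fromBlocks_apply₂₂, rowDegree, colDegree, diagonal_apply, transpose_apply,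
      Sum.inl.injEq, Sum.inr.injEq, ite_mul, zero_mul, mul_ite, mul_zero, Finset.sum_const_zero,
      zero_add, add_zero, Finset.sum_ite_eq, Finset.sum_ite_eq', Finset.mem_univ, if_true,
      reduceCtorEq, if_false, mul_right_comm _ (σ ^ 2), hsq, smul_eq_mul, Finset.sum_ite_irrel]
  · by_cases h : i = i'
    · subst h
      simp only [if_true, ← Finset.sum_mul]
      ring
    · simp [h, Ne.symm h]
  · ring
  · ring
  · by_cases h : j = j'
    · subst h
      simp only [if_true, ← Finset.sum_mul]
      ring
    · simp [h, Ne.symm h]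

theorem noise_covariance_eq {lamW lamF : ℝ} (hW : 0 < lamW) (hF : 0 < lamF) (σ σw σf : ℝ)
    (g : Network n p) :
    ((ridgeMatrix lamW lamF (netAdj g))⁻¹ * noiseMatrix lamW lamF (netAdj g))
        * (diagonal (noiseVariance σ σw σf) : Matrix (NoiseIndex n p) (NoiseIndex n p) ℝ)
        * ((ridgeMatrix lamW lamF (netAdj g))⁻¹ * noiseMatrix lamW lamF (netAdj g))ᵀ
      = jointVariance lamW lamF σ σw σf (netAdj g) := by
  have hu := isUnit_det_ridgeMatrix (netAdj_nonneg g) hW hF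
  rw [transpose_mul, transpose_nonsing_inv, ridgeMatrix_transpose, jointVariance]
  calc _ = (ridgeMatrix lamW lamF (netAdj g))⁻¹ * (noiseMatrix lamW lamF (netAdj g)
        * (diagonal (noiseVariance σ σw σf) : Matrix (NoiseIndex n p) (NoiseIndex n p) ℝ) * (noiseMatrix lamW lamF (netAdj g))ᵀ)
        * (ridgeMatrix lamW lamF (netAdj g))⁻¹ := by simp only [Matrix.mul_assoc]
    _ = _ := by
      rw [noiseMatrix_mul_diagonal_mul, Matrix.mul_add, Matrix.add_mul, Matrix.mul_smul,
        Matrix.nonsing_inv_mul _ hu, Matrix.smul_mul, Matrix.one_mul]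

end Error

end RidgeFE

end

noncomputable section

namespace RidgeFE

/-! ### Conditional covariances of linear functions of the noise -/

section CondExp

variable {Ω S κ ι : Type*} [MeasurableSpace Ω] {P : Measure Ω}
  [MeasurableSpace S] [Fintype S] [DiscreteMeasurableSpace S] {net : Ω → S}

/-- As `S` is finite, every function of `net` is bounded and measurable. -/
theorem integrable_comp_mul (hnet : Measurable net) (f : S → ℝ) {η : Ω → ℝ}
    (hη : Integrable η P) : Integrable (fun ω => f (net ω) * η ω) P := by
  refine hη.bdd_mul (c := ∑ s, ‖f s‖) ?_ (Filter.Eventually.of_forall fun ω => ?_)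
  · exact ((measurable_of_countable f).comp hnet).aestronglyMeasurable
  · exact Finset.single_le_sum (f := fun s => ‖f s‖) (fun _ _ => norm_nonneg _)
      (Finset.mem_univ (net ω))

variable [IsProbabilityMeasure P]

/-- Conditional expectation given `net` of a product of a function of `net` and a variable that is
independent of `net`. -/
theorem condExp_comp_mul_of_indep {T : Type*} [MeasurableSpace T] {X : Ω → T}
    (hnet : Measurable net) (hX : Measurable X) (hind : IndepFun net X P) (f : S → ℝ) {η : T → ℝ}
    (hηm : Measurable η) (hη : Integrable (fun ω => η (X ω)) P) :
    P[fun ω => f (net ω) * η (X ω) | MeasurableSpace.comap net inferInstance]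
      =ᵐ[P] fun ω => f (net ω) * ∫ ω, η (X ω) ∂P := by
  have hf : StronglyMeasurable[MeasurableSpace.comap net inferInstance] fun ω => f (net ω) :=
    ((measurable_of_countable f).comp (comap_measurable net)).stronglyMeasurable
  have h1 := condExp_mul_of_stronglyMeasurable_left hf (integrable_comp_mul hnet f hη) hη
  have h2 := condExp_indep_eq hX.comap_le hnet.comap_le
    (hηm.comp (comap_measurable X)).stronglyMeasurable ((IndepFun_iff_Indep _ _ _).mp hind).symm
  refine h1.trans ?_
  filter_upwards [h2] with ω hω
  exact congrArg (f (net ω) * ·) hω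

variable [Fintype κ] [DecidableEq κ] {ξ : κ → Ω → ℝ}

/-- Conditional covariance given `net` of affine functions, with coefficients that depend on `net`,
of uncorrelated centered variables that are independent of `net`. -/
theorem condVarMatrix_affine (hnet : Measurable net) (hξ : ∀ c, Measurable (ξ c))
    (hξ2 : ∀ c, MemLp (ξ c) 2 P) (hmean : ∀ c, ∫ ω, ξ c ω ∂P = 0) {s : κ → ℝ}
    (hcov : ∀ c d, ∫ ω, ξ c ω * ξ d ω ∂P = if c = d then s c else 0)
    (hind : IndepFun net (fun ω c => ξ c ω) P) {Z : ι → Ω → ℝ} {h : S → ι → ℝ}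
    {C : S → Matrix ι κ ℝ} (hZ : ∀ a ω, Z a ω = h (net ω) a + (C (net ω) *ᵥ fun c => ξ c ω) a)
    (a b : ι) :
    ∀ᵐ ω ∂P, condVarMatrix P (MeasurableSpace.comap net inferInstance) Z ω a b
      = (C (net ω) * diagonal s * (C (net ω))ᵀ) a b := by
  have hpi : Measurable fun ω c => ξ c ω := measurable_pi_lambda _ hξ
  have hξi : ∀ c, Integrable (ξ c) P := fun c => (hξ2 c).integrable (by norm_num)
  have hξξi : ∀ c d, Integrable (fun ω => ξ c ω * ξ d ω) P := fun c d =>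
    (hξ2 c).integrable_mul (hξ2 d)
  have hmean' : ∀ a, P[Z a | MeasurableSpace.comap net inferInstance] =ᵐ[P] fun ω => h (net ω) a := by
    intro a
    have hZa : Z a = fun ω => h (net ω) a * 1 + ∑ c, C (net ω) a c * ξ c ω := by
      funext ω
      rw [hZ, mul_one]
      rfl
    have hi : ∀ c, Integrable (fun ω => C (net ω) a c * ξ c ω) P := fun c =>
      integrable_comp_mul hnet (fun g => C g a c) (hξi c)
    have hi0 : Integrable (fun ω => h (net ω) a * 1) P :=
      integrable_comp_mul hnet (fun g => h g a) (integrable_const 1)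
    have e1 : Z a = (fun ω => h (net ω) a * 1) + ∑ c, fun ω => C (net ω) a c * ξ c ω := by
      rw [hZa]
      funext ω
      simp
    have h1 : P[Z a | MeasurableSpace.comap net inferInstance] =ᵐ[P] P[fun ω => h (net ω) a * 1 | MeasurableSpace.comap net inferInstance]
        + P[∑ c, fun ω => C (net ω) a c * ξ c ω | MeasurableSpace.comap net inferInstance] := by
      rw [e1]
      exact condExp_add hi0 (integrable_finsetSum' _ fun c _ => hi c)
        (MeasurableSpace.comap net inferInstance)
    have h2 := condExp_finsetSum (s := Finset.univ) (fun c _ => hi c)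
      (MeasurableSpace.comap net inferInstance)
    have h3 : ∀ c, P[fun ω => C (net ω) a c * ξ c ω | MeasurableSpace.comap net inferInstance] =ᵐ[P] fun _ => 0 := fun c => by
      have := condExp_comp_mul_of_indep hnet hpi hind (fun g => C g a c)
        (measurable_pi_apply c) (hξi c)
      simpa only [hmean, mul_zero] using this
    have h4 : P[fun ω => h (net ω) a * 1 | MeasurableSpace.comap net inferInstance] = fun ω => h (net ω) a * 1 :=
      condExp_of_stronglyMeasurable hnet.comap_le
        (((measurable_of_countable fun g => h g a * 1).comp
          (comap_measurable net)).stronglyMeasurable) hi0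
    filter_upwards [h1, h2, ae_all_iff.mpr h3] with ω w1 w2 w3
    rw [w1, Pi.add_apply, w2, h4, Finset.sum_apply, Finset.sum_eq_zero fun c _ => w3 c]
    simp
  -- The conditional mean is `h (net ω)`, so the product of the centered entries is a double sum of
  -- products of noise variables, of which only the diagonal terms survive conditioning.
  have hprod : (fun ω => (Z a ω - (P[Z a | MeasurableSpace.comap net inferInstance]) ω) * (Z b ω - (P[Z b | MeasurableSpace.comap net inferInstance]) ω))
      =ᵐ[P] ∑ x : κ × κ, fun ω => (C (net ω) a x.1 * C (net ω) b x.2) * (ξ x.1 ω * ξ x.2 ω) := by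
    filter_upwards [hmean' a, hmean' b] with ω w1 w2
    rw [w1, w2, hZ, hZ, add_sub_cancel_left, add_sub_cancel_left, Finset.sum_apply,
      Fintype.sum_prod_type, mulVec, mulVec, dotProduct, dotProduct, Finset.sum_mul_sum]
    exact Finset.sum_congr rfl fun c _ => Finset.sum_congr rfl fun d _ => by ring
  have hi : ∀ x : κ × κ, Integrable
      (fun ω => (C (net ω) a x.1 * C (net ω) b x.2) * (ξ x.1 ω * ξ x.2 ω)) P := fun x =>
    integrable_comp_mul hnet (fun g => C g a x.1 * C g b x.2) (hξξi x.1 x.2)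
  have h1 := condExp_congr_ae (m := MeasurableSpace.comap net inferInstance) hprod
  have h2 := condExp_finsetSum (s := Finset.univ) (fun x _ => hi x)
    (MeasurableSpace.comap net inferInstance)
  have h3 : ∀ x : κ × κ,
      P[fun ω => (C (net ω) a x.1 * C (net ω) b x.2) * (ξ x.1 ω * ξ x.2 ω) | MeasurableSpace.comap net inferInstance]
        =ᵐ[P] fun ω => (C (net ω) a x.1 * C (net ω) b x.2) * if x.1 = x.2 then s x.1 else 0 :=
    fun x => by
      have := condExp_comp_mul_of_indep hnet hpi hind (fun g => C g a x.1 * C g b x.2)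
        (η := fun y => y x.1 * y x.2)
        ((measurable_pi_apply x.1).mul (measurable_pi_apply x.2)) (hξξi x.1 x.2)
      simpa only [hcov] using this
  filter_upwards [h1, h2, ae_all_iff.mpr h3] with ω w1 w2 w3
  rw [condVarMatrix, of_apply, w1, w2, Finset.sum_apply, Finset.sum_congr rfl fun x _ => w3 x,
    Fintype.sum_prod_type, mul_apply]
  refine Finset.sum_congr rfl fun c _ => ?_
  rw [mul_diagonal, transpose_apply]
  simp
  ring

end CondExp

/-! ### Conditional variance of the ridge error and law of the network. -/

section Model

variable {n p K : ℕ} {Ω : Type*} [MeasurableSpace Ω] {S : BlockModel n p K} {P : Measure Ω}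
  [IsProbabilityMeasure P] {net : Ω → Network n p} {Uw : Fin n → Ω → ℝ} {Uf : Fin p → Ω → ℝ}
  {U : Fin n × Fin p → Ω → ℝ} {σ σw σf : ℝ}

/-- The conditional variance of the estimation error given the network. -/
theorem condVarMatrix_ridgeError (hmodel : IsRandomModel S P net Uw Uf U σ σw σf)
    (muStar phiStar : Fin K → ℝ) {lamW lamF : ℝ} (hW : 0 < lamW) (hF : 0 < lamF)
    {ι : Type*} (v : ι → Fin n ⊕ Fin p) (a b : ι) :
    ∀ᵐ ω ∂P, condVarMatrix P (MeasurableSpace.comap net inferInstance)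
        (fun i => ridgeError S muStar phiStar lamW lamF net Uw Uf U (v i)) ω a b
      = jointVariance lamW lamF σ σw σf (netAdj (net ω)) (v a) (v b) := by
  set ξ : NoiseIndex n p → Ω → ℝ := Sum.elim Uw (Sum.elim Uf U) with hξdef
  have hξ : ∀ c, Measurable (ξ c) := by
    rintro (i | j | e)
    exacts [hmodel.Uw_measurable i, hmodel.Uf_measurable j, hmodel.U_measurable e]
  have hξ2 : ∀ c, MemLp (ξ c) 2 P := by
    rintro (i | j | e)
    exacts [hmodel.Uw_memLp i, hmodel.Uf_memLp j, hmodel.U_memLp e]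
  have hmean : ∀ c, ∫ ω, ξ c ω ∂P = 0 := by
    rintro (i | j | e)
    exacts [hmodel.Uw_mean i, hmodel.Uf_mean j, hmodel.U_mean e]
  have hvar : ∀ c, variance (ξ c) P = noiseVariance σ σw σf c := by
    rintro (i | j | e)
    exacts [hmodel.Uw_var i, hmodel.Uf_var j, hmodel.U_var e]
  have hcov : ∀ c d, ∫ ω, ξ c ω * ξ d ω ∂P = if c = d then noiseVariance σ σw σf c else 0 := by
    intro c d
    by_cases hcd : c = d
    · subst hcd
      rw [if_pos rfl, ← hvar, variance_of_integral_eq_zero (hξ c).aemeasurable (hmean c)]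
      simp only [sq]
    · rw [if_neg hcd]
      have h := (hmodel.noise_indep.indepFun hcd).integral_mul_eq_mul_integral
        (hξ c).aestronglyMeasurable (hξ d).aestronglyMeasurable
      have h0 := hmean c
      rw [hξdef] at h0
      rw [h0, zero_mul] at h
      exact h
  have key := condVarMatrix_affine (P := P) hmodel.net_measurable hξ hξ2 hmean hcov
    hmodel.net_indep_noise
    (Z := fun i => ridgeError S muStar phiStar lamW lamF net Uw Uf U (v i))
    (h := fun g i => ((ridgeMatrix lamW lamF (netAdj g))⁻¹ *ᵥ
          Sum.elim (fun i => -(lamW * muStar (S.wType i)))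
            (fun j => -(lamF * phiStar (S.fType j)))) (v i))
    (C := fun g => ((ridgeMatrix lamW lamF (netAdj g))⁻¹
      * noiseMatrix lamW lamF (netAdj g)).submatrix v id)
    (fun i ω => congrFun (ridge_sub_eq hW hF (net ω) (fun i => muStar (S.wType i))
      (fun j => phiStar (S.fType j)) fun c => ξ c ω) (v i)) a b
  filter_upwards [key] with ω hω
  rw [hω, ← noise_covariance_eq hW hF]
  rfl

theorem wVariance_ae_eq (hmodel : IsRandomModel S P net Uw Uf U σ σw σf)
    (muStar phiStar : Fin K → ℝ) {lamW lamF : ℝ} (hW : 0 < lamW) (hF : 0 < lamF) :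
    ∀ᵐ ω ∂P, wVariance S P muStar phiStar lamW lamF net Uw Uf U ω
      = wVarianceEquiv lamW lamF σ σw σf (netAdj (net ω)) := by
  have h := ae_all_iff.mpr fun a => ae_all_iff.mpr fun b =>
    condVarMatrix_ridgeError hmodel muStar phiStar hW hF Sum.inl a b
  filter_upwards [h] with ω hω
  rw [← jointVariance_toBlocks₁₁ (netAdj_nonneg (net ω)) hW hF]
  ext a b
  exact hω a b

theorem fVariance_ae_eq (hmodel : IsRandomModel S P net Uw Uf U σ σw σf)
    (muStar phiStar : Fin K → ℝ) {lamW lamF : ℝ} (hW : 0 < lamW) (hF : 0 < lamF) :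
    ∀ᵐ ω ∂P, fVariance S P muStar phiStar lamW lamF net Uw Uf U ω
      = fVarianceEquiv lamW lamF σ σw σf (netAdj (net ω)) := by
  have h := ae_all_iff.mpr fun a => ae_all_iff.mpr fun b =>
    condVarMatrix_ridgeError hmodel muStar phiStar hW hF Sum.inr a b
  filter_upwards [h] with ω hω
  rw [← jointVariance_toBlocks₂₂ (netAdj_nonneg (net ω)) hW hF]
  ext a b
  exact hω a b

/-! ### The law of the network -/

theorem meanAdj_nonneg (S : BlockModel n p K) (i : Fin n) (j : Fin p) : 0 ≤ S.meanAdj i j :=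
  div_nonneg (mul_nonneg (S.θ_nonneg j) (S.C_nonneg _ _)) (Nat.cast_nonneg _)

theorem meanAdj_le_one (S : BlockModel n p K) (i : Fin n) (j : Fin p) : S.meanAdj i j ≤ 1 :=
  S.prob_le_one i j

/-- Carries the finite Bernoulli computations over to `P`: independence determines the law of the
network on single configurations, and an event is a finite union of these. -/
theorem measureReal_net_eq (hmodel : IsRandomModel S P net Uw Uf U σ σw σf)
    (B : Set (Fin n × Fin p → Bool)) :
    P.real {ω | (fun e : Fin n × Fin p => net ω e.1 e.2) ∈ B}
      = prob (fun e => S.meanAdj e.1 e.2) B := by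
  classical
  set net' : Ω → Fin n × Fin p → Bool := fun ω e => net ω e.1 e.2 with hnet'
  have hmeas : ∀ e : Fin n × Fin p, Measurable fun ω => net ω e.1 e.2 := fun e =>
    (measurable_pi_apply e.2).comp ((measurable_pi_apply e.1).comp hmodel.net_measurable)
  have hmeas' : Measurable net' := measurable_pi_lambda _ hmeas
  have hone : ∀ (e : Fin n × Fin p) (b : Bool), P.real {ω | net ω e.1 e.2 = b}
      = bernoulliMass (S.meanAdj e.1 e.2) b := by
    intro e b
    have ht : P.real {ω | net ω e.1 e.2 = true} = S.meanAdj e.1 e.2 := by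
      rw [measureReal_def, hmodel.net_law, ENNReal.toReal_ofReal (meanAdj_nonneg S _ _)]
    cases b with
    | true => rw [ht]; rfl
    | false =>
      have hc : {ω | net ω e.1 e.2 = false} = {ω | net ω e.1 e.2 = true}ᶜ := by
        ext ω; simp
      have hm : MeasurableSet {ω | net ω e.1 e.2 = true} := hmeas e (measurableSet_singleton true)
      rw [hc, probReal_compl_eq_one_sub hm, ht]
      rfl
  have hsingle : ∀ g : Fin n × Fin p → Bool,
      P.real (net' ⁻¹' {g}) = productMass (fun e => S.meanAdj e.1 e.2) g := by
    intro g
    have h1 : net' ⁻¹' {g}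
        = ⋂ e ∈ Finset.univ, (fun ω => net ω e.1 e.2) ⁻¹' {g e} := by
      ext ω
      simp [hnet', funext_iff]
    rw [h1, measureReal_def, hmodel.net_indep.measure_inter_preimage_eq_mul Finset.univ
      (fun e _ => measurableSet_singleton (g e)), ENNReal.toReal_prod]
    exact Finset.prod_congr rfl fun e _ => hone e (g e)
  have h2 := sum_measureReal_preimage_singleton (μ := P) (B.toFinite.toFinset) (f := net')
    fun g _ => hmeas' (measurableSet_singleton g)
  rw [Set.Finite.coe_toFinset] at h2
  change P.real (net' ⁻¹' B) = _
  rw [← h2, prob, expect]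
  simp only [hsingle, Set.indicator_apply, Pi.one_apply, mul_ite, mul_one, mul_zero]
  rw [← Finset.sum_filter]
  exact Finset.sum_congr (by ext g; simp) fun _ _ => rfl

end Model

end RidgeFE

end

noncomputable section

namespace RidgeFE

/-! ### Expected degrees in the block model -/

section Degrees

variable {n p K : ℕ} (S : BlockModel n p K)

/-- Grouping firms by type, the weights `θ` of each group sum to 1. -/
theorem sum_meanAdj_row (i : Fin n) : ∑ j, S.meanAdj i j = S.wDeg (S.wType i) := by
  have h : ∀ j, S.meanAdj i j
      = ∑ l, if S.fType j = l then S.θ j * (S.C (S.wType i) l / S.groupSize (S.wType i)) else 0 :=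
    fun j => by simp [BlockModel.meanAdj, mul_div_assoc]
  simp only [h]
  rw [Finset.sum_comm, BlockModel.wDeg, Finset.sum_div]
  refine Finset.sum_congr rfl fun l _ => ?_
  rw [← Finset.sum_filter, ← Finset.sum_mul, S.θ_sum, one_mul]

theorem groupSize_ne_zero (k : Fin K) : (S.groupSize k : ℝ) ≠ 0 := by
  obtain ⟨i, hi⟩ := S.wType_surjective k
  exact Nat.cast_ne_zero.mpr (Finset.card_ne_zero_of_mem (Finset.mem_filter.mpr
    ⟨Finset.mem_univ i, hi⟩))

/-- Grouping workers by type, the number of workers in a group cancels the denominator. -/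
theorem sum_meanAdj_col (j : Fin p) : ∑ i, S.meanAdj i j = S.fDeg j := by
  have h : ∀ i, S.meanAdj i j
      = ∑ k, if S.wType i = k then S.θ j * S.C k (S.fType j) / S.groupSize k else 0 :=
    fun i => by simp [BlockModel.meanAdj]
  simp only [h]
  rw [Finset.sum_comm, BlockModel.fDeg, Finset.mul_sum]
  refine Finset.sum_congr rfl fun k _ => ?_
  rw [← Finset.sum_filter, Finset.sum_const, nsmul_eq_mul]
  exact mul_div_cancel₀ _ (groupSize_ne_zero S k)

theorem wDeg_nonneg (k : Fin K) : 0 ≤ S.wDeg k :=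
  div_nonneg (Finset.sum_nonneg fun l _ => S.C_nonneg k l) (Nat.cast_nonneg _)

theorem fDeg_nonneg (j : Fin p) : 0 ≤ S.fDeg j :=
  mul_nonneg (S.θ_nonneg j) (Finset.sum_nonneg fun k _ => S.C_nonneg k _)

theorem wDegMin_le (k : Fin K) : S.wDegMin ≤ S.wDeg k := ciInf_le (Set.finite_range _).bddBelow k

theorem le_wDegMax (k : Fin K) : S.wDeg k ≤ S.wDegMax := le_ciSup (Set.finite_range _).bddAbove k

theorem fDegMin_le (j : Fin p) : S.fDegMin ≤ S.fDeg j := ciInf_le (Set.finite_range _).bddBelow j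

theorem le_fDegMax (j : Fin p) : S.fDeg j ≤ S.fDegMax := le_ciSup (Set.finite_range _).bddAbove j

theorem wDegMin_nonneg : 0 ≤ S.wDegMin := Real.iInf_nonneg (wDeg_nonneg S)

theorem fDegMin_nonneg : 0 ≤ S.fDegMin := Real.iInf_nonneg (fDeg_nonneg S)

theorem wDegMax_nonneg : 0 ≤ S.wDegMax := Real.iSup_nonneg (wDeg_nonneg S)

theorem fDegMax_nonneg : 0 ≤ S.fDegMax := Real.iSup_nonneg (fDeg_nonneg S)

theorem regDegree_inv_le_maxM {lamW lamF : ℝ} (hW : 0 < lamW) (hF : 0 < lamF)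
    (v : Fin n ⊕ Fin p) : (regDegree lamW lamF S.meanAdj v)⁻¹ ≤ S.maxM lamW lamF := by
  have hw := wDegMin_nonneg S
  have hf := fDegMin_nonneg S
  rcases v with i | j
  · rw [regDegree, Sum.elim_inl, sum_meanAdj_row]
    refine le_trans ?_ (le_max_left _ _)
    gcongr
    exact wDegMin_le S _
  · rw [regDegree, Sum.elim_inr, sum_meanAdj_col]
    refine le_trans ?_ (le_max_right _ _)
    gcongr
    exact fDegMin_le S _

theorem tailW_nonneg (lamW lamF : ℝ) : 0 ≤ S.tailW lamW lamF := by
  rw [BlockModel.tailW]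
  positivity

theorem tailF_nonneg (lamW lamF : ℝ) : 0 ≤ S.tailF lamW lamF := by
  rw [BlockModel.tailF]
  positivity

end Degrees

end RidgeFE

/-- The bounds on both sides hold simultaneously with probability at least `1 - 3 ε`. -/
theorem RidgeFE.variance_bounds_of_small {n p K : ℕ} (hK : 0 < K) (S : RidgeFE.BlockModel n p K)
    {Ω : Type*} [MeasurableSpace Ω] (P : Measure Ω) [IsProbabilityMeasure P]
    (net : Ω → RidgeFE.Network n p) (Uw : Fin n → Ω → ℝ) (Uf : Fin p → Ω → ℝ)
    (U : Fin n × Fin p → Ω → ℝ) (muStar phiStar : Fin K → ℝ)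
    (σ σw σf : ℝ) (hmodel : RidgeFE.IsRandomModel S P net Uw Uf U σ σw σf)
    (lamW lamF : ℝ) (hlamW : 0 < lamW) (hlamF : 0 < lamF)
    (ε : ℝ) (hε : 0 < ε) (hε5 : ε < 1 / 5)
    (hM : S.maxM lamW lamF ≤ (3 * Real.log (((n : ℝ) + p) / ε))⁻¹) :
    1 - 3 * ε ≤
      P.real {ω | ∀ tail, 0 ≤ tail →
        RidgeFE.specNorm
            (RidgeFE.wVariance S P muStar phiStar lamW lamF net Uw Uf U ω
              - RidgeFE.wVarianceEquiv lamW lamF σ σw σf S.meanAdj)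
          ≤ S.wBound lamW lamF σ σw σf ε tail ∧
        RidgeFE.specNorm
            (RidgeFE.fVariance S P muStar phiStar lamW lamF net Uw Uf U ω
              - RidgeFE.fVarianceEquiv lamW lamF σ σw σf S.meanAdj)
          ≤ S.fBound lamW lamF σ σw σf ε tail} := by
  obtain ⟨i₀, -⟩ := S.wType_surjective ⟨0, hK⟩
  -- Without firms the weights of a group would sum to 0 instead of 1.
  obtain ⟨j₀⟩ : Nonempty (Fin p) := by
    by_contra hne
    rw [not_nonempty_iff] at hne
    have := S.θ_sum ⟨0, hK⟩
    simp at this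
  have hn : (1 : ℝ) ≤ n := by exact_mod_cast i₀.pos
  have hp : (1 : ℝ) ≤ p := by exact_mod_cast j₀.pos
  set L := Real.log (((n : ℝ) + p) / ε) with hL_def
  set M := S.maxM lamW lamF with hM_def
  set t := S.rate lamW lamF ε with ht_def
  have hM0 : 0 < M := lt_max_of_lt_left (inv_pos.mpr (by linarith [RidgeFE.wDegMin_nonneg S]))
  -- Here `n + p ≥ 2` and `ε < 1/5`, so the argument of the logarithm exceeds 10, and `e² ≤ 10`.
  have hL : 2 ≤ L := by
    rw [hL_def, Real.le_log_iff_exp_le (by positivity), le_div_iff₀ hε]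
    have h1 : Real.exp 2 ≤ 10 := by
      have h := Real.exp_one_lt_d9
      have e : Real.exp 2 = Real.exp 1 ^ 2 := by rw [← Real.exp_nat_mul]; norm_num
      rw [e]
      nlinarith [Real.exp_pos 1]
    nlinarith [Real.exp_pos 2]
  have ht2 : t ^ 2 = 3 * M * L := Real.sq_sqrt (by positivity)
  have ht0 : 0 ≤ t := Real.sqrt_nonneg _
  have ht1 : t ≤ 1 := by
    have h1 : M * (3 * L) ≤ 1 := by
      have := mul_le_mul_of_nonneg_right hM (show 0 ≤ 3 * L by linarith)
      rwa [inv_mul_cancel₀ (by linarith)] at this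
    nlinarith
  have hexp : ((n : ℝ) + p) * Real.exp (-L) = ε := by
    rw [hL_def, Real.exp_neg, Real.exp_log (by positivity)]
    field_simp
  have hbad := RidgeFE.prob_not_isClose_le (A₀ := S.meanAdj)
    (fun i j => ⟨RidgeFE.meanAdj_nonneg S i j, RidgeFE.meanAdj_le_one S i j⟩) hlamW hlamF
    (RidgeFE.regDegree_inv_le_maxM S hlamW hlamF) hM0 hL ht0 ht1 ht2
    (RidgeFE.wDegMax_nonneg S) (RidgeFE.fDegMin_nonneg S)
    (fun i => (RidgeFE.sum_meanAdj_row S i).trans_le (RidgeFE.le_wDegMax S _))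
    (fun j => (RidgeFE.fDegMin_le S j).trans_eq (RidgeFE.sum_meanAdj_col S j).symm)
  rw [hexp, ← RidgeFE.measureReal_net_eq hmodel] at hbad
  set bad : Set Ω := {ω | (fun e : Fin n × Fin p => net ω e.1 e.2) ∈
    {g | ¬ RidgeFE.IsClose lamW lamF S.wDegMax S.fDegMin t (RidgeFE.adj g) S.meanAdj}} with hbad_def
  -- Subadditivity for the set and its complement avoids any measurability question.
  have hgood : 1 - 3 * ε ≤ P.real badᶜ := by
    have h1 := measureReal_union_le (μ := P) bad badᶜ
    rw [Set.union_compl_self, probReal_univ] at h1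
    linarith
  -- The inclusion of events is only almost sure, since the conditional variances are identified up
  -- to null sets.
  refine hgood.trans (ENNReal.toReal_mono (measure_ne_top _ _) (measure_mono_ae ?_))
  filter_upwards [RidgeFE.wVariance_ae_eq hmodel muStar phiStar hlamW hlamF,
    RidgeFE.fVariance_ae_eq hmodel muStar phiStar hlamW hlamF] with ω hw hf hω
  have hclose : RidgeFE.IsClose lamW lamF S.wDegMax S.fDegMin t (RidgeFE.netAdj (net ω))
      S.meanAdj := not_not.mp hω
  intro tail htail
  constructor
  · rw [hw]
    exact hclose.norm_wVarianceEquiv_sub (RidgeFE.wDegMin_nonneg S)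
      ((RidgeFE.wDegMin_le S (S.wType i₀)).trans (RidgeFE.le_wDegMax S _)) htail
  · rw [hf, RidgeFE.fVarianceEquiv_eq, RidgeFE.fVarianceEquiv_eq]
    exact (hclose.transpose (RidgeFE.fDegMax_nonneg S) (RidgeFE.wDegMin_nonneg S)
      (fun j => (RidgeFE.sum_meanAdj_col S j).trans_le (RidgeFE.le_fDegMax S j))
      (fun i => (RidgeFE.wDegMin_le S _).trans_eq
        (RidgeFE.sum_meanAdj_row S i).symm)).norm_wVarianceEquiv_sub (RidgeFE.fDegMin_nonneg S)
      ((RidgeFE.fDegMin_le S j₀).trans (RidgeFE.le_fDegMax S j₀)) htail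

end
theorem mainTheorem5 {n p K : ℕ} (hK : 0 < K) (S : RidgeFE.BlockModel n p K)
    {Ω : Type*} [MeasurableSpace Ω] (P : Measure Ω) [IsProbabilityMeasure P]
    (net : Ω → RidgeFE.Network n p) (Uw : Fin n → Ω → ℝ) (Uf : Fin p → Ω → ℝ)
    (U : Fin n × Fin p → Ω → ℝ) (muStar phiStar : Fin K → ℝ)
    (σ σw σf : ℝ) (hmodel : RidgeFE.IsRandomModel S P net Uw Uf U σ σw σf)
    (lamW lamF : ℝ) (hlamW : 0 < lamW) (hlamF : 0 < lamF)
    (ε : ℝ) (hε : 0 < ε)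
    (hM : S.maxM lamW lamF ≤ (3 * Real.log (((n : ℝ) + p) / ε))⁻¹)
    (γ : ℝ) (hγ : γ = (p : ℝ) / n) :
    1 - (13 + 6 * γ) / (1 + γ) * ε ≤
        P.real {ω |
          RidgeFE.specNorm
              (RidgeFE.wVariance S P muStar phiStar lamW lamF net Uw Uf U ω
                - RidgeFE.wVarianceEquiv lamW lamF σ σw σf S.meanAdj)
            ≤ S.wBound lamW lamF σ σw σf ε (S.tailF lamW lamF) ∧
          RidgeFE.specNorm
              (RidgeFE.wVariance S P muStar phiStar lamW lamF net Uw Uf U ω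
                - RidgeFE.wVarianceEquiv lamW lamF σ σw σf S.meanAdj)
            ≤ S.wBound lamW lamF σ σw σf ε (S.tailW lamW lamF)} ∧
    1 - (5 + 13 * γ) / (1 + γ) * ε ≤
        P.real {ω |
          RidgeFE.specNorm
              (RidgeFE.fVariance S P muStar phiStar lamW lamF net Uw Uf U ω
                - RidgeFE.fVarianceEquiv lamW lamF σ σw σf S.meanAdj)
            ≤ S.fBound lamW lamF σ σw σf ε (S.tailW lamW lamF)} := by
  have hγ0 : 0 ≤ γ := by rw [hγ]; positivity
  -- The value 5 serves twice: it exceeds the 3 of the union bound, and it makes the lower bound on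
  -- the probability non-positive as soon as `ε ≥ 1/5`.
  have hc1 : 5 ≤ (13 + 6 * γ) / (1 + γ) := by
    rw [le_div_iff₀ (by linarith)]
    linarith
  have hc2 : 5 ≤ (5 + 13 * γ) / (1 + γ) := by
    rw [le_div_iff₀ (by linarith)]
    linarith
  have h1 := mul_le_mul_of_nonneg_right hc1 hε.le
  have h2 := mul_le_mul_of_nonneg_right hc2 hε.le
  rcases le_or_gt (1 / 5) ε with hε5 | hε5
  · exact ⟨le_trans (by linarith) measureReal_nonneg, le_trans (by linarith) measureReal_nonneg⟩
  · have key := RidgeFE.variance_bounds_of_small hK S P net Uw Uf U muStar phiStar σ σw σf hmodel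
      lamW lamF hlamW hlamF ε hε hε5 hM
    constructor
    · refine le_trans (le_trans (by linarith) key) (measureReal_mono fun ω hω => ?_)
      exact ⟨(hω _ (RidgeFE.tailF_nonneg S lamW lamF)).1,
        (hω _ (RidgeFE.tailW_nonneg S lamW lamF)).1⟩
    · refine le_trans (le_trans (by linarith) key) (measureReal_mono fun ω hω => ?_)
      exact (hω _ (RidgeFE.tailW_nonneg S lamW lamF)).2
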